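/- **Theorem 3.** Let $m,n,l$ be non-negative integers with $l\le n\le m+l$, let $A_1,\dots,A_n\subset\mathbb Z_{\ge0}^m$ be finite sets, $\lambda_1,\dots,\lambda_l\in\mathbb C$, $\beta_1,\dots,\beta_m\in\mathbb C$, and consider polynomials $$f_i(x)=\sum_{j\in A_i}a_{ij}x^j,\qquad 1\le i\le n,\quad x=(x_1,\dots,x_m),\quad x^j=x_1^{j_1}\cdots x_m^{j_m},$$ with coefficient vector $a=(a_{ij})$. Let $X_a$ be the set of points $x\in\mathbb C^m$ with $f_{l+1}(x)=\dots=f_n(x)=0$ at which the differentials $df_{l+1},\dots,df_n$ are linearly independent, at which $f_i(x)\ne0$ for every $i\le l$ with $\lambda_i\notin\mathbb Z_{\ge0}$, and at which $x_p\neq0$ for every $p$ with $\beta_p\notin\mathbb Z_{\ge1}$. Put $k=m-(n-l)$. The Gelfand–Leray form is the multivalued holomorphic $k$-form on $X_a$ $$\eta_a=f_1^{\lambda_1}\cdots f_l^{\lambda_l}\,x_1^{\beta_1-1}\cdots x_m^{\beta_m-1}\,\frac{dx_1\wedge\dots\wedge dx_m}{df_{l+1}\wedge\dots\wedge df_n}\Big|_{X_a},$$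 that is, the restriction to $X_a$ of a form $\eta$ with $df_{l+1}\wedge\dots\wedge df_n\wedge\eta=f_1^{\lambda_1}\cdots f_l^{\lambda_l}x_1^{\beta_1-1}\cdots x_m^{\beta_m-1}dx_1\wedge\dots\wedge dx_m$. Let $\mathcal L_a$ be the rank one local system on $X_a$ determined by the branches of $f_1^{\lambda_1}\cdots f_l^{\lambda_l}x_1^{\beta_1-1}\cdots x_m^{\beta_m-1}$ (powers with exponents in $\mathbb Z_{\ge0}$ being single valued). Cycles are smooth singular cubical $k$-cycles on $X_a$ with values in $\mathcal L_a$. A family $(C_a)_{a\in U}$ of cycles over an open set $U$ of coefficient vectors is a twisted singular chain whose cubes and sections of the local system depend on $a$, the cubes smoothly in $a$ and the point of the cube, the sections horizontally, and whose boundary vanishes as a family (modulo degenerate cubes). Then: 1. Every cycle $C$ on $X_{a^0}$ with values in $\mathcal L_{a^0}$ extends to a family $(C_a)$ of cycles over some neighbourhood of $a^0$. 2. If two families over an open set containing $a^0$ coincide at $a^0$, then the integrals $\oint_{C_a}\eta_a$ over them coincide for all $a$ near $a^0$. Thus a cycle at $a^0$ defines the germ at $a^0$ of a function of the coefficients. 3.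 For every family $(C_a)_{a\in U}$ over an open set $U$, the Gelfand–Leray integral $$\Phi(a)=\oint_{C_a}\eta_a$$ is an $A$-hypergeometric function of the coefficients of $f_1,\dots,f_n$ on $U$, where $A=\{(e_i,j):1\le i\le n,\ j\in A_i\}\subset\mathbb Z^{n+m}$, with exponents $(\lambda_1,\dots,\lambda_l,-1,\dots,-1,-\beta_1,\dots,-\beta_m)$. That is, $\Phi$ is holomorphic on $U$ and there $$\frac{\partial^q\Phi}{\partial a_{i_1j_{(1)}}\cdots\partial a_{i_qj_{(q)}}}=\frac{\partial^{q'}\Phi}{\partial a_{i'_1j'_{(1)}}\cdots\partial a_{i'_{q'}j'_{(q')}}}\quad\text{whenever}\quad\sum_{s=1}^{q}(e_{i_s},j_{(s)})=\sum_{s=1}^{q'}(e_{i'_s},j'_{(s)}),$$ $$\sum_{j}a_{ij}\frac{\partial\Phi}{\partial a_{ij}}=\lambda_i\Phi\ (i\le l),\qquad \sum_{j}a_{ij}\frac{\partial\Phi}{\partial a_{ij}}=-\Phi\ (l<i\le n),\qquad \sum_{i,j}j_p\,a_{ij}\frac{\partial\Phi}{\partial a_{ij}}=-\beta_p\Phi\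 (1\le p\le m).$$ -/

import Mathlib

open scoped ContDiff Topology

noncomputable section

namespace GelfandLeray

/-! ### `A`-hypergeometric (Gelfand-Kapranov-Zelevinsky) systems -/

/-- The partial derivative `∂Φ/∂a_w` of a function of the complex variables `a_w`, `w ∈ Ω`. -/
def partialDeriv {Ω : Type*} [Fintype Ω] [DecidableEq Ω] (w : Ω) (Φ : (Ω → ℂ) → ℂ) :
    (Ω → ℂ) → ℂ :=
  fun a => fderiv ℂ Φ a (Pi.single w 1)

/-- The iterated partial derivative `∂^q Φ / ∂a_{w₁} ⋯ ∂a_{w_q}`. -/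
def iteratedPartialDeriv {Ω : Type*} [Fintype Ω] [DecidableEq Ω] (L : List Ω)
    (Φ : (Ω → ℂ) → ℂ) : (Ω → ℂ) → ℂ :=
  L.foldr partialDeriv Φ

/-- `Φ` is, on the open set `U`, an `A`-hypergeometric function with exponents `γ`, where
`A = {A_w : w ∈ Ω} ⊆ ℤ^ι`: it is holomorphic and solves the toric equations and the
homogeneity (Euler) equations. -/
structure IsAHypergeometricOn {Ω ι : Type*} [Fintype Ω] [DecidableEq Ω]
    (A : Ω → ι → ℤ) (γ : ι → ℂ) (U : Set (Ω → ℂ)) (Φ : (Ω → ℂ) → ℂ) : Prop where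
  holomorphic : DifferentiableOn ℂ Φ U
  toric : ∀ L L' : List Ω, (L.map A).sum = (L'.map A).sum →
    ∀ a ∈ U, iteratedPartialDeriv L Φ a = iteratedPartialDeriv L' Φ a
  euler : ∀ q : ι, ∀ a ∈ U, ∑ w : Ω, (A w q : ℂ) * a w * partialDeriv w Φ a = γ q * Φ a

/-! ### Polynomials with indeterminate coefficients -/

/-- The index set of the coefficients `a_{ij}`, for `j` in the support `supp i ⊆ ℕ^m`. -/
abbrev CoeffIndex {κ : Type*} {m : ℕ} (supp : κ → Finset (Fin m →₀ ℕ)) : Type _ :=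
  (i : κ) × {j // j ∈ supp i}

/-- The polynomial `f_i = ∑_{j ∈ supp i} a_{ij} x^j`. -/
def poly {κ : Type*} {m : ℕ} (supp : κ → Finset (Fin m →₀ ℕ)) (a : CoeffIndex supp → ℂ) (i : κ) :
    MvPolynomial (Fin m) ℂ :=
  ∑ j : {j // j ∈ supp i}, MvPolynomial.monomial j.1 (a ⟨i, j⟩)

/-- The vector `(e_i, j) ∈ ℤ^κ ⊕ ℤ^m` attached to the coefficient `a_{ij}`. -/
def exponentVector {κ : Type*} [DecidableEq κ] {m : ℕ} (supp : κ → Finset (Fin m →₀ ℕ))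
    (w : CoeffIndex supp) : κ ⊕ Fin m → ℤ :=
  Sum.elim (Pi.single w.1 1) (fun p => (w.2.1 p : ℤ))

/-- The exponents `(λ_1, …, λ_l, -1, …, -1, -β_1, …, -β_m)` of the hypergeometric system. -/
def hypergeometricExponents {l r m : ℕ} (lam : Fin l → ℂ) (β : Fin m → ℂ) :
    (Fin l ⊕ Fin r) ⊕ Fin m → ℂ :=
  Sum.elim (Sum.elim lam (fun _ => -1)) (fun p => -β p)

/-! ### The form `dx_1 ∧ ⋯ ∧ dx_m / (df_{l+1} ∧ ⋯ ∧ df_n)` -/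

/-- The differential of a polynomial at a point, as a linear form. -/
def differential {m : ℕ} (f : MvPolynomial (Fin m) ℂ) (x : Fin m → ℂ) :
    (Fin m → ℂ) →ₗ[ℂ] ℂ :=
  ∑ p : Fin m, MvPolynomial.eval x (MvPolynomial.pderiv p f) • LinearMap.proj p

/-- The exterior product `d_1 ∧ ⋯ ∧ d_r` of linear forms. -/
def wedgeOneForms {V : Type*} [AddCommGroup V] [Module ℂ V] {r : ℕ} (d : Fin r → V →ₗ[ℂ] ℂ) :
    V [⋀^Fin r]→ₗ[ℂ] ℂ :=
  Matrix.detRowAlternating.compLinearMap (LinearMap.pi d)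

/-- The exterior product of two complex valued alternating forms. -/
def wedge {V : Type*} [AddCommGroup V] [Module ℂ V] {r k : ℕ}
    (θ : V [⋀^Fin r]→ₗ[ℂ] ℂ) (η : V [⋀^Fin k]→ₗ[ℂ] ℂ) : V [⋀^Fin r ⊕ Fin k]→ₗ[ℂ] ℂ :=
  (LinearMap.mul' ℂ ℂ).compAlternatingMap (θ.domCoprod η)

/-- The form `dx_1 ∧ ⋯ ∧ dx_m`, `m = r + k`; its arguments are `r` vectors followed by `k`
vectors. -/
def volumeForm (r k : ℕ) : (Fin (r + k) → ℂ) [⋀^Fin r ⊕ Fin k]→ₗ[ℂ] ℂ :=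
  Matrix.detRowAlternating.domDomCongr finSumFinEquiv.symm

/-- `η` is a quotient `dx_1 ∧ ⋯ ∧ dx_m / (d_1 ∧ ⋯ ∧ d_r)`. -/
def IsQuotientForm {r k : ℕ} (d : Fin r → (Fin (r + k) → ℂ) →ₗ[ℂ] ℂ)
    (η : (Fin (r + k) → ℂ) [⋀^Fin k]→ₗ[ℂ] ℂ) : Prop :=
  wedge (wedgeOneForms d) η = volumeForm r k

/-- If the vectors `v` lie in `⋂ ker d_i`, then
`(d_1 ∧ ⋯ ∧ d_r ∧ η)(w, v) = det (d_e (w_j)) η(v)`; in particular quotients are unique on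
`⋂ ker d_i`. -/
theorem wedge_apply_of_ker {r k : ℕ} (d : Fin r → (Fin (r + k) → ℂ) →ₗ[ℂ] ℂ)
    (η : (Fin (r + k) → ℂ) [⋀^Fin k]→ₗ[ℂ] ℂ) (w : Fin r → Fin (r + k) → ℂ)
    (v : Fin k → Fin (r + k) → ℂ) (hv : ∀ e q, d e (v q) = 0) :
    wedge (wedgeOneForms d) η (Sum.elim w v) = Matrix.det (Matrix.of fun j e => d e (w j)) * η v := by
  have h1 : wedge (wedgeOneForms d) η (Sum.elim w v) = ∑ σ : Equiv.Perm.ModSumCongr (Fin r) (Fin k),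
      LinearMap.mul' ℂ ℂ (AlternatingMap.domCoprod.summand (wedgeOneForms d) η σ (Sum.elim w v)) := by
    simp [wedge, AlternatingMap.domCoprod_apply]
  refine h1.trans ((Fintype.sum_eq_single
    (Quotient.mk'' 1 : Equiv.Perm.ModSumCongr (Fin r) (Fin k)) ?_).trans ?_)
  · intro σ hσ
    induction σ using Quotient.inductionOn' with | _ σ
    rw [AlternatingMap.domCoprod.summand_mk'']
    have : ∃ i q, σ (Sum.inl i) = Sum.inr q := by
      by_contra hcon
      push Not at hcon
      apply hσ
      apply Quotient.sound'
      rw [QuotientGroup.leftRel_apply]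
      have hm : σ ∈ (Equiv.Perm.sumCongrHom (Fin r) (Fin k)).range := by
        apply Equiv.Perm.mem_sumCongrHom_range_of_perm_mapsTo_inl
        rintro _ ⟨i, rfl⟩
        rcases hs : σ (Sum.inl i) with j | q
        · exact ⟨j, rfl⟩
        · exact absurd hs (hcon i q)
      simpa using hm
    obtain ⟨i, q, hi⟩ := this
    have h0 : wedgeOneForms d (fun i => Sum.elim w v (σ (Sum.inl i))) = 0 := by
      change Matrix.det (fun j e => d e (Sum.elim w v (σ (Sum.inl j)))) = 0
      apply Matrix.det_eq_zero_of_row_eq_zero i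
      intro e
      simp [hi, hv]
    simp [MultilinearMap.domCoprod_apply, h0]
  · rw [AlternatingMap.domCoprod.summand_mk'']
    simp [MultilinearMap.domCoprod_apply, wedgeOneForms, Matrix.detRowAlternating]
    left
    rfl

/-- A quotient by linearly independent linear forms exists. -/
theorem exists_isQuotientForm {r k : ℕ} (d : Fin r → (Fin (r + k) → ℂ) →ₗ[ℂ] ℂ)
    (hd : LinearIndependent ℂ d) : ∃ η, IsQuotientForm d η := by
  let D : (Fin (r + k) → ℂ) →ₗ[ℂ] (Fin r → ℂ) := LinearMap.pi d
  have hsurj : LinearMap.range D = ⊤ := by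
    by_contra hne
    obtain ⟨f, hf, hle⟩ := Submodule.exists_le_ker_of_lt_top _ (lt_top_iff_ne_top.2 hne)
    apply hf
    have hz : ∑ e, f (Pi.single e 1) • d e = 0 := by
      refine LinearMap.ext fun x => ?_
      have hx : f (D x) = 0 := hle ⟨x, rfl⟩
      rw [LinearMap.pi_apply_eq_sum_univ f (D x)] at hx
      have hs : ∀ i : Fin r, (fun j => if i = j then (1 : ℂ) else 0) = Pi.single i 1 := by
        intro i
        ext j
        simp [Pi.single_apply, eq_comm]
      simp only [hs] at hx
      simpa [D, mul_comm] using hx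
    have := Fintype.linearIndependent_iff.1 hd _ hz
    refine LinearMap.pi_ext' fun e => ?_
    ext1
    simpa using this e
  obtain ⟨S, hS⟩ := D.exists_rightInverse_of_surjective hsurj
  have hker : Module.finrank ℂ (LinearMap.ker D) = k := by
    have := D.finrank_range_add_finrank_ker
    rw [hsurj] at this
    simp at this
    omega
  let b := Module.finBasisOfFinrankEq ℂ (LinearMap.ker D) hker
  let w : Fin r → (Fin (r + k) → ℂ) := fun j => S (Pi.single j 1)
  let v : Fin k → (Fin (r + k) → ℂ) := fun q => (b q : Fin (r + k) → ℂ)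
  have hDS : ∀ y, D (S y) = y := fun y => LinearMap.congr_fun hS y
  have hDv : ∀ q, D (v q) = 0 := fun q => (b q).2
  have hli : LinearIndependent ℂ (Sum.elim w v) := by
    rw [Fintype.linearIndependent_iff]
    intro g hg
    rw [Fintype.sum_sum_type] at hg
    simp only [Sum.elim_inl, Sum.elim_inr] at hg
    have h1 : ∀ j, g (Sum.inl j) = 0 := by
      intro j
      have := congrFun (congrArg D hg) j
      simpa [hDv, w, hDS, Finset.sum_apply, Pi.single_apply] using this
    have h2 : ∀ q, g (Sum.inr q) = 0 := by
      have h3 : ∑ q, g (Sum.inr q) • b q = 0 := by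
        apply Subtype.ext
        simpa [h1, v] using hg
      exact Fintype.linearIndependent_iff.1 b.linearIndependent _ h3
    rintro (j | q)
    · exact h1 j
    · exact h2 q
  have hcard : Fintype.card (Fin r ⊕ Fin k) = Module.finrank ℂ (Fin (r + k) → ℂ) := by simp
  let B : Module.Basis (Fin r ⊕ Fin k) ℂ (Fin (r + k) → ℂ) :=
    Module.Basis.mk hli (hli.span_eq_top_of_card_eq_finrank' hcard).ge
  have hB : ⇑B = Sum.elim w v := Module.Basis.coe_mk _ _
  let P : (Fin (r + k) → ℂ) →ₗ[ℂ] LinearMap.ker D :=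
    (LinearMap.id - S ∘ₗ D).codRestrict _ (fun x => by simp [hDS])
  have hP : ∀ q, P (v q) = b q := fun q => Subtype.ext (by simp [P, hDv, v])
  refine ⟨volumeForm r k (Sum.elim w v) • b.det.compLinearMap P, ?_⟩
  unfold IsQuotientForm
  rw [AlternatingMap.eq_smul_basis_det B (wedge _ _),
    AlternatingMap.eq_smul_basis_det B (volumeForm r k), hB]
  congr 1
  rw [wedge_apply_of_ker d _ w v (fun e q => congrFun (hDv q) e)]
  have h1 : (Matrix.of fun j e => d e (w j)) = 1 := by
    ext j e
    have := congrFun (hDS (Pi.single j 1)) e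
    simpa [Matrix.one_apply, D, w, Pi.single_apply, eq_comm] using this
  rw [h1, Matrix.det_one, one_mul, AlternatingMap.smul_apply, AlternatingMap.compLinearMap_apply]
  have h2 : (fun q => P (v q)) = b := funext hP
  rw [h2, b.det_self, smul_eq_mul, mul_one]
  rw [← hB, AlternatingMap.smul_apply, B.det_self, smul_eq_mul, mul_one]

open Classical in
/-- A quotient `dx_1 ∧ ⋯ ∧ dx_m / (d_1 ∧ ⋯ ∧ d_r)`. It exists if the `d_i` are linearly
independent, and then its restriction to `⋂ ker d_i` does not depend on the choice. -/
def quotientForm {r k : ℕ} (d : Fin r → (Fin (r + k) → ℂ) →ₗ[ℂ] ℂ) :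
    (Fin (r + k) → ℂ) [⋀^Fin k]→ₗ[ℂ] ℂ :=
  if h : ∃ η, IsQuotientForm d η then h.choose else 0

/-! ### The variety and the rank one local system -/

/-- The functions `f_1, …, f_l, x_1, …, x_m` whose complex powers occur in the integrand. -/
def factor {l r m : ℕ} (supp : Fin l ⊕ Fin r → Finset (Fin m →₀ ℕ))
    (a : CoeffIndex supp → ℂ) (x : Fin m → ℂ) : Fin l ⊕ Fin m → ℂ :=
  Sum.elim (fun i => MvPolynomial.eval x (poly supp a (Sum.inl i))) x

/-- The exponents `λ_1, …, λ_l, β_1 - 1, …, β_m - 1` of these powers. -/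
def factorExponent {l m : ℕ} (lam : Fin l → ℂ) (β : Fin m → ℂ) : Fin l ⊕ Fin m → ℂ :=
  Sum.elim lam (fun p => β p - 1)

/-- `s` is a natural number, i.e. `z ↦ z ^ s` is holomorphic and single valued on all of `ℂ`. -/
def IsNat (s : ℂ) : Prop := ∃ N : ℕ, s = N

open Classical in
/-- The product of the powers with natural exponents: a single valued holomorphic factor. -/
def singleValuedPart {Q : Type*} [Fintype Q] (s z : Q → ℂ) : ℂ :=
  ∏ q, if IsNat (s q) then z q ^ s q else 1

/-- The points of the variety `f_{l+1} = ⋯ = f_n = 0` at which the multivalued form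
`f_1^{λ_1} ⋯ f_l^{λ_l} x^{β-1} dx / (df_{l+1} ∧ ⋯ ∧ df_n)` is defined and holomorphic:
`df_{l+1}, …, df_n` are linearly independent, and a factor may vanish only if its exponent is a
natural number. -/
def variety {l r k : ℕ} (supp : Fin l ⊕ Fin r → Finset (Fin (r + k) →₀ ℕ))
    (lam : Fin l → ℂ) (β : Fin (r + k) → ℂ) (a : CoeffIndex supp → ℂ) : Set (Fin (r + k) → ℂ) :=
  {x | (∀ i, MvPolynomial.eval x (poly supp a (Sum.inr i)) = 0) ∧
    LinearIndependent ℂ (fun i => differential (poly supp a (Sum.inr i)) x) ∧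
    ∀ q, ¬ IsNat (factorExponent lam β q) → factor supp a x q ≠ 0}

open Classical in
/-- `g` is, over `D ⊆ T`, a horizontal section of (the pull-back to `D` of) the rank one local
system generated by the branches of `∏ φ_q ^ s_q`. Factors with natural exponents are single
valued and do not contribute; locally `g` is a constant multiple of a branch of the product of the
other ones. -/
def IsHorizontalOn {T Q : Type*} [TopologicalSpace T] [Fintype Q] (D : Set T)
    (φ : Q → T → ℂ) (s : Q → ℂ) (g : T → ℂ) : Prop :=
  ∀ y ∈ D, ∃ W ∈ 𝓝[D] y, ∃ (c : ℂ) (ℓ : Q → T → ℂ),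
    (∀ q, ¬ IsNat (s q) → ContinuousOn (ℓ q) W ∧ ∀ t ∈ W, Complex.exp (ℓ q t) = φ q t) ∧
    ∀ t ∈ W, g t = c * Complex.exp (∑ q, if IsNat (s q) then 0 else s q * ℓ q t)

/-! ### Singular cubical cycles with values in the local system -/

/-- The unit cube `[0,1]^k`. -/
abbrev unitCube (k : ℕ) : Set (Fin k → ℝ) := Set.Icc 0 1

/-- The face `t_j = ε` of the `(k+1)`-cube, `ε ∈ {0, 1}`, parametrized by the `k`-cube. -/
def face {k : ℕ} (j : Fin (k + 1)) (ε : Fin 2) (s : Fin k → ℝ) : Fin (k + 1) → ℝ :=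
  Fin.insertNth (α := fun _ => ℝ) j ((ε : ℕ) : ℝ) s

/-- The family of singular cubes `τ a`, `a ∈ S`, is degenerate: it does not depend on one of the
coordinates of the cube. -/
def IsDegenerateOn {P E : Type*} {k : ℕ} (S : Set P) (τ : P → (Fin k → ℝ) → E) : Prop :=
  ∃ q : Fin k, ∀ a ∈ S, ∀ s ∈ unitCube k, ∀ u ∈ Set.Icc (0 : ℝ) 1,
    τ a (Function.update s q u) = τ a s

/-- The two families of singular cubes, over `a ∈ S`, are equal. -/
def SameOn {P E : Type*} {k : ℕ} (S : Set P) (τ τ' : P → (Fin k → ℝ) → E) : Prop :=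
  ∀ a ∈ S, ∀ s ∈ unitCube k, τ a s = τ' a s

open Classical in
/-- The boundary of the twisted singular chain `∑ σ_i ⊗ g_i` (a family over `a ∈ S`) vanishes
modulo degenerate cubes: each nondegenerate cube that occurs as a face has total coefficient
zero. A triple `(i, j, ε)` stands for the face `t_j = ε` of the `i`-th cube. -/
def IsClosedOn {P E : Type*} (S : Set P) {N : ℕ} : {k : ℕ} →
    (Fin N → P → (Fin k → ℝ) → E) → (Fin N → P → (Fin k → ℝ) → ℂ) → Prop
  | 0, _, _ => True
  | k + 1, σ, g => ∀ F₀ : Fin N × Fin (k + 1) × Fin 2,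
      ¬ IsDegenerateOn S (fun a s => σ F₀.1 a (face F₀.2.1 F₀.2.2 s)) →
      ∀ a ∈ S, ∀ s ∈ unitCube k,
        ∑ F : Fin N × Fin (k + 1) × Fin 2,
          (if SameOn S (fun a s => σ F.1 a (face F.2.1 F.2.2 s))
              (fun a s => σ F₀.1 a (face F₀.2.1 F₀.2.2 s))
            then (-1 : ℂ) ^ ((F.2.1 : ℕ) + (F.2.2 : ℕ)) * g F.1 a (face F.2.1 F.2.2 s)
            else 0) = 0

/-- The data of a family of twisted singular cubical `k`-chains with `N` cubes, parametrized by
the coefficients: the cubes in `ℂ^m`, `m = r + k`, and the sections of the local system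
along them. -/
structure TwistedChain {l r k : ℕ} (supp : Fin l ⊕ Fin r → Finset (Fin (r + k) →₀ ℕ))
    (N : ℕ) where
  cube : Fin N → (CoeffIndex supp → ℂ) → (Fin k → ℝ) → (Fin (r + k) → ℂ)
  sect : Fin N → (CoeffIndex supp → ℂ) → (Fin k → ℝ) → ℂ

/-- `C` is a family, over the set `S` of coefficient vectors, of smooth singular cycles on the
varieties `f_{l+1} = ⋯ = f_n = 0` with values in the local system of the integrand. Over
`S = {a₀}` this is one such cycle, on the variety given by `a₀`; over an open set it is a
smooth (horizontal) deformation of cycles along with the coefficients. -/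
structure TwistedChain.IsCycleOn {l r k N : ℕ}
    {supp : Fin l ⊕ Fin r → Finset (Fin (r + k) →₀ ℕ)}
    (C : TwistedChain supp N) (lam : Fin l → ℂ) (β : Fin (r + k) → ℂ)
    (S : Set (CoeffIndex supp → ℂ)) : Prop where
  smooth : ∀ i, ContDiffOn ℝ ∞ (fun y : (CoeffIndex supp → ℂ) × (Fin k → ℝ) => C.cube i y.1 y.2)
    (S ×ˢ unitCube k)
  mem_variety : ∀ i, ∀ a ∈ S, ∀ t ∈ unitCube k, C.cube i a t ∈ variety supp lam β a
  horizontal : ∀ i, IsHorizontalOn (S ×ˢ unitCube k)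
    (fun q (y : (CoeffIndex supp → ℂ) × (Fin k → ℝ)) => factor supp y.1 (C.cube i y.1 y.2) q)
    (factorExponent lam β) (fun y => C.sect i y.1 y.2)
  closed : IsClosedOn S C.cube C.sect

/-- `C` and `C'` are the same twisted chain at the coefficient vector `a`. -/
def TwistedChain.AgreeAt {l r k N : ℕ} {supp : Fin l ⊕ Fin r → Finset (Fin (r + k) →₀ ℕ)}
    (C C' : TwistedChain supp N) (a : CoeffIndex supp → ℂ) : Prop :=
  ∀ i, ∀ t ∈ unitCube k, C.cube i a t = C'.cube i a t ∧ C.sect i a t = C'.sect i a t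

/-- The Gelfand-Leray integral
`∮_{C_a} f_1^{λ_1} ⋯ f_l^{λ_l} x^{β-1} dx_1 ∧ ⋯ ∧ dx_m / (df_{l+1} ∧ ⋯ ∧ df_n)`,
as a function of the coefficients `a` of `f_1, …, f_n`. -/
def TwistedChain.integral {l r k N : ℕ} {supp : Fin l ⊕ Fin r → Finset (Fin (r + k) →₀ ℕ)}
    (C : TwistedChain supp N) (lam : Fin l → ℂ) (β : Fin (r + k) → ℂ)
    (a : CoeffIndex supp → ℂ) : ℂ :=
  ∑ i, ∫ t in unitCube k,
    C.sect i a t * singleValuedPart (factorExponent lam β) (factor supp a (C.cube i a t)) *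
      quotientForm (fun e => differential (poly supp a (Sum.inr e)) (C.cube i a t))
        (fun q => fderivWithin ℝ (C.cube i a) (unitCube k) t (Pi.single q 1))

end GelfandLeray

end

noncomputable section

open Set Filter MeasureTheory

namespace GelfandLeray

/-! ### The volume form and the pointwise Stokes formula -/

/-! The proof is Leray's residue method. Let `ω_a` be the form `f_1^{λ_1} ⋯ f_l^{λ_l} x^{β-1} dx /
(f_{l+1} ⋯ f_n)`. Its integral over a thin torus bundle `|f_e| = ε` around a cycle `C_a` is
`(2πi)^r` times the integral of the Gelfand-Leray form over `C_a`. Away from its poles and branch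
points `ω_a` is holomorphic of top degree, hence closed, so by Stokes the bundle may be moved. For
`a` near `a₀` it can be replaced by the bundle over the fixed cycle `C_{a₀}`, and then the
coefficients occur only in the integrand (`IsGoodRadius.integral_eq`). On this fixed domain
everything is elementary. Integrals of equal data at `a₀` agree near `a₀`. Differentiation under the
integral gives holomorphy; each `∂/∂a_{ij}` replaces the power of `f_i` by its derivative and
multiplies by `x^j`, so an iterated derivative depends only on the sum of the vectors `(e_i, j)`,
which is the toric system. Scaling `f_i` scales the integrand. Scaling the coefficients by `e^{s
j_p}` amounts to dilating `x_p`, which is another deformation of the tube. These two scalings give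
the Euler equations. The geometric input is a tube `Ψ(x, b, w)` near the compact support of a cycle,
with `f_e(Ψ) = w_e` for the coefficients `b` and `Ψ(x, b, 0) = x` on the variety of `b`. It comes
from the inverse function theorem, applied to displacements along conjugate gradients
(`exists_tube`). At `w = 0` it carries a cycle at `a₀` to nearby varieties, which is the
continuation claim; at `|w_e| = ε` it parametrizes the torus bundles. Stokes' theorem enters once,
infinitesimally: `hasDerivAt_sweep_integral` says that the integral has zero derivative along any
one-parameter deformation. It is used to move the base cycle, to shrink the radius, and to dilate a
coordinate. Its proof has three ingredients: the pointwise identity `d(G dx) = 0` along a map,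
periodicity in the circle variables, and cancellation of the fluxes through the faces of the cycle.
Cubes are precomposed with `cubeParam`, which turns smoothness on a closed cube into smoothness on
all of `ℝ^k`. -/

theorem volumeForm_apply (r k : ℕ) (v : Fin r ⊕ Fin k → Fin (r + k) → ℂ) :
    volumeForm r k v = Matrix.det (Matrix.of fun i => v (finSumFinEquiv.symm i)) := rfl

/-- The volume form as a continuous real multilinear map. -/
def volumeCMM (r k : ℕ) :
    ContinuousMultilinearMap ℝ (fun _ : Fin r ⊕ Fin k => Fin (r + k) → ℂ) ℂ where
  toMultilinearMap := (volumeForm r k).toMultilinearMap.restrictScalars ℝ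
  cont := by
    change Continuous fun v : Fin r ⊕ Fin k → Fin (r + k) → ℂ =>
      Matrix.det (Matrix.of fun i => v (finSumFinEquiv.symm i))
    refine Continuous.matrix_det ?_
    refine continuous_pi fun i => ?_
    exact continuous_apply _

@[simp]
theorem volumeCMM_apply (r k : ℕ) (v : Fin r ⊕ Fin k → Fin (r + k) → ℂ) :
    volumeCMM r k v = volumeForm r k v := rfl

/-- Cramer's rule for the volume form. -/
theorem map_mul_volumeForm {r k : ℕ} (L : (Fin (r + k) → ℂ) →ₗ[ℂ] ℂ)
    (w : Fin r ⊕ Fin k → Fin (r + k) → ℂ) (v : Fin (r + k) → ℂ) :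
    L v * volumeForm r k w = ∑ j, L (w j) * volumeForm r k (Function.update w j v) := by
  let A : Matrix (Fin (r + k)) (Fin (r + k)) ℂ := Matrix.of fun i => w (finSumFinEquiv.symm i)
  -- The vector form of Cramer's rule, `det(w) v = ∑ det(w with v in place of w_j) w_j`; applying
  -- `L` gives the claim.
  have h1 : volumeForm r k w • v = ∑ j, volumeForm r k (Function.update w j v) • w j := by
    have h2 := Matrix.mulVec_cramer A.transpose v
    rw [Matrix.det_transpose] at h2
    rw [volumeForm_apply]
    refine h2.symm.trans ?_
    rw [← (finSumFinEquiv (m := r) (n := k)).symm.sum_comp]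
    ext p
    simp only [Matrix.mulVec, dotProduct, Finset.sum_apply, Pi.smul_apply, smul_eq_mul]
    refine Finset.sum_congr rfl fun i _ => ?_
    rw [Matrix.cramer_transpose_apply, mul_comm]
    congr 1
    rw [volumeForm_apply]
    congr 1
    ext i' p'
    rcases eq_or_ne i' i with rfl | hne
    · simp [A]
    · simp [A, hne, Function.update_of_ne]
  have h3 := congrArg L h1
  rw [map_smul, map_sum] at h3
  simp only [map_smul, smul_eq_mul] at h3
  rw [mul_comm, h3]
  exact Finset.sum_congr rfl fun j _ => mul_comm _ _

/-- Exchanging the roles of `i` and `j` transposes two arguments of `f` and leaves `B` unchanged, so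
the sum is its own negative. This removes the mixed second derivatives when a pulled back form is
differentiated. -/
theorem sum_update_update_eq_zero {V ι : Type*} [AddCommGroup V] [Module ℂ V] [Fintype ι]
    [DecidableEq ι] (f : V [⋀^ι]→ₗ[ℂ] ℂ) (w : ι → V) (v : V) (B : ι → ι → V)
    (hB : ∀ i j, B i j = B j i) :
    ∑ j, ∑ i ∈ Finset.univ.erase j,
      f (Function.update (Function.update w j v) i (B j i)) = 0 := by
  have h1 : ∀ i j : ι, i ≠ j → f (Function.update (Function.update w j v) i (B j i)) =
      - f (Function.update (Function.update w i v) j (B i j)) := by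
    intro i j hij
    rw [← f.map_swap _ hij]
    congr 1
    ext q
    simp only [Function.comp_apply, Function.update_apply, Equiv.swap_apply_def]
    rcases eq_or_ne q i with rfl | hqi
    · simp [hB]
    · rcases eq_or_ne q j with rfl | hqj
      · simp [hij, hij.symm]
      · simp [hqi, hqj]
  have h2 : ∀ F : ι → ι → ℂ, ∑ j, ∑ i ∈ Finset.univ.erase j, F j i =
      ∑ j, ∑ i, if i ≠ j then F j i else 0 := by
    intro F
    refine Finset.sum_congr rfl fun j _ => ?_
    rw [← Finset.sum_filter]
    congr 1
    ext
    simp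
  rw [h2]
  have h3 := Finset.sum_comm (s := (Finset.univ : Finset ι)) (t := (Finset.univ : Finset ι))
    (f := fun j i => if i ≠ j then
      f (Function.update (Function.update w j v) i (B j i)) else 0)
  have h4 : ∑ y : ι, ∑ x : ι, (if y ≠ x then
      f (Function.update (Function.update w x v) y (B x y)) else 0) =
      - ∑ y : ι, ∑ x : ι, (if x ≠ y then
      f (Function.update (Function.update w y v) x (B y x)) else 0) := by
    simp only [← Finset.sum_neg_distrib]
    refine Finset.sum_congr rfl fun y _ => Finset.sum_congr rfl fun x _ => ?_
    rcases eq_or_ne x y with rfl | hxy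
    · simp
    · simp only [ne_eq, hxy, hxy.symm, not_false_eq_true, if_true]
      exact h1 _ _ hxy.symm
  rw [h4] at h3
  exact self_eq_neg.1 h3

theorem fderiv_mul_volumeForm {E : Type*} [NormedAddCommGroup E] [NormedSpace ℝ E] {r k : ℕ}
    {G : E → ℂ} {G' : E →L[ℝ] ℂ} {w : Fin r ⊕ Fin k → E → Fin (r + k) → ℂ}
    {w' : Fin r ⊕ Fin k → E →L[ℝ] Fin (r + k) → ℂ} {y : E}
    (hG : HasFDerivAt G G' y) (hw : ∀ j, HasFDerivAt (w j) (w' j) y) (u : E) :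
    fderiv ℝ (fun z => G z * volumeForm r k (fun j => w j z)) y u =
      G' u * volumeForm r k (fun j => w j y) +
        G y * ∑ i, volumeForm r k (Function.update (fun j => w j y) i (w' i u)) := by
  have h1 := ((volumeCMM r k).hasFDerivAt (fun j => w j y)).comp y (hasFDerivAt_pi.2 hw)
  have h2 := hG.mul h1
  have h3 : (fun z => G z * volumeForm r k (fun j => w j z)) =
      G * (⇑(volumeCMM r k) ∘ fun x i => w i x) := rfl
  rw [h3, h2.fderiv]
  simp [ContinuousMultilinearMap.linearDeriv_apply]
  ring

/-- The differential of the pull-back of a holomorphic form of top degree vanishes. -/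
theorem fderiv_pullback_volumeForm {E : Type*} [NormedAddCommGroup E] [NormedSpace ℝ E] {r k : ℕ}
    {G : E → ℂ} {T : E → Fin (r + k) → ℂ} {y : E} {L : (Fin (r + k) → ℂ) →L[ℂ] ℂ}
    (hT : ContDiffAt ℝ 2 T y)
    (hG : HasFDerivAt G ((L.restrictScalars ℝ).comp (fderiv ℝ T y)) y)
    (d : Fin r ⊕ Fin k → E) (d₀ : E) :
    fderiv ℝ (fun z => G z * volumeForm r k (fun j => fderiv ℝ T z (d j))) y d₀ =
      ∑ j, fderiv ℝ (fun z => G z * volumeForm r k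
        (Function.update (fun i => fderiv ℝ T z (d i)) j (fderiv ℝ T z d₀))) y (d j) := by
  have hT2 : HasFDerivAt (fderiv ℝ T) (fderiv ℝ (fderiv ℝ T) y) y :=
    ((hT.fderiv_right (m := 1) (by norm_num)).differentiableAt (by norm_num)).hasFDerivAt
  have hsymm : ∀ u v, fderiv ℝ (fderiv ℝ T) y u v = fderiv ℝ (fderiv ℝ T) y v u :=
    fun u v => (hT.isSymmSndFDerivAt (by simp)).eq u v
  have hw : ∀ u : E, HasFDerivAt (fun z => fderiv ℝ T z u)
      ((ContinuousLinearMap.apply ℝ _ u).comp (fderiv ℝ (fderiv ℝ T) y)) y := fun u =>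
    (ContinuousLinearMap.apply ℝ (Fin (r + k) → ℂ) u).hasFDerivAt.comp y hT2
  rw [fderiv_mul_volumeForm hG (fun j => hw (d j)) d₀]
  -- Hypothesis `hG` makes `dG` a complex linear form evaluated on `dT`, as when `G` is locally a
  -- holomorphic function of `T`. The right-hand side then has three kinds of terms: those with `L`,
  -- summed by Cramer's rule; the second derivatives in slot `j`, which match the left-hand side by
  -- symmetry of `D²T`; and those in slots `i ≠ j`, which cancel in pairs.
  have h1 : ∀ j, fderiv ℝ (fun z => G z * volumeForm r k
        (Function.update (fun i => fderiv ℝ T z (d i)) j (fderiv ℝ T z d₀))) y (d j) =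
      L (fderiv ℝ T y (d j)) * volumeForm r k
        (Function.update (fun i => fderiv ℝ T y (d i)) j (fderiv ℝ T y d₀)) +
      G y * (volumeForm r k (Function.update (fun i => fderiv ℝ T y (d i)) j
          (fderiv ℝ (fderiv ℝ T) y (d j) d₀)) +
        ∑ i ∈ Finset.univ.erase j, volumeForm r k (Function.update
          (Function.update (fun i => fderiv ℝ T y (d i)) j (fderiv ℝ T y d₀)) i
          (fderiv ℝ (fderiv ℝ T) y (d j) (d i)))) := by
    intro j
    have h2 : ∀ z, (fun i => fderiv ℝ T z (Function.update d j d₀ i)) =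
        Function.update (fun i => fderiv ℝ T z (d i)) j (fderiv ℝ T z d₀) := by
      intro z
      ext i
      simp only [Function.update_apply]
      split_ifs <;> rfl
    have h3 := fderiv_mul_volumeForm hG (fun i => hw (Function.update d j d₀ i)) (d j)
    simp only [h2] at h3
    rw [h3, ← Finset.add_sum_erase _ _ (Finset.mem_univ j)]
    simp only [Function.update_self, Function.update_idem, ContinuousLinearMap.comp_apply,
      ContinuousLinearMap.apply_apply, ContinuousLinearMap.coe_restrictScalars']
    congr 3
    refine Finset.sum_congr rfl fun i hi => ?_
    rw [Function.update_of_ne (Finset.ne_of_mem_erase hi)]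
  simp only [h1, mul_add, Finset.sum_add_distrib]
  rw [← Finset.mul_sum (a := G y), ← Finset.mul_sum (a := G y),
    sum_update_update_eq_zero _ _ _ (fun i j => fderiv ℝ (fderiv ℝ T) y (d i) (d j))
      (fun i j => hsymm _ _), mul_zero, add_zero]
  congr 1
  · exact map_mul_volumeForm L.toLinearMap _ _
  · congr 1
    refine Finset.sum_congr rfl fun i _ => ?_
    simp only [ContinuousLinearMap.comp_apply, ContinuousLinearMap.apply_apply]
    rw [hsymm]

/-! ### Integrals over compact sets depending on parameters -/

/-- The derivative is continuous on a compact ball times `K`, hence bounded there, and a constant is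
integrable over `K`; dominated differentiation applies. -/
theorem hasFDerivAt_setIntegral_of_isCompact {𝕜 E X : Type*} [RCLike 𝕜] [NormedAddCommGroup E]
    [NormedSpace 𝕜 E] [ProperSpace E] [TopologicalSpace X] [T2Space X] [MeasurableSpace X]
    [OpensMeasurableSpace X] [SecondCountableTopology X] {μ : Measure X}
    [IsFiniteMeasureOnCompacts μ] {K : Set X} (hK : IsCompact K) {B : Set E} (hB : IsOpen B)
    {F : E → X → ℂ} [NormedSpace 𝕜 ℂ] {F' : E → X → E →L[𝕜] ℂ}
    (hF : ContinuousOn (fun p : E × X => F p.1 p.2) (B ×ˢ K))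
    (hF' : ContinuousOn (fun p : E × X => F' p.1 p.2) (B ×ˢ K))
    (hd : ∀ a ∈ B, ∀ x ∈ K, HasFDerivAt (fun a => F a x) (F' a x) a) {a₀ : E} (ha₀ : a₀ ∈ B) :
    HasFDerivAt (fun a => ∫ x in K, F a x ∂μ) (∫ x in K, F' a₀ x ∂μ) a₀ := by
  obtain ⟨ε, hε, hεB⟩ := Metric.nhds_basis_closedBall.mem_iff.1 (hB.mem_nhds ha₀)
  have hcomp : IsCompact (Metric.closedBall a₀ ε ×ˢ K) := (isCompact_closedBall _ _).prod hK
  obtain ⟨M, hM⟩ := hcomp.exists_bound_of_continuousOn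
    (hF'.mono (prod_mono hεB Subset.rfl))
  have hslice : ∀ a ∈ B, ContinuousOn (F a) K := fun a ha =>
    hF.comp (by fun_prop : ContinuousOn (fun x => (a, x)) K) fun x hx => ⟨ha, hx⟩
  have hslice' : ∀ a ∈ B, ContinuousOn (F' a) K := fun a ha =>
    hF'.comp (by fun_prop : ContinuousOn (fun x => (a, x)) K) fun x hx => ⟨ha, hx⟩
  refine hasFDerivAt_integral_of_dominated_of_fderiv_le (s := Metric.closedBall a₀ ε)
    (bound := fun _ => M) (Metric.closedBall_mem_nhds _ hε) ?_ ?_ ?_ ?_ ?_ ?_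
  · filter_upwards [hB.mem_nhds ha₀] with a ha
    exact (hslice a ha).aestronglyMeasurable_of_isCompact hK hK.measurableSet
  · exact (hslice a₀ ha₀).integrableOn_compact hK
  · exact (hslice' a₀ ha₀).aestronglyMeasurable_of_isCompact hK hK.measurableSet
  · filter_upwards [ae_restrict_mem hK.measurableSet] with x hx a ha
    exact hM (a, x) ⟨ha, hx⟩
  · exact integrableOn_const hK.measure_lt_top.ne
  · filter_upwards [ae_restrict_mem hK.measurableSet] with x hx a ha
    exact hd a (hεB ha) x hx

theorem hasDerivAt_setIntegral_of_isCompact {X : Type*} [TopologicalSpace X] [T2Space X]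
    [MeasurableSpace X] [OpensMeasurableSpace X] [SecondCountableTopology X] {μ : Measure X}
    [IsFiniteMeasureOnCompacts μ] {K : Set X} (hK : IsCompact K) {B : Set ℝ} (hB : IsOpen B)
    {F F' : ℝ → X → ℂ}
    (hF : ContinuousOn (fun p : ℝ × X => F p.1 p.2) (B ×ˢ K))
    (hF' : ContinuousOn (fun p : ℝ × X => F' p.1 p.2) (B ×ˢ K))
    (hd : ∀ a ∈ B, ∀ x ∈ K, HasDerivAt (fun a => F a x) (F' a x) a) {a₀ : ℝ} (ha₀ : a₀ ∈ B) :
    HasDerivAt (fun a => ∫ x in K, F a x ∂μ) (∫ x in K, F' a₀ x ∂μ) a₀ := by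
  have hslice' : ContinuousOn (F' a₀) K :=
    hF'.comp (by fun_prop : ContinuousOn (fun x => (a₀, x)) K) fun x hx => ⟨ha₀, hx⟩
  have h1 := hasFDerivAt_setIntegral_of_isCompact (𝕜 := ℝ) (μ := μ) hK hB
    (F' := fun a x => ContinuousLinearMap.toSpanSingleton ℝ (F' a x)) hF
    ((ContinuousLinearMap.toSpanSingletonCLE (𝕜 := ℝ) (E := ℂ)).continuous.comp_continuousOn hF')
    (fun a ha x hx => (hd a ha x hx).hasFDerivAt) ha₀
  have h2 := h1.hasDerivAt
  rwa [ContinuousLinearMap.integral_apply, show (fun x => (ContinuousLinearMap.toSpanSingleton ℝ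
    (F' a₀ x)) (1 : ℝ)) = F' a₀ by ext; simp] at h2
  exact (((ContinuousLinearMap.toSpanSingletonCLE (𝕜 := ℝ) (E := ℂ)).continuous.comp_continuousOn
    hslice').integrableOn_compact hK)

theorem continuousOn_setIntegral_of_isCompact {Y X : Type*} [TopologicalSpace Y]
    [FirstCountableTopology Y] [TopologicalSpace X] [T2Space X]
    [MeasurableSpace X] [OpensMeasurableSpace X] [SecondCountableTopology X] {μ : Measure X}
    [IsFiniteMeasureOnCompacts μ] {K : Set X} (hK : IsCompact K) {B : Set Y} (hB : IsCompact B)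
    {F : Y → X → ℂ} (hF : ContinuousOn (fun p : Y × X => F p.1 p.2) (B ×ˢ K)) :
    ContinuousOn (fun a => ∫ x in K, F a x ∂μ) B := by
  obtain ⟨M, hM⟩ := (hB.prod hK).exists_bound_of_continuousOn hF
  refine continuousOn_of_dominated (bound := fun _ => M) ?_ ?_ ?_ ?_
  · intro a ha
    exact (hF.comp (by fun_prop : ContinuousOn (fun x => (a, x)) K)
      fun x hx => ⟨ha, hx⟩).aestronglyMeasurable_of_isCompact hK hK.measurableSet
  · intro a ha
    filter_upwards [ae_restrict_mem hK.measurableSet] with x hx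
    exact hM (a, x) ⟨ha, hx⟩
  · exact integrableOn_const hK.measure_lt_top.ne
  · filter_upwards [ae_restrict_mem hK.measurableSet] with x hx
    exact hF.comp (by fun_prop : ContinuousOn (fun a => (a, x)) B) fun a ha => ⟨ha, hx⟩

/-! ### Integration by parts on the unit cube -/

theorem isCompact_unitCube (k : ℕ) : IsCompact (unitCube k) := isCompact_Icc

/-- The divergence theorem for the vector field whose only nonzero component is the `j`-th one. -/
theorem integral_fderiv_single {n : ℕ} {f : (Fin (n + 1) → ℝ) → ℂ} (hf : ContDiff ℝ 1 f)
    (j : Fin (n + 1)) :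
    ∫ t in unitCube (n + 1), fderiv ℝ f t (Pi.single j 1) =
      (∫ s in unitCube n, f (face j 1 s)) - ∫ s in unitCube n, f (face j 0 s) := by
  have h1 := integral_divergence_of_hasFDerivAt_off_countable (E := ℂ) (n := n) (a := 0) (b := 1)
    zero_le_one (fun t => Pi.single j (f t))
    (fun t => (ContinuousLinearMap.single ℝ (fun _ => ℂ) j).comp (fderiv ℝ f t)) ∅
    countable_empty ?_ ?_ ?_
  · have h2 : ∀ t : Fin (n + 1) → ℝ, (∑ i, (ContinuousLinearMap.single ℝ (fun _ => ℂ) j).comp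
        (fderiv ℝ f t) (Pi.single i 1) i) = fderiv ℝ f t (Pi.single j 1) := by
      intro t
      rw [Finset.sum_eq_single j]
      · simp
      · intro i _ hij
        simp [hij]
      · simp
    simp only [h2] at h1
    rw [h1, Finset.sum_eq_single j]
    · have h0 : ((0 : Fin (n + 1) → ℝ) ∘ j.succAbove) = 0 := rfl
      have h1 : ((1 : Fin (n + 1) → ℝ) ∘ j.succAbove) = 1 := rfl
      simp [h0, h1, face]
    · intro i _ hij
      simp [hij]
    · simp
  · exact ((ContinuousLinearMap.single ℝ (fun _ => ℂ) j).continuous.comp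
      hf.continuous).continuousOn
  · intro x _
    exact (ContinuousLinearMap.single ℝ (fun _ => ℂ) j).hasFDerivAt.comp x
      (hf.differentiable (by norm_num) x).hasFDerivAt
  · refine ContinuousOn.integrableOn_compact isCompact_Icc (Continuous.continuousOn ?_)
    refine continuous_finsetSum _ fun i _ => ?_
    have h3 : Continuous fun t => fderiv ℝ f t (Pi.single i 1) :=
      (hf.continuous_fderiv (by norm_num)).clm_apply continuous_const
    exact (continuous_apply i).comp
      ((ContinuousLinearMap.single ℝ (fun _ => ℂ) j).continuous.comp h3)

theorem face_one_eq {n : ℕ} (j : Fin (n + 1)) (s : Fin n → ℝ) :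
    face j 1 s = face j 0 s + Pi.single j 1 := by
  ext i
  rcases Fin.eq_self_or_eq_succAbove j i with rfl | ⟨i, rfl⟩ <;> simp [face]

theorem integral_fderiv_single_of_periodic {n : ℕ} {f : (Fin n → ℝ) → ℂ} (hf : ContDiff ℝ 1 f)
    (j : Fin n) (hper : ∀ t, f (t + Pi.single j 1) = f t) :
    ∫ t in unitCube n, fderiv ℝ f t (Pi.single j 1) = 0 := by
  obtain _ | n := n
  · exact j.elim0
  · rw [integral_fderiv_single hf]
    simp [face_one_eq, hper]

/-! ### A smooth parametrization of the cube by the whole space -/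

/-- A smooth map `ℝ^k → [0,1]^k` that maps the cube bijectively onto itself. -/
def cubeParam {k : ℕ} (t : Fin k → ℝ) : Fin k → ℝ := fun q => (1 - Real.cos (Real.pi * t q)) / 2

theorem cubeParam_mem {k : ℕ} (t : Fin k → ℝ) : cubeParam t ∈ unitCube k := by
  refine ⟨fun q => ?_, fun q => ?_⟩
  · simp only [cubeParam, Pi.zero_apply]
    linarith [Real.cos_le_one (Real.pi * t q)]
  · simp only [cubeParam, Pi.one_apply]
    linarith [Real.neg_one_le_cos (Real.pi * t q)]

theorem contDiff_cubeParam (k : ℕ) : ContDiff ℝ ∞ (cubeParam (k := k)) := by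
  unfold cubeParam
  fun_prop

/-- Each coordinate of `cubeParam` fixes `0` and `1`, so the reparametrization respects the faces,
and with them the cancellation in the boundary of a cycle. -/
theorem cubeParam_face {k : ℕ} (j : Fin (k + 1)) (ε : Fin 2) (s : Fin k → ℝ) :
    cubeParam (face j ε s) = face j ε (cubeParam s) := by
  ext i
  rcases Fin.eq_self_or_eq_succAbove j i with rfl | ⟨i, rfl⟩
  · fin_cases ε <;> simp [face, cubeParam]
  · simp [face, cubeParam]

theorem cubeParam_update {k : ℕ} (t : Fin k → ℝ) (q : Fin k) (u : ℝ) :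
    cubeParam (Function.update t q u) =
      Function.update (cubeParam t) q ((1 - Real.cos (Real.pi * u)) / 2) := by
  ext i
  rcases eq_or_ne i q with rfl | h <;> simp [cubeParam, *]

theorem exists_cubeParam_eq {k : ℕ} {t : Fin k → ℝ} (ht : t ∈ unitCube k) :
    ∃ s ∈ unitCube k, cubeParam s = t := by
  refine ⟨fun q => Real.arccos (1 - 2 * t q) / Real.pi, ⟨fun q => ?_, fun q => ?_⟩, ?_⟩
  · exact div_nonneg (Real.arccos_nonneg _) Real.pi_pos.le
  · exact div_le_one_of_le₀ (Real.arccos_le_pi _) Real.pi_pos.le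
  · ext q
    have h0 : 0 ≤ t q := ht.1 q
    have h1 : t q ≤ 1 := ht.2 q
    simp only [cubeParam]
    rw [mul_div_cancel₀ _ Real.pi_ne_zero, Real.cos_arccos (by linarith) (by linarith)]
    ring

theorem injOn_cubeParam (k : ℕ) : InjOn (cubeParam (k := k)) (unitCube k) := by
  intro s hs t ht hst
  ext q
  have h1 := congrFun hst q
  simp only [cubeParam] at h1
  have hmem : ∀ u ∈ unitCube k, Real.pi * u q ∈ Icc 0 Real.pi := fun u hu =>
    ⟨mul_nonneg Real.pi_pos.le (hu.1 q), by
      have := mul_le_mul_of_nonneg_left (hu.2 q) Real.pi_pos.le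
      simpa using this⟩
  exact mul_left_cancel₀ Real.pi_ne_zero
    (Real.injOn_cos (hmem s hs) (hmem t ht) (by linarith))

theorem hasFDerivAt_cubeParam {k : ℕ} (t : Fin k → ℝ) :
    HasFDerivAt cubeParam (Matrix.toLin' (Matrix.diagonal fun q =>
      Real.pi / 2 * Real.sin (Real.pi * t q))).toContinuousLinearMap t := by
  rw [hasFDerivAt_pi']
  intro q
  have h1 : HasDerivAt (fun x : ℝ => (1 - Real.cos (Real.pi * x)) / 2)
      (Real.pi / 2 * Real.sin (Real.pi * t q)) (t q) := by
    have h2 := (((hasDerivAt_id (t q)).const_mul Real.pi).cos.const_sub 1).div_const 2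
    convert! h2 using 1
    simp
    ring
  have h3 := h1.comp_hasFDerivAt t (hasFDerivAt_apply (𝕜 := ℝ) q t)
  convert! h3 using 1
  ext v
  simp [Matrix.mulVec_diagonal]

/-- Change of variables needs injectivity only, so it does no harm that the Jacobian vanishes on the
boundary of the cube. On the cube all the sines are nonnegative and the absolute value can be
dropped. -/
theorem setIntegral_unitCube_eq {k : ℕ} (f : (Fin k → ℝ) → ℂ) :
    ∫ t in unitCube k, f t = ∫ t in unitCube k,
      ((∏ q, Real.pi / 2 * Real.sin (Real.pi * t q) : ℝ) : ℂ) * f (cubeParam t) := by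
  have himage : cubeParam '' unitCube k = unitCube k := by
    ext t
    constructor
    · rintro ⟨s, _, rfl⟩
      exact cubeParam_mem s
    · exact fun ht => exists_cubeParam_eq ht
  conv_lhs => rw [← himage]
  rw [integral_image_eq_integral_abs_det_fderiv_smul volume (measurableSet_Icc)
    (fun t _ => (hasFDerivAt_cubeParam t).hasFDerivWithinAt) (injOn_cubeParam k)]
  refine setIntegral_congr_fun measurableSet_Icc fun t ht => ?_
  have hdet : (Matrix.toLin' (Matrix.diagonal fun q =>
      Real.pi / 2 * Real.sin (Real.pi * t q))).toContinuousLinearMap.det =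
      ∏ q, Real.pi / 2 * Real.sin (Real.pi * t q) := by
    simp [ContinuousLinearMap.det]
  beta_reduce
  rw [hdet, abs_of_nonneg, Complex.real_smul]
  refine Finset.prod_nonneg fun q _ => mul_nonneg (by positivity) ?_
  refine Real.sin_nonneg_of_nonneg_of_le_pi (mul_nonneg Real.pi_pos.le (ht.1 q)) ?_
  have := mul_le_mul_of_nonneg_left (ht.2 q) Real.pi_pos.le
  simpa using this

/-! ### Values and differentials of the polynomials -/

/-- The value `f_i(x)` of the polynomial with coefficients `a`. -/
@[irreducible]
def polyVal {κ : Type*} {m : ℕ} (supp : κ → Finset (Fin m →₀ ℕ)) (a : CoeffIndex supp → ℂ)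
    (x : Fin m → ℂ) (i : κ) : ℂ :=
  MvPolynomial.eval x (poly supp a i)

theorem polyVal_def {κ : Type*} {m : ℕ} (supp : κ → Finset (Fin m →₀ ℕ))
    (a : CoeffIndex supp → ℂ) (x : Fin m → ℂ) (i : κ) :
    polyVal supp a x i = MvPolynomial.eval x (poly supp a i) := by
  rw [polyVal]

theorem polyVal_eq_sum {κ : Type*} {m : ℕ} (supp : κ → Finset (Fin m →₀ ℕ))
    (a : CoeffIndex supp → ℂ) (x : Fin m → ℂ) (i : κ) :
    polyVal supp a x i = ∑ j : {j // j ∈ supp i}, a ⟨i, j⟩ * ∏ p, x p ^ (j.1 p) := by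
  simp only [polyVal_def, poly, map_sum, MvPolynomial.eval_monomial]
  refine Finset.sum_congr rfl fun j _ => ?_
  rw [Finsupp.prod_fintype _ _ (by simp)]

theorem contDiff_polyVal {κ : Type*} [Fintype κ] {m : ℕ} (supp : κ → Finset (Fin m →₀ ℕ)) (i : κ) :
    ContDiff ℂ ∞ fun p : (CoeffIndex supp → ℂ) × (Fin m → ℂ) => polyVal supp p.1 p.2 i := by
  simp only [polyVal_eq_sum]
  fun_prop

theorem contDiff_real_polyVal {κ : Type*} [Fintype κ] {m : ℕ} (supp : κ → Finset (Fin m →₀ ℕ))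
    (i : κ) :
    ContDiff ℝ ∞ fun p : (CoeffIndex supp → ℂ) × (Fin m → ℂ) => polyVal supp p.1 p.2 i :=
  (contDiff_polyVal supp i).restrict_scalars ℝ

theorem hasFDerivAt_eval {m : ℕ} (f : MvPolynomial (Fin m) ℂ) (x : Fin m → ℂ) :
    HasFDerivAt (fun x => MvPolynomial.eval x f)
      (LinearMap.toContinuousLinearMap (differential f x)) x := by
  induction f using MvPolynomial.induction_on with
  | C c =>
    simp only [MvPolynomial.eval_C]
    refine (hasFDerivAt_const c x).congr_fderiv ?_
    ext v
    simp [differential]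
  | add f g hf hg =>
    simp only [map_add]
    convert! hf.add hg using 1
    ext v
    simp [differential, add_mul, Finset.sum_add_distrib]
  | mul_X f p hf =>
    simp only [map_mul, MvPolynomial.eval_X]
    refine (hf.mul (hasFDerivAt_apply (𝕜 := ℂ) p x)).congr_fderiv ?_
    ext v
    simp [differential, MvPolynomial.pderiv_X, Pi.single_apply, add_mul, Finset.sum_add_distrib,
      Finset.mul_sum, apply_ite, mul_assoc]

/-! ### The tubular neighbourhood of a compact piece of the variety -/

/-- Injectivity on a compact set together with local injectivity at its points gives injectivity on
a neighbourhood. The global inverse there coincides with the local inverses of the inverse function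
theorem, hence is smooth. -/
theorem exists_smooth_inverse_near {P : Type*} [NormedAddCommGroup P] [NormedSpace ℝ P]
    [CompleteSpace P] {H : P → P} (hH : ContDiff ℝ ∞ H) {Z : Set P} (hZ : IsCompact Z)
    (hinj : InjOn H Z) (hder : ∀ z ∈ Z, ∃ e : P ≃L[ℝ] P, (e : P →L[ℝ] P) = fderiv ℝ H z) :
    ∃ t : Set P, IsOpen t ∧ Z ⊆ t ∧ IsOpen (H '' t) ∧
      ∃ G : P → P, ContDiffOn ℝ ∞ G (H '' t) ∧ ∀ z ∈ t, G (H z) = z := by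
  have hne : (∞ : WithTop ℕ∞) ≠ 0 := by simp
  obtain ⟨t₀, ht₀, hZt₀, hinj₀⟩ := hinj.exists_isOpen_superset hZ
    (fun z _ => hH.continuous.continuousAt) (by
      intro z hz
      obtain ⟨e, he⟩ := hder z hz
      have hs : HasStrictFDerivAt H (e : P →L[ℝ] P) z := by
        rw [he]
        exact (hH.contDiffAt).hasStrictFDerivAt hne
      let E := hs.toOpenPartialHomeomorph H
      exact ⟨E.source, E.open_source.mem_nhds hs.mem_toOpenPartialHomeomorph_source, E.injOn⟩)
  -- Invertibility of the derivative is an open condition, so it persists on a neighbourhood of `Z`.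
  let R : Set P := (fderiv ℝ H) ⁻¹' (range ((↑) : (P ≃L[ℝ] P) → P →L[ℝ] P))
  have hR : IsOpen R :=
    (ContinuousLinearEquiv.isOpen).preimage (hH.continuous_fderiv hne)
  have hopen : IsOpen (t₀ ∩ R) := ht₀.inter hR
  have hinjt : InjOn H (t₀ ∩ R) := hinj₀.mono inter_subset_left
  have hloc : ∀ z ∈ t₀ ∩ R, ∃ g : P → P, ContDiffAt ℝ ∞ g (H z) ∧
      ∀ᶠ w in 𝓝 (H z), g w ∈ t₀ ∩ R ∧ H (g w) = w := by
    rintro z ⟨hz, e, he⟩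
    have hf' : HasFDerivAt H (e : P →L[ℝ] P) z := by
      rw [he]
      exact (hH.differentiable hne z).hasFDerivAt
    have hs := (hH.contDiffAt (x := z)).hasStrictFDerivAt' hf' hne
    refine ⟨_, (hH.contDiffAt (x := z)).to_localInverse hf' hne, ?_⟩
    refine Filter.Eventually.and ?_ hs.eventually_right_inverse
    have hc := ((hH.contDiffAt (x := z)).to_localInverse hf' hne).continuousAt
    have himg : (hH.contDiffAt (x := z)).localInverse hf' hne (H z) = z :=
      (hH.contDiffAt (x := z)).localInverse_apply_image hf' hne
    refine hc.eventually_mem (hopen.mem_nhds ?_)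
    rw [himg]
    exact ⟨hz, e, he⟩
  refine ⟨t₀ ∩ R, hopen, fun z hz => ⟨hZt₀ hz, hder z hz⟩, ?_,
    Function.invFunOn H (t₀ ∩ R), ?_, fun z hz => hinjt.leftInvOn_invFunOn hz⟩
  · rw [isOpen_iff_mem_nhds]
    rintro _ ⟨z, hz, rfl⟩
    obtain ⟨g, -, hg⟩ := hloc z hz
    filter_upwards [hg] with w hw
    exact ⟨g w, hw.1, hw.2⟩
  · rintro _ ⟨z, hz, rfl⟩
    obtain ⟨g, hgs, hg⟩ := hloc z hz
    refine (hgs.congr_of_eventuallyEq ?_).contDiffWithinAt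
    filter_upwards [hg] with w hw
    calc Function.invFunOn H (t₀ ∩ R) w = Function.invFunOn H (t₀ ∩ R) (H (g w)) := by rw [hw.2]
      _ = g w := hinjt.leftInvOn_invFunOn hw.1

/-- The hypothesis says that the Gram matrix of the gradients annihilates `u`. Pairing with the
conjugate of `u` gives the squared norm of `∑ ū_e ∇f_e`; this vector vanishes, and linear
independence gives `u = 0`. -/
theorem eq_zero_of_differential_conj_eq_zero {r m : ℕ} {f : Fin r → MvPolynomial (Fin m) ℂ}
    {x : Fin m → ℂ} (hli : LinearIndependent ℂ fun e => differential (f e) x) (u : Fin r → ℂ)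
    (h : ∀ e, differential (f e) x (fun p => ∑ e', u e' *
      starRingEnd ℂ (MvPolynomial.eval x (MvPolynomial.pderiv p (f e')))) = 0) : u = 0 := by
  let D : Fin r → Fin m → ℂ := fun e p => MvPolynomial.eval x (MvPolynomial.pderiv p (f e))
  have h1 : ∀ p, ∑ e, starRingEnd ℂ (u e) * D e p = 0 := by
    have h2 : ∑ p, (∑ e, starRingEnd ℂ (u e) * D e p) *
        starRingEnd ℂ (∑ e, starRingEnd ℂ (u e) * D e p) = 0 := by
      have h3 : ∑ e, starRingEnd ℂ (u e) * (differential (f e) x (fun p => ∑ e', u e' *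
          starRingEnd ℂ (D e' p))) = 0 := by
        refine Finset.sum_eq_zero fun e _ => ?_
        rw [h e, mul_zero]
      rw [← h3]
      have h4 : ∀ p, starRingEnd ℂ (∑ e, starRingEnd ℂ (u e) * D e p) =
          ∑ e', u e' * starRingEnd ℂ (D e' p) := fun p => by simp
      simp only [h4]
      have h5 : ∀ A : Fin m → ℂ, ∑ p, (∑ e, starRingEnd ℂ (u e) * D e p) * A p =
          ∑ e, starRingEnd ℂ (u e) * differential (f e) x A := by
        intro A
        simp only [differential, LinearMap.sum_apply, LinearMap.smul_apply, LinearMap.proj_apply,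
          smul_eq_mul, Finset.mul_sum, Finset.sum_mul]
        rw [Finset.sum_comm]
        refine Finset.sum_congr rfl fun e _ => Finset.sum_congr rfl fun p _ => ?_
        simp only [D]
        ring
      exact h5 _
    intro p
    simp only [Complex.mul_conj] at h2
    have h3 : ∑ p, Complex.normSq (∑ e, starRingEnd ℂ (u e) * D e p) = 0 := by exact_mod_cast h2
    exact Complex.normSq_eq_zero.1
      ((Finset.sum_eq_zero_iff_of_nonneg fun _ _ => Complex.normSq_nonneg _).1 h3 p
        (Finset.mem_univ p))
  have h4 : ∑ e, starRingEnd ℂ (u e) • differential (f e) x = 0 := by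
    refine LinearMap.ext fun v => ?_
    simp only [differential, LinearMap.sum_apply, LinearMap.smul_apply, LinearMap.proj_apply,
      smul_eq_mul, LinearMap.zero_apply, Finset.mul_sum]
    rw [Finset.sum_comm]
    refine Finset.sum_eq_zero fun p _ => ?_
    have := h1 p
    calc ∑ e, starRingEnd ℂ (u e) * (MvPolynomial.eval x (MvPolynomial.pderiv p (f e)) * v p)
        = (∑ e, starRingEnd ℂ (u e) * D e p) * v p := by
          rw [Finset.sum_mul]
          exact Finset.sum_congr rfl fun e _ => by simp only [D]; ring
      _ = 0 := by rw [this, zero_mul]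
  ext e
  have := Fintype.linearIndependent_iff.1 hli _ h4 e
  simpa using this

theorem contDiff_eval {m : ℕ} (f : MvPolynomial (Fin m) ℂ) :
    ContDiff ℝ ∞ fun x : Fin m → ℂ => MvPolynomial.eval x f := by
  simp only [MvPolynomial.eval_eq]
  fun_prop

/-- The conjugate gradient direction `∑_e u_e \overline{∇ f_e(x)}`, which is transversal to the
variety at its regular points. -/
def normalVector {r m : ℕ} (f : Fin r → MvPolynomial (Fin m) ℂ) (x : Fin m → ℂ) (u : Fin r → ℂ) :
    Fin m → ℂ :=
  fun p => ∑ e, u e * starRingEnd ℂ (MvPolynomial.eval x (MvPolynomial.pderiv p (f e)))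

theorem contDiff_normalVector {r m : ℕ} (f : Fin r → MvPolynomial (Fin m) ℂ) :
    ContDiff ℝ ∞ fun z : (Fin m → ℂ) × (Fin r → ℂ) => normalVector f z.1 z.2 := by
  refine contDiff_pi.2 fun p => ContDiff.sum fun e _ => ContDiff.mul (by fun_prop) ?_
  exact (Complex.conjCLE : ℂ ≃L[ℝ] ℂ).contDiff.comp ((contDiff_eval _).comp contDiff_fst)

@[simp]
theorem normalVector_zero {r m : ℕ} (f : Fin r → MvPolynomial (Fin m) ℂ) (x : Fin m → ℂ) :
    normalVector f x 0 = 0 := by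
  ext p
  simp [normalVector]

theorem normalVector_smul {r m : ℕ} (f : Fin r → MvPolynomial (Fin m) ℂ) (x : Fin m → ℂ) (s : ℝ)
    (u : Fin r → ℂ) : normalVector f x (s • u) = s • normalVector f x u := by
  ext p
  simp [normalVector, Finset.mul_sum, mul_assoc]

section Tube

variable {l r m : ℕ} (supp : Fin l ⊕ Fin r → Finset (Fin m →₀ ℕ)) (a₀ : CoeffIndex supp → ℂ)

/-- The values of the `f_e` (for the coefficients `b`) at a normal displacement of `x`. -/
def normalValue (z : (Fin m → ℂ) × (CoeffIndex supp → ℂ) × (Fin r → ℂ)) : Fin r → ℂ :=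
  fun e => polyVal supp z.2.1
    (z.1 + normalVector (fun e => poly supp a₀ (Sum.inr e)) z.1 z.2.2) (Sum.inr e)

theorem contDiff_normalValue : ContDiff ℝ ∞ (normalValue supp a₀) := by
  refine contDiff_pi.2 fun e => ?_
  have h1 : ContDiff ℝ ∞ fun z : (Fin m → ℂ) × (CoeffIndex supp → ℂ) × (Fin r → ℂ) =>
      z.1 + normalVector (fun e => poly supp a₀ (Sum.inr e)) z.1 z.2.2 :=
    contDiff_fst.add ((contDiff_normalVector _).comp
      (contDiff_fst.prodMk (contDiff_snd.comp contDiff_snd)))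
  exact ContDiff.comp (g := fun p : (CoeffIndex supp → ℂ) × (Fin m → ℂ) =>
    polyVal supp p.1 p.2 (Sum.inr e)) (contDiff_real_polyVal supp (Sum.inr e))
    ((contDiff_fst.comp contDiff_snd).prodMk h1)

/-- The displacement is linear in `u`, so restricting to the line `s ↦ (x, a₀, s u)` computes the
derivative in the normal directions, which is the Gram block. -/
theorem fderiv_normalValue_apply (x : Fin m → ℂ) (u : Fin r → ℂ) (e : Fin r) :
    fderiv ℝ (normalValue supp a₀) (x, a₀, 0) (0, 0, u) e =
      differential (poly supp a₀ (Sum.inr e)) x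
        (normalVector (fun e => poly supp a₀ (Sum.inr e)) x u) := by
  have hF : HasFDerivAt (normalValue supp a₀) (fderiv ℝ (normalValue supp a₀) (x, a₀, 0))
      (x, a₀, 0) := ((contDiff_normalValue supp a₀).differentiable (by simp) _).hasFDerivAt
  have h1 : HasDerivAt (fun s : ℝ => ((x, a₀, s • u) :
      (Fin m → ℂ) × (CoeffIndex supp → ℂ) × (Fin r → ℂ))) (0, 0, u) 0 := by
    refine (hasDerivAt_const _ _).prodMk ((hasDerivAt_const _ _).prodMk ?_)
    simpa using (hasDerivAt_id (0 : ℝ)).smul_const u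
  have h2 : HasDerivAt (fun s : ℝ => normalValue supp a₀ (x, a₀, s • u))
      (fderiv ℝ (normalValue supp a₀) (x, a₀, 0) (0, 0, u)) 0 := by
    refine HasFDerivAt.comp_hasDerivAt (l := normalValue supp a₀) (f := fun s : ℝ =>
      ((x, a₀, s • u) : (Fin m → ℂ) × (CoeffIndex supp → ℂ) × (Fin r → ℂ))) 0 ?_ h1
    simpa using hF
  have h3 := hasDerivAt_pi.1 h2 e
  generalize hv : normalVector (fun e => poly supp a₀ (Sum.inr e)) x u = v
  have h5 : HasDerivAt (fun s : ℝ => x + s • v) v 0 := by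
    simpa using ((hasDerivAt_id (0 : ℝ)).smul_const v).const_add x
  have h6 : HasFDerivAt (fun x => MvPolynomial.eval x (poly supp a₀ (Sum.inr e)))
      ((LinearMap.toContinuousLinearMap
        (differential (poly supp a₀ (Sum.inr e)) x)).restrictScalars ℝ) (x + (0 : ℝ) • v) := by
    simpa using ((hasFDerivAt_eval (poly supp a₀ (Sum.inr e)) x).restrictScalars ℝ)
  have h7 : HasDerivAt (fun s : ℝ => MvPolynomial.eval (x + s • v) (poly supp a₀ (Sum.inr e)))
      (differential (poly supp a₀ (Sum.inr e)) x v) 0 := by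
    exact HasFDerivAt.comp_hasDerivAt (f := fun s : ℝ => x + s • v)
      (l := fun x => MvPolynomial.eval x (poly supp a₀ (Sum.inr e))) 0 h6 h5
  refine h3.unique ?_
  simpa only [normalValue, polyVal_def, normalVector_smul, hv] using h7

/-- The map that is inverted to construct the tubular neighbourhood. -/
def normalMap (z : (Fin m → ℂ) × (CoeffIndex supp → ℂ) × (Fin r → ℂ)) :
    (Fin m → ℂ) × (CoeffIndex supp → ℂ) × (Fin r → ℂ) := (z.1, z.2.1, normalValue supp a₀ z)

theorem contDiff_normalMap : ContDiff ℝ ∞ (normalMap supp a₀) :=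
  contDiff_fst.prodMk ((contDiff_fst.comp contDiff_snd).prodMk (contDiff_normalValue supp a₀))

/-- The derivative is block triangular, with identity blocks on `x` and on the coefficients. A
kernel vector is therefore purely normal, and the Gram block kills it only if it is zero; in finite
dimension injectivity suffices. -/
theorem exists_equiv_eq_fderiv_normalMap {x : Fin m → ℂ}
    (hli : LinearIndependent ℂ fun e => differential (poly supp a₀ (Sum.inr e)) x) :
    ∃ E : ((Fin m → ℂ) × (CoeffIndex supp → ℂ) × (Fin r → ℂ)) ≃L[ℝ]
        ((Fin m → ℂ) × (CoeffIndex supp → ℂ) × (Fin r → ℂ)),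
      (E : _ →L[ℝ] _) = fderiv ℝ (normalMap supp a₀) (x, a₀, 0) := by
  have hH : HasFDerivAt (normalMap supp a₀) (fderiv ℝ (normalMap supp a₀) (x, a₀, 0))
      (x, a₀, 0) := ((contDiff_normalMap supp a₀).differentiable (by simp) _).hasFDerivAt
  have hF : HasFDerivAt (normalValue supp a₀) (fderiv ℝ (normalValue supp a₀) (x, a₀, 0))
      (x, a₀, 0) := ((contDiff_normalValue supp a₀).differentiable (by simp) _).hasFDerivAt
  have hder := hH.unique
    (hasFDerivAt_fst.prodMk ((hasFDerivAt_fst.comp _ hasFDerivAt_snd).prodMk hF))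
  have hinj : Function.Injective (fderiv ℝ (normalMap supp a₀) (x, a₀, 0)) := by
    rw [injective_iff_map_eq_zero]
    rintro ⟨ξ, β, u⟩ h
    rw [hder] at h
    simp only [ContinuousLinearMap.prod_apply, ContinuousLinearMap.comp_apply,
      ContinuousLinearMap.coe_fst', ContinuousLinearMap.coe_snd', Prod.mk_eq_zero] at h
    obtain ⟨rfl, rfl, h⟩ := h
    have h1 : u = 0 := eq_zero_of_differential_conj_eq_zero hli u fun e => by
      have h2 := fderiv_normalValue_apply supp a₀ x u e
      rw [h] at h2
      exact h2.symm
    rw [h1]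
    rfl
  refine ⟨(LinearEquiv.ofInjectiveEndo (fderiv ℝ (normalMap supp a₀) (x, a₀, 0)).toLinearMap
    hinj).toContinuousLinearEquiv, ?_⟩
  exact ContinuousLinearMap.ext fun v => rfl

/-- A smooth family `Ψ(x, b, w)` of points with `f_e(Ψ) = w_e` (for the coefficients `b`), defined
near a compact piece of the variety at `a₀`; it retracts a neighbourhood to the varieties. -/
theorem exists_tube {K : Set (Fin m → ℂ)} (hK : IsCompact K)
    (hzero : ∀ x ∈ K, ∀ e, polyVal supp a₀ x (Sum.inr e) = 0)
    (hli : ∀ x ∈ K, LinearIndependent ℂ fun e => differential (poly supp a₀ (Sum.inr e)) x) :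
    ∃ O : Set ((Fin m → ℂ) × (CoeffIndex supp → ℂ) × (Fin r → ℂ)), IsOpen O ∧
      ∃ Ψ : (Fin m → ℂ) × (CoeffIndex supp → ℂ) × (Fin r → ℂ) → Fin m → ℂ,
        ContDiffOn ℝ ∞ Ψ O ∧ (∀ x ∈ K, (x, a₀, 0) ∈ O) ∧
        (∀ p ∈ O, ∀ e, polyVal supp p.2.1 (Ψ p) (Sum.inr e) = p.2.2 e) ∧
        ∀ x b, (x, b, 0) ∈ O → (∀ e, polyVal supp b x (Sum.inr e) = 0) → Ψ (x, b, 0) = x := by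
  have hH := contDiff_normalMap supp a₀
  have hZ : IsCompact (K ×ˢ ({(a₀, 0)} : Set ((CoeffIndex supp → ℂ) × (Fin r → ℂ)))) :=
    hK.prod isCompact_singleton
  have hval : ∀ x b, (∀ e, polyVal supp b x (Sum.inr e) = 0) →
      normalMap supp a₀ (x, b, 0) = (x, b, 0) := by
    intro x b hx
    refine Prod.ext rfl (Prod.ext rfl (funext fun e => ?_))
    simp [normalMap, normalValue, hx]
  have hinj : InjOn (normalMap supp a₀)
      (K ×ˢ ({(a₀, 0)} : Set ((CoeffIndex supp → ℂ) × (Fin r → ℂ)))) :=  by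
    intro z hz z' hz' h
    have h1 : (normalMap supp a₀ z).1 = (normalMap supp a₀ z').1 := by rw [h]
    exact Prod.ext h1 ((mem_singleton_iff.1 hz.2).trans (mem_singleton_iff.1 hz'.2).symm)
  obtain ⟨t, ht, hZt, hHt, G, hG, hGH⟩ := exists_smooth_inverse_near hH hZ hinj (by
    rintro ⟨x, y⟩ ⟨hx, hy⟩
    simp only [mem_singleton_iff] at hx hy
    subst hy
    exact exists_equiv_eq_fderiv_normalMap supp a₀ (hli x hx))
  -- The second condition on `O` serves the retraction: for `x` on the variety of `b`, `normalMap`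
  -- fixes `(x, b, 0)`, and if this point lies in `t` then so does the inverse `G`.
  refine ⟨normalMap supp a₀ '' t ∩ {p | (p.1, p.2.1, 0) ∈ t},
    hHt.inter (ht.preimage (by fun_prop)),
    fun p => (G p).1 + normalVector (fun e => poly supp a₀ (Sum.inr e)) (G p).1 (G p).2.2,
    ?_, ?_, ?_, ?_⟩
  · have hG' : ContDiffOn ℝ ∞ G (normalMap supp a₀ '' t ∩ {p | (p.1, p.2.1, 0) ∈ t}) :=
      hG.mono inter_subset_left
    exact hG'.fst.add ((contDiff_normalVector _).comp_contDiffOn (hG'.fst.prodMk hG'.snd.snd))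
  · intro x hx
    have h0 : (x, a₀, (0 : Fin r → ℂ)) ∈ t := hZt ⟨hx, rfl⟩
    exact ⟨⟨_, h0, hval x a₀ (hzero x hx)⟩, h0⟩
  · rintro _ ⟨⟨z, hz, rfl⟩, -⟩ e
    beta_reduce
    rw [hGH z hz]
    rfl
  · rintro x b ⟨-, h0⟩ hx
    have h2 := hGH _ h0
    rw [hval x b hx] at h2
    simp [h2]

end Tube

/-! ### Branches of the multivalued integrand -/

theorem contDiff_factor {l r m : ℕ} (supp : Fin l ⊕ Fin r → Finset (Fin m →₀ ℕ)) (q : Fin l ⊕ Fin m) :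
    ContDiff ℂ ∞ fun p : (CoeffIndex supp → ℂ) × (Fin m → ℂ) => factor supp p.1 p.2 q := by
  rcases q with i | p
  · simpa only [factor, Sum.elim_inl, polyVal_def] using contDiff_polyVal supp (Sum.inl i)
  · simp only [factor, Sum.elim_inr]
    fun_prop

theorem contDiff_polyVal_right {κ : Type*} [Fintype κ] {m : ℕ}
    (supp : κ → Finset (Fin m →₀ ℕ)) (a : CoeffIndex supp → ℂ) (i : κ) :
    ContDiff ℂ ∞ fun x => polyVal supp a x i :=
  ContDiff.comp (g := fun p : (CoeffIndex supp → ℂ) × (Fin m → ℂ) => polyVal supp p.1 p.2 i)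
    (contDiff_polyVal supp i) (contDiff_const.prodMk contDiff_id)

theorem contDiff_factor_right {l r m : ℕ} (supp : Fin l ⊕ Fin r → Finset (Fin m →₀ ℕ))
    (a : CoeffIndex supp → ℂ) (q : Fin l ⊕ Fin m) : ContDiff ℂ ∞ fun x => factor supp a x q := by
  rcases q with i | p
  · simpa only [factor, Sum.elim_inl, polyVal_def] using contDiff_polyVal_right supp a (Sum.inl i)
  · simp only [factor, Sum.elim_inr]
    fun_prop

open Classical in
/-- The branch of `z ^ s / z₀ ^ s` that is `1` at `z = z₀`; for a natural exponent `s`, the single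
valued power `z ^ s`. -/
def branchPow (s z₀ z : ℂ) : ℂ := if IsNat s then z ^ s else (z / z₀) ^ s

theorem branchPow_of_isNat {s : ℂ} (hs : IsNat s) (z₀ z : ℂ) : branchPow s z₀ z = z ^ s :=
  if_pos hs

theorem branchPow_of_not_isNat {s : ℂ} (hs : ¬ IsNat s) (z₀ z : ℂ) :
    branchPow s z₀ z = (z / z₀) ^ s := if_neg hs

theorem ofReal_mul_cpow {c : ℝ} (hc : 0 < c) (z s : ℂ) :
    ((c : ℂ) * z) ^ s = (c : ℂ) ^ s * z ^ s := by
  rcases eq_or_ne z 0 with rfl | hz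
  · rcases eq_or_ne s 0 with rfl | hs <;> simp [*]
  · have hc' : (c : ℂ) ≠ 0 := by exact_mod_cast hc.ne'
    rw [Complex.cpow_def_of_ne_zero (mul_ne_zero hc' hz), Complex.cpow_def_of_ne_zero hc',
      Complex.cpow_def_of_ne_zero hz, Complex.log_ofReal_mul hc hz, ← Complex.exp_add,
      Complex.ofReal_log hc.le, add_mul]

/-- A positive real factor does not change the argument, so it splits off without a change of
branch. The dilations behind the Euler equations are real for this reason. -/
theorem branchPow_ofReal_mul (s z₀ z : ℂ) {c : ℝ} (hc : 0 < c) :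
    branchPow s z₀ (c * z) = (c : ℂ) ^ s * branchPow s z₀ z := by
  unfold branchPow
  split_ifs with hs
  · rw [ofReal_mul_cpow hc]
  · rw [mul_div_assoc, ofReal_mul_cpow hc]

/-- The integrand at `x`, relative to the reference values `ref` of its multivalued factors. -/
def weight {l r m : ℕ} (supp : Fin l ⊕ Fin r → Finset (Fin m →₀ ℕ)) (lam : Fin l → ℂ)
    (β : Fin m → ℂ) (a : CoeffIndex supp → ℂ) (ref : Fin l ⊕ Fin m → ℂ) (x : Fin m → ℂ) : ℂ :=
  (∏ q, branchPow (factorExponent lam β q) (ref q) (factor supp a x q)) *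
    ∏ e, (polyVal supp a x (Sum.inr e))⁻¹

/-- The points at which the branches used in `weight` are holomorphic. -/
def IsAdmissible {l r m : ℕ} (supp : Fin l ⊕ Fin r → Finset (Fin m →₀ ℕ)) (lam : Fin l → ℂ)
    (β : Fin m → ℂ) (a : CoeffIndex supp → ℂ) (ref : Fin l ⊕ Fin m → ℂ) (x : Fin m → ℂ) : Prop :=
  (∀ q, ¬ IsNat (factorExponent lam β q) → factor supp a x q / ref q ∈ Complex.slitPlane) ∧
    ∀ e, polyVal supp a x (Sum.inr e) ≠ 0

/-- A continuous logarithm of a holomorphic function along a map is locally the composition with a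
holomorphic logarithm. -/
theorem eventually_eq_add_log {Y : Type*} [TopologicalSpace Y] {y₀ : Y} {μ f : Y → ℂ}
    (hμ : ContinuousAt μ y₀) (hf : ∀ᶠ y in 𝓝 y₀, Complex.exp (μ y) = f y) :
    ∀ᶠ y in 𝓝 y₀, μ y = μ y₀ + Complex.log (f y / f y₀) := by
  have h1 : ContinuousAt (fun y => (μ y - μ y₀).im) y₀ :=
    Complex.continuous_im.continuousAt.comp (hμ.sub continuousAt_const)
  have h2 : ∀ᶠ y in 𝓝 y₀, (μ y - μ y₀).im ∈ Ioo (-Real.pi) Real.pi := by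
    refine h1.eventually_mem (isOpen_Ioo.mem_nhds ?_)
    simp [Real.pi_pos]
  filter_upwards [h2, hf] with y hy hfy
  rw [← hfy, ← hf.self_of_nhds, ← Complex.exp_sub, Complex.log_exp hy.1 hy.2.le]
  ring

/-- Along a map into the domain of a horizontal section, the product of the section and `weight`
is locally the composition with a holomorphic function. -/
theorem exists_holomorphic_eq_mul_weight {l r m : ℕ} {supp : Fin l ⊕ Fin r → Finset (Fin m →₀ ℕ)}
    {lam : Fin l → ℂ} {β : Fin m → ℂ} {S Y : Type*} [TopologicalSpace S] [TopologicalSpace Y]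
    {D : Set S} {φ : Fin l ⊕ Fin m → S → ℂ} {g : S → ℂ}
    (hg : IsHorizontalOn D φ (factorExponent lam β) g) {y₀ : Y} {p : Y → S} {T : Y → Fin m → ℂ}
    (hp : ContinuousAt p y₀) (hpD : ∀ᶠ y in 𝓝 y₀, p y ∈ D) (hT : ContinuousAt T y₀)
    {a : CoeffIndex supp → ℂ}
    (hadm : IsAdmissible supp lam β a (fun q => φ q (p y₀)) (T y₀)) :
    ∃ h : (Fin m → ℂ) → ℂ, ContDiffAt ℂ ∞ h (T y₀) ∧
      ∀ᶠ y in 𝓝 y₀, g (p y) * weight supp lam β a (fun q => φ q (p y)) (T y) = h (T y) := by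
  classical
  obtain ⟨W, hW, c, ℓ, hℓ, hgW⟩ := hg (p y₀) hpD.self_of_nhds
  have hpW : Tendsto p (𝓝 y₀) (𝓝[W] (p y₀)) := by
    have h1 : Tendsto p (𝓝 y₀) (𝓝[D] (p y₀)) := tendsto_nhdsWithin_iff.2 ⟨hp, hpD⟩
    exact tendsto_nhdsWithin_iff.2 ⟨hp, h1.eventually_mem hW⟩
  have hpWe : ∀ᶠ y in 𝓝 y₀, p y ∈ W := (tendsto_nhdsWithin_iff.1 hpW).2
  have hfc : ∀ q, Continuous fun x => factor supp a x q := fun q =>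
    (contDiff_factor_right supp a q).continuous
  set s := factorExponent lam β with hs
  have hratio : ∀ q, ¬ IsNat (s q) → ContinuousAt (ℓ q ∘ p) y₀ ∧
      ContinuousAt (fun y => factor supp a (T y) q / φ q (p y)) y₀ := by
    intro q hq
    have h1 : ContinuousAt (ℓ q ∘ p) y₀ := ((hℓ q hq).1 _ hpWe.self_of_nhds).tendsto.comp hpW
    refine ⟨h1, ((hfc q).continuousAt.comp hT).div ?_ ?_⟩
    · refine (Complex.continuous_exp.continuousAt.comp h1).congr ?_
      filter_upwards [hpWe] with y hy
      exact (hℓ q hq).2 _ hy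
    · rw [← (hℓ q hq).2 _ hpWe.self_of_nhds]
      exact Complex.exp_ne_zero _
  -- The logarithm `ℓ q` of the reference value plus the principal logarithm of the ratio is a
  -- continuous logarithm of the factor along `T`. Near `y₀` it agrees with a holomorphic logarithm
  -- evaluated at `T y`, so the dependence on the base point `p y` drops out of the product.
  let μ : Fin l ⊕ Fin m → Y → ℂ := fun q y =>
    ℓ q (p y) + Complex.log (factor supp a (T y) q / φ q (p y))
  have hslit : ∀ q, ¬ IsNat (s q) → ∀ᶠ y in 𝓝 y₀,
      factor supp a (T y) q / φ q (p y) ∈ Complex.slitPlane := fun q hq =>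
    (hratio q hq).2.eventually_mem (Complex.isOpen_slitPlane.mem_nhds (hadm.1 q hq))
  have hμc : ∀ q, ¬ IsNat (s q) → ContinuousAt (μ q) y₀ := fun q hq =>
    (hratio q hq).1.add ((hratio q hq).2.clog (hadm.1 q hq))
  have hμe : ∀ q, ¬ IsNat (s q) → ∀ᶠ y in 𝓝 y₀, Complex.exp (μ q y) = factor supp a (T y) q := by
    intro q hq
    filter_upwards [hpWe, hslit q hq] with y hy hys
    have h1 := (hℓ q hq).2 _ hy
    have h2 : φ q (p y) ≠ 0 := h1 ▸ Complex.exp_ne_zero _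
    rw [Complex.exp_add, Complex.exp_log (Complex.slitPlane_ne_zero hys), h1, mul_div_cancel₀ _ h2]
  have hμlog : ∀ᶠ y in 𝓝 y₀, ∀ q, ¬ IsNat (s q) →
      μ q y = μ q y₀ + Complex.log (factor supp a (T y) q / factor supp a (T y₀) q) := by
    refine eventually_all.2 fun q => ?_
    by_cases hq : IsNat (s q)
    · exact Eventually.of_forall fun y h => absurd hq h
    · filter_upwards [eventually_eq_add_log (hμc q hq) (hμe q hq)] with y hy _ using hy
  have hslit' : ∀ᶠ y in 𝓝 y₀, ∀ q, ¬ IsNat (s q) →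
      factor supp a (T y) q / φ q (p y) ∈ Complex.slitPlane := by
    refine eventually_all.2 fun q => ?_
    by_cases hq : IsNat (s q)
    · exact Eventually.of_forall fun y h => absurd hq h
    · filter_upwards [hslit q hq] with y hy _ using hy
  refine ⟨fun x => c * (∏ q, if IsNat (s q) then factor supp a x q ^ s q else
    Complex.exp (s q * (μ q y₀ + Complex.log (factor supp a x q / factor supp a (T y₀) q)))) *
    ∏ e, (polyVal supp a x (Sum.inr e))⁻¹, ?_, ?_⟩
  · have hfd : ∀ q, ContDiffAt ℂ ∞ (fun x => factor supp a x q) (T y₀) := fun q =>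
      (contDiff_factor_right supp a q).contDiffAt
    refine (contDiffAt_const.mul (contDiffAt_prod fun q _ => ?_)).mul
      (contDiffAt_prod fun e _ => ?_)
    · by_cases hq : IsNat (s q)
      · simp only [hq, if_true]
        obtain ⟨N, hN⟩ := hq
        simp only [hN, Complex.cpow_natCast]
        exact (hfd q).pow N
      · simp only [hq, if_false]
        have hone : factor supp a (T y₀) q / factor supp a (T y₀) q ∈ Complex.slitPlane := by
          rw [div_self]
          · exact Complex.one_mem_slitPlane
          · rw [← (hμe q hq).self_of_nhds]
            exact Complex.exp_ne_zero _
        refine ContDiffAt.cexp (contDiffAt_const.mul (contDiffAt_const.add ?_))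
        exact ContDiffAt.comp (g := Complex.log)
          (f := fun x => factor supp a x q / factor supp a (T y₀) q) (T y₀)
          (Complex.contDiffAt_log hone) ((hfd q).div_const _)
    · refine ContDiffAt.inv ?_ (hadm.2 e)
      exact (contDiff_polyVal_right supp a (Sum.inr e)).contDiffAt
  · filter_upwards [hpWe, hμlog, hslit'] with y hyW hyμ hys
    rw [hgW _ hyW, weight, ← mul_assoc]
    congr 1
    rw [mul_assoc, Complex.exp_sum, ← Finset.prod_mul_distrib]
    congr 1
    refine Finset.prod_congr rfl fun q _ => ?_
    by_cases hq : IsNat (s q)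
    · simp only [hq, if_true, Complex.exp_zero, one_mul]
      exact branchPow_of_isNat hq _ _
    · simp only [hq, if_false]
      rw [branchPow_of_not_isNat hq, ← hyμ q hq,
        Complex.cpow_def_of_ne_zero (Complex.slitPlane_ne_zero (hys q hq)), ← Complex.exp_add]
      congr 1
      simp only [μ]
      ring

/-! ### Stokes' theorem on a product of cubes -/

theorem integral_prodCube_fderiv_of_periodic {k r : ℕ} {f : (Fin k → ℝ) × (Fin r → ℝ) → ℂ}
    (hf : ContDiff ℝ 1 f) (e : Fin r) (hper : ∀ t θ, f (t, θ + Pi.single e 1) = f (t, θ)) :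
    ∫ z in unitCube k ×ˢ unitCube r, fderiv ℝ f z (0, Pi.single e 1) = 0 := by
  have hc : Continuous fun z => fderiv ℝ f z (0, Pi.single e 1) :=
    (hf.continuous_fderiv (by norm_num)).clm_apply continuous_const
  rw [Measure.volume_eq_prod, setIntegral_prod _ (hc.continuousOn.integrableOn_compact
    ((isCompact_unitCube k).prod (isCompact_unitCube r)))]
  have h1 : ∀ t : Fin k → ℝ,
      ∫ θ in unitCube r, fderiv ℝ f (t, θ) (0, Pi.single e 1) = 0 := by
    intro t
    have hft : ContDiff ℝ 1 fun θ => f (t, θ) := hf.comp (by fun_prop)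
    rw [← integral_fderiv_single_of_periodic hft e (hper t)]
    congr 1
    ext θ
    have h2 : HasFDerivAt (fun θ : Fin r → ℝ => (t, θ))
        (ContinuousLinearMap.inr ℝ (Fin k → ℝ) (Fin r → ℝ)) θ := hasFDerivAt_prodMk_right t θ
    have h3 := ((hf.differentiable (by norm_num) (t, θ)).hasFDerivAt.comp θ h2).fderiv
    have h4 : (f ∘ fun θ : Fin r → ℝ => (t, θ)) = fun θ => f (t, θ) := rfl
    rw [← h4, h3]
    simp
  simp [h1]

theorem integral_prodCube_fderiv {k r : ℕ} {f : (Fin (k + 1) → ℝ) × (Fin r → ℝ) → ℂ}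
    (hf : ContDiff ℝ 1 f) (q : Fin (k + 1)) :
    ∫ z in unitCube (k + 1) ×ˢ unitCube r, fderiv ℝ f z (Pi.single q 1, 0) =
      ∫ θ in unitCube r, ((∫ s in unitCube k, f (face q 1 s, θ)) -
        ∫ s in unitCube k, f (face q 0 s, θ)) := by
  have hc : Continuous fun z => fderiv ℝ f z (Pi.single q 1, 0) :=
    (hf.continuous_fderiv (by norm_num)).clm_apply continuous_const
  have hi : IntegrableOn (fun z : (Fin r → ℝ) × (Fin (k + 1) → ℝ) =>
      fderiv ℝ f z.swap (Pi.single q 1, 0)) (unitCube r ×ˢ unitCube (k + 1)) :=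
    (hc.comp continuous_swap).continuousOn.integrableOn_compact
      ((isCompact_unitCube r).prod (isCompact_unitCube (k + 1)))
  rw [Measure.volume_eq_prod, ← setIntegral_prod_swap, setIntegral_prod _ hi]
  congr 1
  ext θ
  have hft : ContDiff ℝ 1 fun t => f (t, θ) := hf.comp (by fun_prop)
  rw [← integral_fderiv_single hft q]
  congr 1
  ext t
  have h2 : HasFDerivAt (fun t : Fin (k + 1) → ℝ => (t, θ))
      (ContinuousLinearMap.inl ℝ (Fin (k + 1) → ℝ) (Fin r → ℝ)) t := hasFDerivAt_prodMk_left t θ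
  have h3 := ((hf.differentiable (by norm_num) (t, θ)).hasFDerivAt.comp t h2).fderiv
  have h4 : (f ∘ fun t : Fin (k + 1) → ℝ => (t, θ)) = fun t => f (t, θ) := rfl
  rw [← h4, h3]
  simp

/-- Moving `v` from slot `q` to the front is a cycle of sign `(-1)^q`. This is the orientation sign
of a face in the cubical boundary. -/
theorem volumeForm_insertNth {r k : ℕ} (u : Fin r → Fin (r + (k + 1)) → ℂ) (q : Fin (k + 1))
    (v : Fin (r + (k + 1)) → ℂ) (w : Fin k → Fin (r + (k + 1)) → ℂ) :
    volumeForm r (k + 1) (Sum.elim u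
      (Fin.insertNth (α := fun _ => Fin (r + (k + 1)) → ℂ) q v w)) =
      (-1) ^ (q : ℕ) * volumeForm r (k + 1)
        (Sum.elim u (Fin.cons (α := fun _ => Fin (r + (k + 1)) → ℂ) v w)) := by
  have h1 : Sum.elim u (Fin.insertNth (α := fun _ => Fin (r + (k + 1)) → ℂ) q v w) =
      Sum.elim u (Fin.cons (α := fun _ => Fin (r + (k + 1)) → ℂ) v w) ∘
        (Equiv.Perm.sumCongr 1 q.cycleRange) := by
    ext j p
    rcases j with e | q'
    · simp
    · have := congrFun (Fin.cons_comp_cycleRange v w q) q'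
      simp only [Sum.elim_inr, Function.comp_apply, Equiv.Perm.sumCongr_apply, Sum.map_inr]
      rw [← this]
      rfl
  rw [h1, AlternatingMap.map_perm, Equiv.Perm.sign_sumCongr, Equiv.Perm.sign_one, one_mul,
    Fin.sign_cycleRange]
  simp [Units.smul_def]

/-- The coordinate directions of a product of cubes, ordered as in `volumeForm`. -/
def cubeDir (r k : ℕ) : Fin r ⊕ Fin k → (Fin k → ℝ) × (Fin r → ℝ) :=
  Sum.elim (fun e => (0, Pi.single e 1)) (fun q => (Pi.single q 1, 0))

/-- The density of the form `G dx_1 ∧ ⋯ ∧ dx_m` pulled back by a family `T` of product cubes. -/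
def density {r k : ℕ} (G : ℝ × (Fin k → ℝ) × (Fin r → ℝ) → ℂ)
    (T : ℝ × (Fin k → ℝ) × (Fin r → ℝ) → Fin (r + k) → ℂ) (y : ℝ × (Fin k → ℝ) × (Fin r → ℝ)) : ℂ :=
  G y * volumeForm r k fun j => fderiv ℝ T y (0, cubeDir r k j)

/-- The density of the contraction of this form with the direction of the family. -/
def flux {r k : ℕ} (G : ℝ × (Fin k → ℝ) × (Fin r → ℝ) → ℂ)
    (T : ℝ × (Fin k → ℝ) × (Fin r → ℝ) → Fin (r + k) → ℂ) (j : Fin r ⊕ Fin k)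
    (y : ℝ × (Fin k → ℝ) × (Fin r → ℝ)) : ℂ :=
  G y * volumeForm r k
    (Function.update (fun i => fderiv ℝ T y (0, cubeDir r k i)) j (fderiv ℝ T y (1, 0)))

theorem contDiffAt_volumeForm_comp {E : Type*} [NormedAddCommGroup E] [NormedSpace ℝ E] {r k : ℕ}
    {w : Fin r ⊕ Fin k → E → Fin (r + k) → ℂ} {y : E} (hw : ∀ j, ContDiffAt ℝ ∞ (w j) y) :
    ContDiffAt ℝ ∞ (fun z => volumeForm r k fun j => w j z) y :=
  ((volumeCMM r k).contDiff.contDiffAt (x := fun j => w j y)).comp y (contDiffAt_pi.2 hw)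

section Stokes

variable {r k : ℕ} {G : ℝ × (Fin k → ℝ) × (Fin r → ℝ) → ℂ}
  {T : ℝ × (Fin k → ℝ) × (Fin r → ℝ) → Fin (r + k) → ℂ}

theorem contDiffAt_fderiv_apply {y : ℝ × (Fin k → ℝ) × (Fin r → ℝ)} (hT : ContDiffAt ℝ ∞ T y)
    (v : ℝ × (Fin k → ℝ) × (Fin r → ℝ)) : ContDiffAt ℝ ∞ (fun z => fderiv ℝ T z v) y :=
  (hT.fderiv_right (m := ∞) (by simp)).clm_apply contDiffAt_const

theorem contDiffAt_density {y : ℝ × (Fin k → ℝ) × (Fin r → ℝ)} (hG : ContDiffAt ℝ ∞ G y)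
    (hT : ContDiffAt ℝ ∞ T y) : ContDiffAt ℝ ∞ (density G T) y :=
  hG.mul (contDiffAt_volumeForm_comp fun _ => contDiffAt_fderiv_apply hT _)

theorem flux_eq (j : Fin r ⊕ Fin k) (y : ℝ × (Fin k → ℝ) × (Fin r → ℝ)) :
    flux G T j y = G y * volumeForm r k fun i => fderiv ℝ T y
      (Function.update (fun i => ((0 : ℝ), cubeDir r k i)) j (1, 0) i) := by
  unfold flux
  congr 2
  ext i
  simp only [Function.update_apply]
  split_ifs <;> rfl

theorem contDiffAt_flux {y : ℝ × (Fin k → ℝ) × (Fin r → ℝ)} (hG : ContDiffAt ℝ ∞ G y)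
    (hT : ContDiffAt ℝ ∞ T y) (j : Fin r ⊕ Fin k) : ContDiffAt ℝ ∞ (flux G T j) y := by
  have h1 : flux G T j = fun y => G y * volumeForm r k fun i => fderiv ℝ T y
      (Function.update (fun i => ((0 : ℝ), cubeDir r k i)) j (1, 0) i) := funext (flux_eq j)
  rw [h1]
  exact hG.mul (contDiffAt_volumeForm_comp fun _ => contDiffAt_fderiv_apply hT _)

theorem flux_periodic (hTper : ∀ s t θ e, T (s, t, θ + Pi.single e 1) = T (s, t, θ))
    (hGper : ∀ s t θ e, G (s, t, θ + Pi.single e 1) = G (s, t, θ)) (j : Fin r ⊕ Fin k) (s : ℝ)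
    (t : Fin k → ℝ) (θ : Fin r → ℝ) (e : Fin r) :
    flux G T j (s, t, θ + Pi.single e 1) = flux G T j (s, t, θ) := by
  have h1 : (fun y => T (y + (0, 0, Pi.single e 1))) = T := by
    ext1 ⟨s, t, θ⟩
    simpa using hTper s t θ e
  have h2 : fderiv ℝ T (s, t, θ + Pi.single e 1) = fderiv ℝ T (s, t, θ) := by
    have h3 := fderiv_comp_add_right (𝕜 := ℝ) (f := T) (x := (s, t, θ)) (0, 0, Pi.single e 1)
    rw [h1] at h3
    rw [h3]
    simp
  unfold flux
  rw [h2, hGper]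

/-- Stokes' theorem for a family of product cubes that are periodic in the second group of
variables. -/
theorem integral_fderiv_density {s₀ : ℝ} (hT : ∀ z, ContDiffAt ℝ ∞ T (s₀, z))
    (hG : ∀ z, ContDiffAt ℝ ∞ G (s₀, z))
    (hGT : ∀ z, ∃ L : (Fin (r + k) → ℂ) →L[ℂ] ℂ,
      HasFDerivAt G ((L.restrictScalars ℝ).comp (fderiv ℝ T (s₀, z))) (s₀, z))
    (hTper : ∀ s t θ e, T (s, t, θ + Pi.single e 1) = T (s, t, θ))
    (hGper : ∀ s t θ e, G (s, t, θ + Pi.single e 1) = G (s, t, θ)) :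
    ∫ z in unitCube k ×ˢ unitCube r, fderiv ℝ (density G T) (s₀, z) (1, 0) =
      ∑ q : Fin k, ∫ z in unitCube k ×ˢ unitCube r,
        fderiv ℝ (fun z => flux G T (Sum.inr q) (s₀, z)) z (Pi.single q 1, 0) := by
  have hflux : ∀ j, ContDiff ℝ ∞ fun z => flux G T j (s₀, z) := fun j =>
    contDiff_iff_contDiffAt.2 fun z => (contDiffAt_flux (hG z) (hT z) j).comp z
      (by fun_prop : ContDiffAt ℝ ∞ (fun z => (s₀, z)) z)
  have hslice : ∀ j z v, fderiv ℝ (flux G T j) (s₀, z) (0, v) =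
      fderiv ℝ (fun z => flux G T j (s₀, z)) z v := by
    intro j z v
    have h1 := (((contDiffAt_flux (hG z) (hT z) j).differentiableAt (by simp)).hasFDerivAt.comp z
      (hasFDerivAt_prodMk_right s₀ z)).fderiv
    have h4 : (flux G T j ∘ fun z : (Fin k → ℝ) × (Fin r → ℝ) => (s₀, z)) =
      fun z => flux G T j (s₀, z) := rfl
    rw [← h4, h1]
    simp
  -- Closedness of the form: the derivative of the density in the direction of the deformation is
  -- the divergence of the flux.
  have hpt : ∀ z, fderiv ℝ (density G T) (s₀, z) (1, 0) =
      ∑ j, fderiv ℝ (fun z => flux G T j (s₀, z)) z (cubeDir r k j) := by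
    intro z
    obtain ⟨L, hL⟩ := hGT z
    have h1 := fderiv_pullback_volumeForm ((hT z).of_le (WithTop.coe_le_coe.2 le_top)) hL
      (fun j => (0, cubeDir r k j)) (1, 0)
    simp only [← hslice]
    exact h1
  have hint : ∀ j, IntegrableOn (fun z => fderiv ℝ (fun z => flux G T j (s₀, z)) z (cubeDir r k j))
      (unitCube k ×ˢ unitCube r) := fun j =>
    (((hflux j).continuous_fderiv (by simp)).clm_apply
      continuous_const).continuousOn.integrableOn_compact
      ((isCompact_unitCube k).prod (isCompact_unitCube r))
  simp only [hpt]
  rw [integral_finsetSum _ fun j _ => hint j, Fintype.sum_sum_type]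
  simp only [cubeDir, Sum.elim_inl, Sum.elim_inr]
  -- The fluxes in the circle directions integrate to zero by periodicity; only those through the
  -- faces of the base cube remain.
  rw [Finset.sum_eq_zero, zero_add]
  intro e _
  exact integral_prodCube_fderiv_of_periodic ((hflux _).of_le (by exact_mod_cast le_top)) e
    fun t θ => flux_periodic hTper hGper _ _ _ _ _

end Stokes

/-! ### Deformations of cycles -/

/-- Each value `H x` is spread evenly over the class of `x`, which avoids choosing representatives;
exchanging the sums then produces the class sums of `c`. The alternative `H y = 0` accommodates
degenerate faces, for which the class sum need not vanish. -/
theorem sum_mul_eq_zero_of_class_sums {X : Type*} [Fintype X] {rel : X → X → Prop}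
    [DecidableRel rel] (hrel : Equivalence rel) {c H : X → ℂ}
    (hH : ∀ x y, rel x y → H x = H y)
    (h0 : ∀ y, H y = 0 ∨ ∑ x, (if rel x y then c x else 0) = 0) : ∑ x, c x * H x = 0 := by
  let n : X → ℂ := fun x => ∑ y, if rel x y then 1 else 0
  have hn : ∀ x, n x ≠ 0 := by
    intro x
    have h1 : n x = (Finset.univ.filter fun y => rel x y).card := by simp [n]
    rw [h1, Nat.cast_ne_zero, Finset.card_ne_zero]
    exact ⟨x, by simpa using hrel.refl x⟩
  have hn' : ∀ x y, rel x y → n x = n y := by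
    intro x y h
    refine Finset.sum_congr rfl fun z _ => if_congr ⟨fun h' => ?_, fun h' => ?_⟩ rfl rfl
    · exact hrel.trans (hrel.symm h) h'
    · exact hrel.trans h h'
  calc ∑ x, c x * H x = ∑ x, ∑ y, (if rel x y then c x else 0) * (H y / n y) := by
        refine Finset.sum_congr rfl fun x _ => ?_
        have h1 : ∀ y, (if rel x y then c x else 0) * (H y / n y) =
            c x * (H x / n x) * (if rel x y then 1 else 0) := by
          intro y
          split_ifs with h
          · rw [hH x y h, hn' x y h, mul_one]
          · simp
        simp only [h1, ← Finset.mul_sum]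
        change _ = c x * (H x / n x) * n x
        rw [mul_assoc, div_mul_cancel₀ _ (hn x)]
    _ = ∑ y, (∑ x, if rel x y then c x else 0) * (H y / n y) := by
        rw [Finset.sum_comm]
        exact Finset.sum_congr rfl fun y _ => (Finset.sum_mul _ _ _).symm
    _ = 0 := by
        refine Finset.sum_eq_zero fun y _ => ?_
        rcases h0 y with h | h <;> simp [h]

theorem equivalence_sameOn {P E ι : Type*} {k : ℕ} (S : Set P) (τ : ι → P → (Fin k → ℝ) → E) :
    Equivalence fun x y => SameOn S (τ x) (τ y) :=
  ⟨fun _ _ _ _ _ => rfl, fun h a ha s hs => (h a ha s hs).symm,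
    fun h h' a ha s hs => (h a ha s hs).trans (h' a ha s hs)⟩

/-! ### Product cubes swept out by a deformation. -/

section Homotopy

variable {l r k N : ℕ} {supp : Fin l ⊕ Fin r → Finset (Fin (r + k) →₀ ℕ)}

/-- The family of product cubes swept out by a parametrized deformation of the `i`-th cube. -/
def sweep (C : TwistedChain supp N) (b : ℝ → CoeffIndex supp → ℂ)
    (Θ : ℝ × (Fin (r + k) → ℂ) × (Fin r → ℝ) → Fin (r + k) → ℂ) (i : Fin N)
    (y : ℝ × (Fin k → ℝ) × (Fin r → ℝ)) : Fin (r + k) → ℂ :=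
  Θ (y.1, C.cube i (b y.1) (cubeParam y.2.1), y.2.2)

/-- The integrand along `sweep`. -/
def sweepWeight (C : TwistedChain supp N) (lam : Fin l → ℂ) (β : Fin (r + k) → ℂ)
    (a : CoeffIndex supp → ℂ) (b : ℝ → CoeffIndex supp → ℂ)
    (Θ : ℝ × (Fin (r + k) → ℂ) × (Fin r → ℝ) → Fin (r + k) → ℂ) (i : Fin N)
    (y : ℝ × (Fin k → ℝ) × (Fin r → ℝ)) : ℂ :=
  C.sect i (b y.1) (cubeParam y.2.1) * weight supp lam β a
    (factor supp (b y.1) (C.cube i (b y.1) (cubeParam y.2.1))) (sweep C b Θ i y)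

end Homotopy

/-! ### The flux through a face of a swept cube. -/

section Faces

variable {l r k N : ℕ} {supp : Fin l ⊕ Fin r → Finset (Fin (r + (k + 1)) →₀ ℕ)}
  (C : TwistedChain supp N) (b : ℝ → CoeffIndex supp → ℂ)
  (Θ : ℝ × (Fin (r + (k + 1)) → ℂ) × (Fin r → ℝ) → Fin (r + (k + 1)) → ℂ)

/-- The restriction of `sweep` to a face of a cube. -/
def faceSweep (F : Fin N × Fin (k + 1) × Fin 2) (y : ℝ × (Fin k → ℝ) × (Fin r → ℝ)) :
    Fin (r + (k + 1)) → ℂ :=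
  Θ (y.1, C.cube F.1 (b y.1) (face F.2.1 F.2.2 (cubeParam y.2.1)), y.2.2)

/-- The volume swept out by a face. -/
def faceVolume (F : Fin N × Fin (k + 1) × Fin 2) (y : ℝ × (Fin k → ℝ) × (Fin r → ℝ)) : ℂ :=
  volumeForm r (k + 1) (Sum.elim (fun e => fderiv ℝ (faceSweep C b Θ F) y (0, 0, Pi.single e 1))
    (Fin.cons (α := fun _ => Fin (r + (k + 1)) → ℂ) (fderiv ℝ (faceSweep C b Θ F) y (1, 0))
      fun q => fderiv ℝ (faceSweep C b Θ F) y (0, Pi.single q 1, 0)))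

theorem faceSweep_eq (F : Fin N × Fin (k + 1) × Fin 2) (y : ℝ × (Fin k → ℝ) × (Fin r → ℝ)) :
    faceSweep C b Θ F y = sweep C b Θ F.1 (y.1, face F.2.1 F.2.2 y.2.1, y.2.2) := by
  simp only [faceSweep, sweep, cubeParam_face]

theorem hasFDerivAt_face (q : Fin (k + 1)) (ε : Fin 2) (y : ℝ × (Fin k → ℝ) × (Fin r → ℝ)) :
    ∃ A : (ℝ × (Fin k → ℝ) × (Fin r → ℝ)) →L[ℝ] (ℝ × (Fin (k + 1) → ℝ) × (Fin r → ℝ)),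
      HasFDerivAt (fun y : ℝ × (Fin k → ℝ) × (Fin r → ℝ) => (y.1, face q ε y.2.1, y.2.2)) A y ∧
      A (1, 0) = (1, 0) ∧ (∀ e, A (0, 0, Pi.single e 1) = (0, 0, Pi.single e 1)) ∧
      ∀ q', A (0, Pi.single q' 1, 0) = (0, Pi.single (q.succAbove q') 1, 0) := by
  let A₀ : (Fin k → ℝ) →L[ℝ] (Fin (k + 1) → ℝ) := LinearMap.toContinuousLinearMap
    { toFun := fun s => Fin.insertNth (α := fun _ => ℝ) q 0 s
      map_add' := fun s t => by
        ext i
        rcases Fin.eq_self_or_eq_succAbove q i with rfl | ⟨i, rfl⟩ <;> simp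
      map_smul' := fun c s => by
        ext i
        rcases Fin.eq_self_or_eq_succAbove q i with rfl | ⟨i, rfl⟩ <;> simp }
  have hA₀ : ∀ s, A₀ s = Fin.insertNth (α := fun _ => ℝ) q 0 s := fun s => rfl
  have hface : ∀ s, face q ε s = A₀ s + Pi.single q ((ε : ℕ) : ℝ) := by
    intro s
    ext i
    rcases Fin.eq_self_or_eq_succAbove q i with rfl | ⟨i, rfl⟩ <;> simp [face, hA₀]
  have h1 : HasFDerivAt (face q ε) A₀ y.2.1 := by
    rw [show face q ε = fun s => A₀ s + Pi.single q ((ε : ℕ) : ℝ) from funext hface]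
    exact A₀.hasFDerivAt.add_const _
  refine ⟨_, hasFDerivAt_fst.prodMk ((h1.comp y (hasFDerivAt_fst.comp y hasFDerivAt_snd)).prodMk
    (hasFDerivAt_snd.comp y hasFDerivAt_snd)), ?_, fun e => ?_, fun q' => ?_⟩
  · simp
  · simp
  · simp only [ContinuousLinearMap.prod_apply, ContinuousLinearMap.comp_apply,
      ContinuousLinearMap.coe_fst', ContinuousLinearMap.coe_snd']
    refine Prod.ext rfl (Prod.ext ?_ rfl)
    ext i
    rcases Fin.eq_self_or_eq_succAbove q i with rfl | ⟨i, rfl⟩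
    · simp [hA₀]
    · simp [hA₀, Pi.single_apply]

variable {C b Θ}

/-- In the flux through the face `t_q = ε`, the deformation direction replaces the normal direction
`q`, so only tangent vectors of the swept face occur. The sign comes from bringing that direction to
the front. -/
theorem flux_face {s₀ : ℝ} (F : Fin N × Fin (k + 1) × Fin 2) (t : Fin k → ℝ) (θ : Fin r → ℝ)
    (hT : ContDiffAt ℝ ∞ (sweep C b Θ F.1) (s₀, face F.2.1 F.2.2 t, θ))
    (G : ℝ × (Fin (k + 1) → ℝ) × (Fin r → ℝ) → ℂ) :
    flux G (sweep C b Θ F.1) (Sum.inr F.2.1) (s₀, face F.2.1 F.2.2 t, θ) =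
      G (s₀, face F.2.1 F.2.2 t, θ) * ((-1) ^ (F.2.1 : ℕ) * faceVolume C b Θ F (s₀, t, θ)) := by
  obtain ⟨A, hA, hA1, hAe, hAq⟩ := hasFDerivAt_face (r := r) F.2.1 F.2.2 (s₀, t, θ)
  have h1 : fderiv ℝ (faceSweep C b Θ F) (s₀, t, θ) =
      (fderiv ℝ (sweep C b Θ F.1) (s₀, face F.2.1 F.2.2 t, θ)).comp A := by
    have h2 : HasFDerivAt (sweep C b Θ F.1)
      (fderiv ℝ (sweep C b Θ F.1) (s₀, face F.2.1 F.2.2 t, θ)) (s₀, face F.2.1 F.2.2 t, θ) :=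
      (hT.differentiableAt (by simp)).hasFDerivAt
    have h3 := HasFDerivAt.comp (g := sweep C b Θ F.1) (s₀, t, θ) h2 hA
    rw [show faceSweep C b Θ F = _ from funext (faceSweep_eq C b Θ F)]
    exact h3.fderiv
  unfold flux faceVolume
  congr 1
  rw [← volumeForm_insertNth]
  congr 1
  ext1 j
  rcases j with e | q
  · simp [h1, hAe, cubeDir]
  · rcases Fin.eq_self_or_eq_succAbove F.2.1 q with h | ⟨q', h⟩
    · simp [h, h1, hA1]
    · rw [h, Function.update_of_ne (by simp [Fin.succAbove_ne])]
      simp [h1, hAq, cubeDir]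

/-- The volume contains a derivative in the deformation parameter, so equality of the faces at a
single coefficient vector would not suffice. Equality over `U` makes the swept faces agree as germs.
-/
theorem faceVolume_congr {U : Set (CoeffIndex supp → ℂ)} {s₀ : ℝ} (hb : ∀ᶠ s in 𝓝 s₀, b s ∈ U)
    {F F' : Fin N × Fin (k + 1) × Fin 2}
    (h : SameOn U (fun a s => C.cube F.1 a (face F.2.1 F.2.2 s))
      (fun a s => C.cube F'.1 a (face F'.2.1 F'.2.2 s))) (t : Fin k → ℝ) (θ : Fin r → ℝ) :
    faceVolume C b Θ F (s₀, t, θ) = faceVolume C b Θ F' (s₀, t, θ) := by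
  have h1 : faceSweep C b Θ F =ᶠ[𝓝 (s₀, t, θ)] faceSweep C b Θ F' := by
    have h2 : ∀ᶠ y : ℝ × (Fin k → ℝ) × (Fin r → ℝ) in 𝓝 (s₀, t, θ), b y.1 ∈ U :=
      (continuous_fst.tendsto (s₀, t, θ)).eventually hb
    filter_upwards [h2] with y hy
    have h3 : C.cube F.1 (b y.1) (face F.2.1 F.2.2 (cubeParam y.2.1)) =
      C.cube F'.1 (b y.1) (face F'.2.1 F'.2.2 (cubeParam y.2.1)) := h _ hy _ (cubeParam_mem _)
    simp only [faceSweep, h3]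
  unfold faceVolume
  rw [h1.fderiv_eq]

/-- A face that is constant in one coordinate has a zero tangent vector in that direction, and the
determinant vanishes. -/
theorem faceVolume_eq_zero {U : Set (CoeffIndex supp → ℂ)} {s₀ : ℝ} (hs₀ : b s₀ ∈ U)
    {F : Fin N × Fin (k + 1) × Fin 2}
    (h : IsDegenerateOn U (fun a s => C.cube F.1 a (face F.2.1 F.2.2 s))) (t : Fin k → ℝ)
    (θ : Fin r → ℝ) : faceVolume C b Θ F (s₀, t, θ) = 0 := by
  obtain ⟨q, hq⟩ := h
  refine AlternatingMap.map_coord_zero _ (Sum.inr q.succ) ?_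
  simp only [Sum.elim_inr, Fin.cons_succ]
  -- Smoothness of `Θ` need not be assumed: where the sweep is not differentiable, `fderiv` is zero
  -- by convention and the conclusion still holds.
  by_cases hd : DifferentiableAt ℝ (faceSweep C b Θ F) (s₀, t, θ)
  · have h1 : HasDerivAt (fun u : ℝ => ((s₀, t + u • Pi.single q 1, θ) :
        ℝ × (Fin k → ℝ) × (Fin r → ℝ))) (0, Pi.single q 1, 0) 0 := by
      refine (hasDerivAt_const _ _).prodMk (HasDerivAt.prodMk ?_ (hasDerivAt_const _ _))
      simpa using ((hasDerivAt_id (0 : ℝ)).smul_const (Pi.single q (1 : ℝ))).const_add t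
    have h2 : HasFDerivAt (faceSweep C b Θ F) (fderiv ℝ (faceSweep C b Θ F) (s₀, t, θ))
        (s₀, t + (0 : ℝ) • Pi.single q 1, θ) := by
      simpa using hd.hasFDerivAt
    have h3 := h2.comp_hasDerivAt (0 : ℝ) h1
    have h4 : (faceSweep C b Θ F ∘ fun u : ℝ => ((s₀, t + u • Pi.single q 1, θ) :
        ℝ × (Fin k → ℝ) × (Fin r → ℝ))) = fun _ => faceSweep C b Θ F (s₀, t, θ) := by
      ext1 u
      simp only [Function.comp_apply, faceSweep]
      have h5 : t + u • Pi.single q 1 = Function.update t q (t q + u) := by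
        ext i
        rcases eq_or_ne i q with rfl | hi <;> simp [*]
      have h6 := cubeParam_mem (Function.update t q (t q + u))
      have h7 := hq (b s₀) hs₀ (cubeParam t) (cubeParam_mem t)
        (cubeParam (Function.update t q (t q + u)) q) ⟨h6.1 q, h6.2 q⟩
      rw [h5]
      congr 3
      rw [cubeParam_update] at h7 ⊢
      simpa using h7
    rw [h4] at h3
    exact h3.unique (hasDerivAt_const _ _)
  · rw [fderiv_zero_of_not_differentiableAt hd]
    rfl

end Faces

/-! ### Cancellation of the fluxes through the faces of a cycle. -/

section Cancellation

variable {l r k N : ℕ} {supp : Fin l ⊕ Fin r → Finset (Fin (r + (k + 1)) →₀ ℕ)}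
  {C : TwistedChain supp N} {lam : Fin l → ℂ} {β : Fin (r + (k + 1)) → ℂ}
  {b : ℝ → CoeffIndex supp → ℂ}
  {Θ : ℝ × (Fin (r + (k + 1)) → ℂ) × (Fin r → ℝ) → Fin (r + (k + 1)) → ℂ}
  {U : Set (CoeffIndex supp → ℂ)} {s₀ : ℝ}

/-- The fluxes through the faces of a closed family of chains cancel. -/
theorem sum_flux_face_eq_zero (hC : IsClosedOn U C.cube C.sect) (hb : ∀ᶠ s in 𝓝 s₀, b s ∈ U)
    (hT : ∀ i z, ContDiffAt ℝ ∞ (sweep C b Θ i) (s₀, z)) (a : CoeffIndex supp → ℂ)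
    (t : Fin k → ℝ) (θ : Fin r → ℝ) :
    ∑ i, ∑ q, (flux (sweepWeight C lam β a b Θ i) (sweep C b Θ i) (Sum.inr q)
        (s₀, face q 1 t, θ) -
      flux (sweepWeight C lam β a b Θ i) (sweep C b Θ i) (Sum.inr q) (s₀, face q 0 t, θ)) = 0 := by
  classical
  -- The flux is split into the signed coefficient `c` of the boundary and a part `H` that depends
  -- on the face only through its family of points, so that the class sums in `IsClosedOn` apply.
  let c : Fin N × Fin (k + 1) × Fin 2 → ℂ := fun F =>
    (-1 : ℂ) ^ ((F.2.1 : ℕ) + (F.2.2 : ℕ)) * C.sect F.1 (b s₀) (face F.2.1 F.2.2 (cubeParam t))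
  let H : Fin N × Fin (k + 1) × Fin 2 → ℂ := fun F =>
    weight supp lam β a (factor supp (b s₀) (C.cube F.1 (b s₀) (face F.2.1 F.2.2 (cubeParam t))))
      (Θ (s₀, C.cube F.1 (b s₀) (face F.2.1 F.2.2 (cubeParam t)), θ)) *
      faceVolume C b Θ F (s₀, t, θ)
  have hbU := hb.self_of_nhds
  have h1 : ∑ F, c F * H F = 0 := by
    refine sum_mul_eq_zero_of_class_sums (equivalence_sameOn U
      (fun (F : Fin N × Fin (k + 1) × Fin 2) a s => C.cube F.1 a (face F.2.1 F.2.2 s))) ?_ ?_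
    · intro F F' h
      have h3 : C.cube F.1 (b s₀) (face F.2.1 F.2.2 (cubeParam t)) =
        C.cube F'.1 (b s₀) (face F'.2.1 F'.2.2 (cubeParam t)) := h _ hbU _ (cubeParam_mem t)
      simp only [H]
      rw [faceVolume_congr hb h, h3]
    · intro F
      by_cases hd : IsDegenerateOn U (fun a s => C.cube F.1 a (face F.2.1 F.2.2 s))
      · left
        simp only [H]
        rw [faceVolume_eq_zero hbU hd, mul_zero]
      · right
        exact hC F hd _ hbU _ (cubeParam_mem t)
  have h2 : ∀ F : Fin N × Fin (k + 1) × Fin 2,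
      flux (sweepWeight C lam β a b Θ F.1) (sweep C b Θ F.1) (Sum.inr F.2.1)
        (s₀, face F.2.1 F.2.2 t, θ) = (-1) ^ (F.2.2 : ℕ) * (c F * H F) := by
    intro F
    rw [flux_face F t θ (hT _ _)]
    simp only [c, H, sweepWeight, sweep, cubeParam_face, pow_add]
    have h3 : ((-1 : ℂ) ^ (F.2.2 : ℕ)) * (-1) ^ (F.2.2 : ℕ) = 1 := by
      rw [← mul_pow]
      simp
    linear_combination (- (-1) ^ (F.2.1 : ℕ) *
      C.sect F.1 (b s₀) (face F.2.1 F.2.2 (cubeParam t)) *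
      (weight supp lam β a
        (factor supp (b s₀) (C.cube F.1 (b s₀) (face F.2.1 F.2.2 (cubeParam t))))
        (Θ (s₀, C.cube F.1 (b s₀) (face F.2.1 F.2.2 (cubeParam t)), θ)) *
      faceVolume C b Θ F (s₀, t, θ))) * h3
  rw [Fintype.sum_prod_type] at h1
  simp only [Fintype.sum_prod_type, Fin.sum_univ_two] at h1
  rw [← neg_eq_zero, ← h1, ← Finset.sum_neg_distrib]
  refine Finset.sum_congr rfl fun i _ => ?_
  rw [← Finset.sum_neg_distrib]
  refine Finset.sum_congr rfl fun q _ => ?_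
  rw [h2 (i, q, 1), h2 (i, q, 0)]
  simp

theorem sum_integral_fderiv_flux_eq_zero (hC : IsClosedOn U C.cube C.sect)
    (hb : ∀ᶠ s in 𝓝 s₀, b s ∈ U) (hT : ∀ i z, ContDiffAt ℝ ∞ (sweep C b Θ i) (s₀, z))
    (a : CoeffIndex supp → ℂ)
    (hG : ∀ i z, ContDiffAt ℝ ∞ (sweepWeight C lam β a b Θ i) (s₀, z)) :
    ∑ i, ∑ q : Fin (k + 1), ∫ z in unitCube (k + 1) ×ˢ unitCube r,
      fderiv ℝ (fun z => flux (sweepWeight C lam β a b Θ i) (sweep C b Θ i) (Sum.inr q) (s₀, z)) z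
        (Pi.single q 1, 0) = 0 := by
  have hflux : ∀ i j, ContDiff ℝ ∞ fun z =>
      flux (sweepWeight C lam β a b Θ i) (sweep C b Θ i) j (s₀, z) := fun i j =>
    contDiff_iff_contDiffAt.2 fun z => (contDiffAt_flux (hG i z) (hT i z) j).comp z
      (by fun_prop : ContDiffAt ℝ ∞ (fun z => (s₀, z)) z)
  have hface : ∀ (q : Fin (k + 1)) (ε : Fin 2), Continuous fun s : Fin k → ℝ => face q ε s := by
    intro q ε
    unfold face
    exact Continuous.finInsertNth q continuous_const continuous_id
  have hcont : ∀ i (q : Fin (k + 1)) (ε : Fin 2), Continuous fun p : (Fin r → ℝ) × (Fin k → ℝ) =>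
      flux (sweepWeight C lam β a b Θ i) (sweep C b Θ i) (Sum.inr q) (s₀, face q ε p.2, p.1) :=
    fun i q ε => (hflux i (Sum.inr q)).continuous.comp
      (((hface q ε).comp continuous_snd).prodMk continuous_fst)
  have hint : ∀ i (q : Fin (k + 1)), IntegrableOn (fun p : (Fin r → ℝ) × (Fin k → ℝ) =>
      flux (sweepWeight C lam β a b Θ i) (sweep C b Θ i) (Sum.inr q) (s₀, face q 1 p.2, p.1) -
      flux (sweepWeight C lam β a b Θ i) (sweep C b Θ i) (Sum.inr q) (s₀, face q 0 p.2, p.1))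
      (unitCube r ×ˢ unitCube k) (volume.prod volume) := fun i q =>
    ((hcont i q 1).sub (hcont i q 0)).continuousOn.integrableOn_compact
      ((isCompact_unitCube r).prod (isCompact_unitCube k))
  have h1 : ∀ i (q : Fin (k + 1)), ∫ z in unitCube (k + 1) ×ˢ unitCube r,
      fderiv ℝ (fun z => flux (sweepWeight C lam β a b Θ i) (sweep C b Θ i) (Sum.inr q) (s₀, z)) z
        (Pi.single q 1, 0) = ∫ p in unitCube r ×ˢ unitCube k,
      (flux (sweepWeight C lam β a b Θ i) (sweep C b Θ i) (Sum.inr q) (s₀, face q 1 p.2, p.1) -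
      flux (sweepWeight C lam β a b Θ i) (sweep C b Θ i) (Sum.inr q) (s₀, face q 0 p.2, p.1))
      ∂(volume.prod volume) := by
    intro i q
    rw [integral_prodCube_fderiv ((hflux i _).of_le (by exact_mod_cast le_top)) q,
      setIntegral_prod _ (hint i q)]
    congr 1
    ext θ
    rw [integral_sub]
    · exact ((hcont i q 1).comp (by fun_prop : Continuous fun s : Fin k → ℝ =>
        (θ, s))).continuousOn.integrableOn_compact (isCompact_unitCube k)
    · exact ((hcont i q 0).comp (by fun_prop : Continuous fun s : Fin k → ℝ =>
        (θ, s))).continuousOn.integrableOn_compact (isCompact_unitCube k)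
  simp only [h1]
  calc _ = ∑ i, ∫ p in unitCube r ×ˢ unitCube k, ∑ q : Fin (k + 1),
      (flux (sweepWeight C lam β a b Θ i) (sweep C b Θ i) (Sum.inr q) (s₀, face q 1 p.2, p.1) -
      flux (sweepWeight C lam β a b Θ i) (sweep C b Θ i) (Sum.inr q) (s₀, face q 0 p.2, p.1))
      ∂(volume.prod volume) :=
        Finset.sum_congr rfl fun i _ => (integral_finsetSum _ fun q _ => hint i q).symm
    _ = ∫ p in unitCube r ×ˢ unitCube k, ∑ i, ∑ q : Fin (k + 1),
      (flux (sweepWeight C lam β a b Θ i) (sweep C b Θ i) (Sum.inr q) (s₀, face q 1 p.2, p.1) -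
      flux (sweepWeight C lam β a b Θ i) (sweep C b Θ i) (Sum.inr q) (s₀, face q 0 p.2, p.1))
      ∂(volume.prod volume) :=
        (integral_finsetSum _ fun i _ => integrable_finsetSum _ fun q _ => hint i q).symm
    _ = 0 := by
      simp only [sum_flux_face_eq_zero hC hb hT, integral_zero]

end Cancellation

/-! ### Invariance of the integral under deformation. -/

section Homotopy

variable {l r k N : ℕ} {supp : Fin l ⊕ Fin r → Finset (Fin (r + k) →₀ ℕ)}
  {C : TwistedChain supp N} {lam : Fin l → ℂ} {β : Fin (r + k) → ℂ}
  {U : Set (CoeffIndex supp → ℂ)}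

/-- Since `cubeParam` takes all its values in the closed cube, smoothness within the cube becomes
smoothness in a full neighbourhood after composition. -/
theorem TwistedChain.IsCycleOn.contDiffAt_cube {E : Type*} [NormedAddCommGroup E]
    [NormedSpace ℝ E] (hC : C.IsCycleOn lam β U) {b : E → CoeffIndex supp → ℂ}
    {τ : E → Fin k → ℝ} {y : E} (hb : ContDiffAt ℝ ∞ b y) (hbU : ∀ᶠ z in 𝓝 y, b z ∈ U)
    (hτ : ContDiffAt ℝ ∞ τ y) (i : Fin N) :
    ContDiffAt ℝ ∞ (fun z => C.cube i (b z) (cubeParam (τ z))) y := by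
  have h1 := hC.smooth i (b y, cubeParam (τ y)) ⟨hbU.self_of_nhds, cubeParam_mem _⟩
  have h2 : ContDiffAt ℝ ∞ (fun z => (b z, cubeParam (τ z))) y :=
    hb.prodMk ((contDiff_cubeParam k).contDiffAt.comp y hτ)
  rw [← contDiffWithinAt_univ] at h2 ⊢
  refine ContDiffWithinAt.comp_of_preimage_mem_nhdsWithin (f := fun z => (b z, cubeParam (τ z)))
    (g := fun p : (CoeffIndex supp → ℂ) × (Fin k → ℝ) => C.cube i p.1 p.2) y h1 h2 ?_
  rw [nhdsWithin_univ]
  filter_upwards [hbU] with z hz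
  exact ⟨hz, cubeParam_mem _⟩

/-- The integral over a deformation of a cycle of a closed form does not depend on the parameter of
the deformation. -/
theorem hasDerivAt_sweep_integral (hC : C.IsCycleOn lam β U) (a : CoeffIndex supp → ℂ)
    {I : Set ℝ} (hI : IsOpen I) {b : ℝ → CoeffIndex supp → ℂ} (hb : ∀ s ∈ I, ContDiffAt ℝ ∞ b s)
    (hbU : ∀ s ∈ I, b s ∈ U) {Θ : ℝ × (Fin (r + k) → ℂ) × (Fin r → ℝ) → Fin (r + k) → ℂ}
    (hΘ : ∀ s ∈ I, ∀ i t θ, ContDiffAt ℝ ∞ Θ (s, C.cube i (b s) (cubeParam t), θ))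
    (hper : ∀ s x θ e, Θ (s, x, θ + Pi.single e 1) = Θ (s, x, θ))
    (hadm : ∀ s ∈ I, ∀ i t θ, IsAdmissible supp lam β a
      (factor supp (b s) (C.cube i (b s) (cubeParam t)))
      (Θ (s, C.cube i (b s) (cubeParam t), θ))) {s₀ : ℝ} (hs₀ : s₀ ∈ I) :
    HasDerivAt (fun s => ∑ i, ∫ z in unitCube k ×ˢ unitCube r,
      sweepWeight C lam β a b Θ i (s, z) * volumeForm r k fun j =>
        fderiv ℝ (fun z => sweep C b Θ i (s, z)) z (cubeDir r k j)) 0 s₀ := by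
  have hbU' : ∀ s ∈ I, ∀ᶠ s' in 𝓝 s, b s' ∈ U := fun s hs => by
    filter_upwards [hI.mem_nhds hs] with s' hs' using hbU s' hs'
  have hcube : ∀ s ∈ I, ∀ i z, ContDiffAt ℝ ∞ (fun y : ℝ × (Fin k → ℝ) × (Fin r → ℝ) =>
      C.cube i (b y.1) (cubeParam y.2.1)) (s, z) := fun s hs i z =>
    hC.contDiffAt_cube (ContDiffAt.comp (g := b) (f := fun y : ℝ × (Fin k → ℝ) × (Fin r → ℝ) =>
      y.1) (s, z) (hb s hs) contDiffAt_fst) ((continuous_fst.tendsto (s, z)).eventually (hbU' s hs))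
      (by fun_prop) i
  have hT : ∀ s ∈ I, ∀ i z, ContDiffAt ℝ ∞ (sweep C b Θ i) (s, z) := fun s hs i z =>
    ContDiffAt.comp (g := Θ) (f := fun y : ℝ × (Fin k → ℝ) × (Fin r → ℝ) =>
      (y.1, C.cube i (b y.1) (cubeParam y.2.1), y.2.2)) (s, z) (hΘ s hs i z.1 z.2)
      (contDiffAt_fst.prodMk ((hcube s hs i z).prodMk (by fun_prop)))
  -- Locally the section times the weight is a holomorphic function of the swept point; this is what
  -- makes the form closed along the sweep.
  have hloc : ∀ s ∈ I, ∀ i z, ∃ h : (Fin (r + k) → ℂ) → ℂ,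
      ContDiffAt ℂ ∞ h (sweep C b Θ i (s, z)) ∧
      sweepWeight C lam β a b Θ i =ᶠ[𝓝 (s, z)] h ∘ sweep C b Θ i := by
    intro s hs i z
    have hp : ContinuousAt (fun y : ℝ × (Fin k → ℝ) × (Fin r → ℝ) =>
        (b y.1, cubeParam y.2.1)) (s, z) := by
      refine ContinuousAt.prodMk ?_ ?_
      · exact ContinuousAt.comp (g := b) (f := fun y : ℝ × (Fin k → ℝ) × (Fin r → ℝ) => y.1)
          (hb s hs).continuousAt continuousAt_fst
      · exact ((contDiff_cubeParam k).continuous.comp (by fun_prop)).continuousAt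
    exact exists_holomorphic_eq_mul_weight (hC.horizontal i) hp
      (by
        filter_upwards [(continuous_fst.tendsto (s, z)).eventually (hbU' s hs)] with y hy
        exact ⟨hy, cubeParam_mem _⟩)
      (hT s hs i z).continuousAt (hadm s hs i z.1 z.2)
  have hG : ∀ s ∈ I, ∀ i z, ContDiffAt ℝ ∞ (sweepWeight C lam β a b Θ i) (s, z) := by
    intro s hs i z
    obtain ⟨h, hh, he⟩ := hloc s hs i z
    exact ((hh.restrict_scalars ℝ).comp (s, z) (hT s hs i z)).congr_of_eventuallyEq he
  have hGT : ∀ s ∈ I, ∀ i z, ∃ L : (Fin (r + k) → ℂ) →L[ℂ] ℂ,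
      HasFDerivAt (sweepWeight C lam β a b Θ i)
        ((L.restrictScalars ℝ).comp (fderiv ℝ (sweep C b Θ i) (s, z))) (s, z) := by
    intro s hs i z
    obtain ⟨h, hh, he⟩ := hloc s hs i z
    refine ⟨fderiv ℂ h (sweep C b Θ i (s, z)), HasFDerivAt.congr_of_eventuallyEq ?_ he⟩
    exact ((hh.differentiableAt (by simp)).hasFDerivAt.restrictScalars ℝ).comp (s, z)
      ((hT s hs i z).differentiableAt (by simp)).hasFDerivAt
  have hdens : ∀ s ∈ I, ∀ i z, sweepWeight C lam β a b Θ i (s, z) * (volumeForm r k fun j =>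
      fderiv ℝ (fun z => sweep C b Θ i (s, z)) z (cubeDir r k j)) =
      density (sweepWeight C lam β a b Θ i) (sweep C b Θ i) (s, z) := by
    intro s hs i z
    have h1 := (((hT s hs i z).differentiableAt (by simp)).hasFDerivAt.comp z
      (hasFDerivAt_prodMk_right s z)).fderiv
    have h4 : (sweep C b Θ i ∘ fun z : (Fin k → ℝ) × (Fin r → ℝ) => (s, z)) =
      fun z => sweep C b Θ i (s, z) := rfl
    rw [← h4, h1]
    simp [density]
  have hD : ∀ s ∈ I, ∀ i z, ContDiffAt ℝ ∞
      (density (sweepWeight C lam β a b Θ i) (sweep C b Θ i)) (s, z) := fun s hs i z =>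
    contDiffAt_density (hG s hs i z) (hT s hs i z)
  have hbox : IsCompact (unitCube k ×ˢ unitCube r) :=
    (isCompact_unitCube k).prod (isCompact_unitCube r)
  have h1 : ∀ i, HasDerivAt (fun s => ∫ z in unitCube k ×ˢ unitCube r,
      density (sweepWeight C lam β a b Θ i) (sweep C b Θ i) (s, z))
      (∫ z in unitCube k ×ˢ unitCube r,
        fderiv ℝ (density (sweepWeight C lam β a b Θ i) (sweep C b Θ i)) (s₀, z) (1, 0)) s₀ := by
    intro i
    refine hasDerivAt_setIntegral_of_isCompact hbox hI
      (F := fun s z => density (sweepWeight C lam β a b Θ i) (sweep C b Θ i) (s, z))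
      (F' := fun s z => fderiv ℝ (density (sweepWeight C lam β a b Θ i) (sweep C b Θ i)) (s, z)
        (1, 0)) ?_ ?_ ?_ hs₀
    · rintro ⟨s, z⟩ ⟨hs, -⟩
      exact (hD s hs i z).continuousAt.continuousWithinAt
    · rintro ⟨s, z⟩ ⟨hs, -⟩
      exact (((hD s hs i z).fderiv_right (m := ∞) (by simp)).continuousAt.clm_apply
        continuousAt_const).continuousWithinAt
    · intro s hs z _
      have h2 : HasDerivAt (fun s : ℝ => (s, z)) ((1 : ℝ), (0 : (Fin k → ℝ) × (Fin r → ℝ))) s :=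
        (hasDerivAt_id s).prodMk (hasDerivAt_const _ _)
      exact ((hD s hs i z).differentiableAt (by simp)).hasFDerivAt.comp_hasDerivAt s h2
  have h2 := HasDerivAt.fun_sum (u := Finset.univ) fun i _ => h1 i
  have h3 : ∑ i, ∫ z in unitCube k ×ˢ unitCube r,
      fderiv ℝ (density (sweepWeight C lam β a b Θ i) (sweep C b Θ i)) (s₀, z) (1, 0) = 0 := by
    have h4 : ∀ i, ∫ z in unitCube k ×ˢ unitCube r,
        fderiv ℝ (density (sweepWeight C lam β a b Θ i) (sweep C b Θ i)) (s₀, z) (1, 0) =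
        ∑ q : Fin k, ∫ z in unitCube k ×ˢ unitCube r, fderiv ℝ (fun z =>
          flux (sweepWeight C lam β a b Θ i) (sweep C b Θ i) (Sum.inr q) (s₀, z)) z
          (Pi.single q 1, 0) := fun i =>
      integral_fderiv_density (hT s₀ hs₀ i) (hG s₀ hs₀ i) (hGT s₀ hs₀ i)
        (fun s t θ e => hper _ _ _ _) (fun s t θ e => by simp only [sweepWeight, sweep, hper])
    simp only [h4]
    clear h1 h2 h4 hdens hD hbox hloc hGT hcube hΘ hadm
    -- A cycle of dimension zero has no faces, and the sum over `q` is empty.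
    obtain _ | k := k
    · simp
    · exact sum_integral_fderiv_flux_eq_zero hC.closed (hbU' s₀ hs₀) (hT s₀ hs₀) a (hG s₀ hs₀)
  rw [h3] at h2
  refine h2.congr_of_eventuallyEq ?_
  filter_upwards [hI.mem_nhds hs₀] with s hs
  exact Finset.sum_congr rfl fun i _ => integral_congr_ae (Eventually.of_forall (hdens s hs i))

end Homotopy

/-! ### The Gelfand-Leray integral as a limit of integrals over thin tubes -/

theorem IsHorizontalOn.continuousOn {S Q : Type*} [TopologicalSpace S] [Fintype Q] {D : Set S}
    {φ : Q → S → ℂ} {s : Q → ℂ} {g : S → ℂ} (hg : IsHorizontalOn D φ s g) : ContinuousOn g D := by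
  intro y hy
  obtain ⟨W, hW, c, ℓ, hℓ, hgW⟩ := hg y hy
  have hyW : y ∈ W := mem_of_mem_nhdsWithin hy hW
  have h1 : ContinuousOn g W := by
    refine ContinuousOn.congr ?_ hgW
    refine continuousOn_const.mul (Complex.continuous_exp.comp_continuousOn ?_)
    refine continuousOn_finsetSum _ fun q _ => ?_
    by_cases hq : IsNat (s q)
    · simp only [hq, if_true]
      exact continuousOn_const
    · simp only [hq, if_false]
      exact continuousOn_const.mul (hℓ q hq).1
  exact (h1 y hyW).mono_of_mem_nhdsWithin hW

theorem continuousWithinAt_branchPow {Y : Type*} [TopologicalSpace Y] {D : Set Y} {y : Y} {s : ℂ}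
    {f g : Y → ℂ} (hf : ContinuousWithinAt f D y) (hg : ContinuousWithinAt g D y)
    (h : ¬ IsNat s → g y / f y ∈ Complex.slitPlane) :
    ContinuousWithinAt (fun y => branchPow s (f y) (g y)) D y := by
  by_cases hs : IsNat s
  · simp only [branchPow_of_isNat hs]
    obtain ⟨n, rfl⟩ := hs
    simp only [Complex.cpow_natCast]
    exact hg.pow n
  · simp only [branchPow_of_not_isNat hs]
    have h1 := h hs
    have hf0 : f y ≠ 0 := fun h0 => by simp [h0] at h1
    exact (hg.div hf hf0).cpow continuousWithinAt_const h1

theorem prod_branchPow_self {l m : ℕ} (s z : Fin l ⊕ Fin m → ℂ)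
    (hz : ∀ q, ¬ IsNat (s q) → z q ≠ 0) :
    ∏ q, branchPow (s q) (z q) (z q) = singleValuedPart s z := by
  unfold singleValuedPart
  refine Finset.prod_congr rfl fun q _ => ?_
  by_cases hs : IsNat (s q)
  · rw [branchPow_of_isNat hs, if_pos hs]
  · rw [branchPow_of_not_isNat hs, if_neg hs, div_self (hz q hs), Complex.one_cpow]

section Tube

variable {l r k N : ℕ} {supp : Fin l ⊕ Fin r → Finset (Fin (r + k) →₀ ℕ)}

theorem linearIndependent_of_mem_variety {lam : Fin l → ℂ} {β : Fin (r + k) → ℂ}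
    {a : CoeffIndex supp → ℂ} {x : Fin (r + k) → ℂ} (hx : x ∈ variety supp lam β a) :
    LinearIndependent ℂ fun e => differential (poly supp a (Sum.inr e)) x := hx.2.1

theorem polyVal_eq_zero_of_mem_variety {lam : Fin l → ℂ} {β : Fin (r + k) → ℂ}
    {a : CoeffIndex supp → ℂ} {x : Fin (r + k) → ℂ} (hx : x ∈ variety supp lam β a) (e : Fin r) :
    polyVal supp a x (Sum.inr e) = 0 := by
  rw [polyVal_def]
  exact hx.1 e

/-- The algebraic core of the residue formula: on vectors tangent to the variety, the volume form
factors into the determinant of the normal derivatives and the Gelfand-Leray form. -/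
theorem volumeForm_eq_det_mul_quotientForm {d : Fin r → (Fin (r + k) → ℂ) →ₗ[ℂ] ℂ}
    (hd : LinearIndependent ℂ d) (w : Fin r → Fin (r + k) → ℂ) (v : Fin k → Fin (r + k) → ℂ)
    (hv : ∀ e q, d e (v q) = 0) :
    volumeForm r k (Sum.elim w v) = Matrix.det (Matrix.of fun j e => d e (w j)) *
      quotientForm d v := by
  have hη : IsQuotientForm d (quotientForm d) := by
    have h := exists_isQuotientForm d hd
    unfold quotientForm
    rw [dif_pos h]
    exact h.choose_spec
  rw [← wedge_apply_of_ker d (quotientForm d) w v hv]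
  exact (congrArg (fun f => f (Sum.elim w v)) hη).symm

/-- The Gelfand-Leray integral in terms of the parametrization `cubeParam`. -/
theorem TwistedChain.IsCycleOn.integral_eq {C : TwistedChain supp N} {lam : Fin l → ℂ}
    {β : Fin (r + k) → ℂ} {U : Set (CoeffIndex supp → ℂ)} (hC : C.IsCycleOn lam β U)
    {a : CoeffIndex supp → ℂ} (ha : a ∈ U) :
    C.integral lam β a = ∑ i, ∫ t in unitCube k, C.sect i a (cubeParam t) *
      singleValuedPart (factorExponent lam β) (factor supp a (C.cube i a (cubeParam t))) *
      quotientForm (fun e => differential (poly supp a (Sum.inr e)) (C.cube i a (cubeParam t)))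
        (fun q => fderiv ℝ (fun t => C.cube i a (cubeParam t)) t (Pi.single q 1)) := by
  unfold TwistedChain.integral
  refine Finset.sum_congr rfl fun i _ => ?_
  rw [setIntegral_unitCube_eq]
  congr 1
  ext t
  have h1 : DifferentiableWithinAt ℝ (C.cube i a) (unitCube k) (cubeParam t) := by
    have h2 : ContDiffWithinAt ℝ ∞ (fun t => C.cube i a t) (unitCube k) (cubeParam t) :=
      ContDiffWithinAt.comp (g := fun p : (CoeffIndex supp → ℂ) × (Fin k → ℝ) => C.cube i p.1 p.2)
        (f := fun t => (a, t)) (cubeParam t) (hC.smooth i (a, cubeParam t) ⟨ha, cubeParam_mem t⟩)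
        (by fun_prop) fun t ht => ⟨ha, ht⟩
    exact h2.differentiableWithinAt (by simp)
  have h2 := h1.hasFDerivWithinAt.comp_hasFDerivAt t (hasFDerivAt_cubeParam t)
    (Eventually.of_forall cubeParam_mem)
  have h3 : (C.cube i a ∘ cubeParam) = fun t => C.cube i a (cubeParam t) := rfl
  rw [h3] at h2
  -- The derivative of `cubeParam` is diagonal, so each argument of the alternating form acquires
  -- one factor; their product is exactly the Jacobian in `setIntegral_unitCube_eq`.
  have h4 : (fun q => fderiv ℝ (fun t => C.cube i a (cubeParam t)) t (Pi.single q 1)) = fun q =>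
      ((Real.pi / 2 * Real.sin (Real.pi * t q) : ℝ) : ℂ) •
        fderivWithin ℝ (C.cube i a) (unitCube k) (cubeParam t) (Pi.single q 1) := by
    ext1 q
    rw [h2.fderiv, Complex.coe_smul, ← map_smul]
    simp only [ContinuousLinearMap.comp_apply]
    congr 1
    ext q'
    simp [Matrix.mulVec_single, Pi.single_apply]
  rw [h4]
  have h5 := (quotientForm (fun e => differential (poly supp a (Sum.inr e))
    (C.cube i a (cubeParam t)))).toMultilinearMap.map_smul_univ
    (fun q => ((Real.pi / 2 * Real.sin (Real.pi * t q) : ℝ) : ℂ))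
    (fun q => fderivWithin ℝ (C.cube i a) (unitCube k) (cubeParam t) (Pi.single q 1))
  simp only [AlternatingMap.coe_multilinearMap] at h5
  rw [h5, Complex.ofReal_prod, smul_eq_mul]
  ring

/-- The unit torus. -/
def circ {r : ℕ} (θ : Fin r → ℝ) : Fin r → ℂ := fun e => Complex.exp (2 * Real.pi * Complex.I * θ e)

theorem circ_ne_zero {r : ℕ} (θ : Fin r → ℝ) (e : Fin r) : circ θ e ≠ 0 := Complex.exp_ne_zero _

theorem norm_circ {r : ℕ} (θ : Fin r → ℝ) (e : Fin r) : ‖circ θ e‖ = 1 := by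
  have := Complex.norm_exp_ofReal_mul_I (2 * Real.pi * θ e)
  rw [circ, ← this]
  congr 2
  push_cast
  ring

theorem circ_add_single {r : ℕ} (θ : Fin r → ℝ) (e : Fin r) : circ (θ + Pi.single e 1) = circ θ := by
  ext e'
  simp only [circ, Pi.add_apply, Complex.ofReal_add, mul_add, Complex.exp_add]
  rcases eq_or_ne e' e with rfl | h
  · simp
  · simp [h]

theorem contDiff_circ (r : ℕ) : ContDiff ℝ ∞ (circ (r := r)) := by
  refine contDiff_pi.2 fun e => ContDiff.cexp ?_
  refine contDiff_const.mul (Complex.ofRealCLM.contDiff.comp (by fun_prop))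

theorem fderiv_circ_single {r : ℕ} (θ : Fin r → ℝ) (e : Fin r) :
    fderiv ℝ circ θ (Pi.single e 1) = Pi.single e (2 * Real.pi * Complex.I * circ θ e) := by
  have h1 : HasDerivAt (fun u : ℝ => θ + u • Pi.single e (1 : ℝ)) (Pi.single e 1) 0 := by
    simpa using ((hasDerivAt_id (0 : ℝ)).smul_const (Pi.single e (1 : ℝ))).const_add θ
  have h2 : HasFDerivAt circ (fderiv ℝ circ θ) (θ + (0 : ℝ) • Pi.single e (1 : ℝ)) := by
    simpa using ((contDiff_circ r).differentiable (by simp) θ).hasFDerivAt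
  have h3 := h2.comp_hasDerivAt (0 : ℝ) h1
  refine h3.unique (hasDerivAt_pi.2 fun e' => ?_)
  rcases eq_or_ne e' e with rfl | h
  · have h4 : HasDerivAt (fun u : ℝ => 2 * Real.pi * Complex.I * ((θ e' + u : ℝ) : ℂ))
        (2 * Real.pi * Complex.I) 0 := by
      have h5 := (((hasDerivAt_id (0 : ℝ)).const_add (θ e')).ofReal_comp).const_mul
        (2 * Real.pi * Complex.I)
      simpa using h5
    have h5 := h4.cexp
    simp only [add_zero] at h5
    simp only [Pi.single_eq_same]
    convert! h5 using 1
    · ext u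
      simp [circ]
    · simp only [circ]
      ring
  · have h4 : (fun u : ℝ => (circ ∘ fun u : ℝ => θ + u • Pi.single e (1 : ℝ)) u e') =
        fun _ => circ θ e' := by
      ext u
      simp [circ, h]
    rw [h4, Pi.single_eq_of_ne h]
    exact hasDerivAt_const _ _

end Tube

/-- `Ψ` is a smooth family of points with `f_e(Ψ(x, b, w)) = w_e` that is a retraction to the
variety for `w = 0`. -/
structure IsTube {l r m : ℕ} (supp : Fin l ⊕ Fin r → Finset (Fin m →₀ ℕ))
    (O : Set ((Fin m → ℂ) × (CoeffIndex supp → ℂ) × (Fin r → ℂ)))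
    (Ψ : (Fin m → ℂ) × (CoeffIndex supp → ℂ) × (Fin r → ℂ) → Fin m → ℂ) : Prop where
  isOpen : IsOpen O
  smooth : ContDiffOn ℝ ∞ Ψ O
  value : ∀ p ∈ O, ∀ e, polyVal supp p.2.1 (Ψ p) (Sum.inr e) = p.2.2 e
  retract : ∀ x b, (x, b, 0) ∈ O → (∀ e, polyVal supp b x (Sum.inr e) = 0) → Ψ (x, b, 0) = x

/-! ### Torus bundles over a cycle, and displacement of the base. -/

section Tube

variable {l r k N : ℕ} {supp : Fin l ⊕ Fin r → Finset (Fin (r + k) →₀ ℕ)}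
  {O : Set ((Fin (r + k) → ℂ) × (CoeffIndex supp → ℂ) × (Fin r → ℂ))}
  {Ψ : (Fin (r + k) → ℂ) × (CoeffIndex supp → ℂ) × (Fin r → ℂ) → Fin (r + k) → ℂ}

theorem IsTube.contDiffAt (hΨ : IsTube supp O Ψ)
    {p : (Fin (r + k) → ℂ) × (CoeffIndex supp → ℂ) × (Fin r → ℂ)} (hp : p ∈ O) :
    ContDiffAt ℝ ∞ Ψ p := hΨ.smooth.contDiffAt (hΨ.isOpen.mem_nhds hp)

theorem IsTube.hasFDerivAt (hΨ : IsTube supp O Ψ)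
    {p : (Fin (r + k) → ℂ) × (CoeffIndex supp → ℂ) × (Fin r → ℂ)} (hp : p ∈ O) :
    HasFDerivAt Ψ (fderiv ℝ Ψ p) p := ((hΨ.contDiffAt hp).differentiableAt (by simp)).hasFDerivAt

theorem differential_of_hasDerivAt {m : ℕ} (f : MvPolynomial (Fin m) ℂ) {γ : ℝ → Fin m → ℂ}
    {v : Fin m → ℂ} {s : ℝ} (hγ : HasDerivAt γ v s) :
    HasDerivAt (fun s => MvPolynomial.eval (γ s) f) (differential f (γ s) v) s :=
  HasFDerivAt.comp_hasDerivAt (l := fun x => MvPolynomial.eval x f) s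
    ((hasFDerivAt_eval f (γ s)).restrictScalars ℝ) hγ

/-- The derivative of the tube in the normal directions is inverse to the `df_e`. -/
theorem IsTube.differential_fderiv (hΨ : IsTube supp O Ψ) {x : Fin (r + k) → ℂ}
    {b : CoeffIndex supp → ℂ} {w : Fin r → ℂ} (hp : (x, b, w) ∈ O) (u : Fin r → ℂ) (e : Fin r) :
    differential (poly supp b (Sum.inr e)) (Ψ (x, b, w)) (fderiv ℝ Ψ (x, b, w) (0, 0, u)) = u e := by
  have h1 : HasDerivAt (fun s : ℝ => ((x, b, w + s • u) :
      (Fin (r + k) → ℂ) × (CoeffIndex supp → ℂ) × (Fin r → ℂ))) (0, 0, u) 0 := by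
    refine (hasDerivAt_const _ _).prodMk ((hasDerivAt_const _ _).prodMk ?_)
    simpa using ((hasDerivAt_id (0 : ℝ)).smul_const u).const_add w
  have h2 : HasDerivAt (fun s : ℝ => Ψ (x, b, w + s • u)) (fderiv ℝ Ψ (x, b, w) (0, 0, u)) 0 := by
    refine HasFDerivAt.comp_hasDerivAt (l := Ψ) (f := fun s : ℝ => ((x, b, w + s • u) :
      (Fin (r + k) → ℂ) × (CoeffIndex supp → ℂ) × (Fin r → ℂ))) 0 ?_ h1
    simpa using hΨ.hasFDerivAt hp
  have h3 := differential_of_hasDerivAt (poly supp b (Sum.inr e)) h2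
  have h4 : ∀ᶠ s : ℝ in 𝓝 0, MvPolynomial.eval (Ψ (x, b, w + s • u)) (poly supp b (Sum.inr e)) =
      w e + s • u e := by
    have h5 : ∀ᶠ s : ℝ in 𝓝 0, (x, b, w + s • u) ∈ O := by
      refine h1.continuousAt.eventually_mem (hΨ.isOpen.mem_nhds ?_)
      simpa using hp
    filter_upwards [h5] with s hs
    rw [← polyVal_def, hΨ.value _ hs]
    rfl
  have h5 : HasDerivAt (fun s : ℝ => w e + s • u e) (u e) 0 := by
    simpa using ((hasDerivAt_id (0 : ℝ)).smul_const (u e)).const_add (w e)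
  have h6 := h3.unique (h5.congr_of_eventuallyEq h4)
  simpa using h6

/-- The integral over the tube of radius `ρ` over the cycle `C_b`, of the form given by `a`. -/
def TwistedChain.tubeIntegral (C : TwistedChain supp N) (lam : Fin l → ℂ) (β : Fin (r + k) → ℂ)
    (Ψ : (Fin (r + k) → ℂ) × (CoeffIndex supp → ℂ) × (Fin r → ℂ) → Fin (r + k) → ℂ)
    (a b : CoeffIndex supp → ℂ) (ρ : ℝ) : ℂ :=
  ∑ i, ∫ z in unitCube k ×ˢ unitCube r, C.sect i b (cubeParam z.1) *
    weight supp lam β a (factor supp b (C.cube i b (cubeParam z.1)))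
      (Ψ (C.cube i b (cubeParam z.1), b, ρ • circ z.2)) *
    volumeForm r k fun j => fderiv ℝ
      (fun z : (Fin k → ℝ) × (Fin r → ℝ) => Ψ (C.cube i b (cubeParam z.1), b, ρ • circ z.2)) z
      (cubeDir r k j)

/-- For coefficients in the ball of radius `δ` the tubes of radius at most `ε` are defined, and the
integrands have well defined branches along them. -/
structure IsGoodRadius (C : TwistedChain supp N) (lam : Fin l → ℂ) (β : Fin (r + k) → ℂ)
    (U : Set (CoeffIndex supp → ℂ))
    (O : Set ((Fin (r + k) → ℂ) × (CoeffIndex supp → ℂ) × (Fin r → ℂ)))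
    (Ψ : (Fin (r + k) → ℂ) × (CoeffIndex supp → ℂ) × (Fin r → ℂ) → Fin (r + k) → ℂ)
    (a₀ : CoeffIndex supp → ℂ) (ε δ : ℝ) : Prop where
  pos : 0 < ε
  pos' : 0 < δ
  subset : Metric.ball a₀ δ ⊆ U
  mem : ∀ b ∈ Metric.ball a₀ δ, ∀ i t, ∀ w : Fin r → ℂ, (∀ e, ‖w e‖ ≤ ε) →
    (C.cube i b (cubeParam t), b, w) ∈ O
  slit : ∀ a ∈ Metric.ball a₀ δ, ∀ b ∈ Metric.ball a₀ δ, ∀ i t, ∀ w : Fin r → ℂ,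
    (∀ e, ‖w e‖ ≤ ε) → ∀ q, ¬ IsNat (factorExponent lam β q) →
    factor supp a (Ψ (C.cube i b (cubeParam t), b, w)) q /
      factor supp b (C.cube i b (cubeParam t)) q ∈ Complex.slitPlane
  ne_zero : ∀ a ∈ Metric.ball a₀ δ, ∀ b ∈ Metric.ball a₀ δ, ∀ i t, ∀ w : Fin r → ℂ,
    (∀ e, ‖w e‖ = ε) → ∀ e, polyVal supp a (Ψ (C.cube i b (cubeParam t), b, w)) (Sum.inr e) ≠ 0

theorem norm_smul_circ {ρ : ℝ} (hρ : 0 ≤ ρ) (θ : Fin r → ℝ) (e : Fin r) :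
    ‖(ρ • circ θ) e‖ = ρ := by
  simp [norm_circ, abs_of_nonneg hρ]

theorem contDiffAt_tube_param (hΨ : IsTube supp O Ψ) {b : ℝ → CoeffIndex supp → ℂ} {ρ : ℝ → ℝ}
    {s : ℝ} {x : Fin (r + k) → ℂ} {θ : Fin r → ℝ} (hb : ContDiffAt ℝ ∞ b s)
    (hρ : ContDiffAt ℝ ∞ ρ s) (hmem : (x, b s, ρ s • circ θ) ∈ O) :
    ContDiffAt ℝ ∞ (fun y : ℝ × (Fin (r + k) → ℂ) × (Fin r → ℝ) =>
      Ψ (y.2.1, b y.1, ρ y.1 • circ y.2.2)) (s, x, θ) := by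
  have hb' : ContDiffAt ℝ ∞ (fun y : ℝ × (Fin (r + k) → ℂ) × (Fin r → ℝ) => b y.1) (s, x, θ) :=
    ContDiffAt.comp (g := b) (f := fun y : ℝ × (Fin (r + k) → ℂ) × (Fin r → ℝ) => y.1) _ hb
      contDiffAt_fst
  have hρ' : ContDiffAt ℝ ∞ (fun y : ℝ × (Fin (r + k) → ℂ) × (Fin r → ℝ) => ρ y.1) (s, x, θ) :=
    ContDiffAt.comp (g := ρ) (f := fun y : ℝ × (Fin (r + k) → ℂ) × (Fin r → ℝ) => y.1) _ hρ
      contDiffAt_fst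
  have hc : ContDiffAt ℝ ∞ (fun y : ℝ × (Fin (r + k) → ℂ) × (Fin r → ℝ) => circ y.2.2) (s, x, θ) :=
    (contDiff_circ r).contDiffAt.comp _ (by fun_prop)
  exact ContDiffAt.comp (g := Ψ) (f := fun y : ℝ × (Fin (r + k) → ℂ) × (Fin r → ℝ) =>
    (y.2.1, b y.1, ρ y.1 • circ y.2.2)) (s, x, θ) (hΨ.contDiffAt hmem)
    (ContDiffAt.prodMk (by fun_prop) (hb'.prodMk (hρ'.smul hc)))

variable {C : TwistedChain supp N} {lam : Fin l → ℂ} {β : Fin (r + k) → ℂ}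
  {U : Set (CoeffIndex supp → ℂ)} {a₀ : CoeffIndex supp → ℂ} {ε δ : ℝ}

/-- Moving the base cycle does not change the integral over the tube. -/
theorem IsGoodRadius.tubeIntegral_eq (h : IsGoodRadius C lam β U O Ψ a₀ ε δ)
    (hΨ : IsTube supp O Ψ) (hC : C.IsCycleOn lam β U) {a : CoeffIndex supp → ℂ}
    (ha : a ∈ Metric.ball a₀ δ) :
    C.tubeIntegral lam β Ψ a a ε = C.tubeIntegral lam β Ψ a a₀ ε := by
  -- The base cycle travels along the segment from `a₀` to `a` while the form keeps the coefficients
  -- `a`. The bounds of `IsGoodRadius` treat form and base independently, so no pole or branch cut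
  -- is met.
  let b : ℝ → CoeffIndex supp → ℂ := fun s => a₀ + s • (a - a₀)
  have hbs : ContDiff ℝ ∞ b := by fun_prop
  have hI : IsOpen (b ⁻¹' Metric.ball a₀ δ) := Metric.isOpen_ball.preimage hbs.continuous
  have h01 : Icc (0 : ℝ) 1 ⊆ b ⁻¹' Metric.ball a₀ δ := by
    intro s hs
    have h1 : ‖s • (a - a₀)‖ ≤ ‖a - a₀‖ := by
      rw [norm_smul, Real.norm_of_nonneg hs.1]
      exact mul_le_of_le_one_left (norm_nonneg _) hs.2
    rw [mem_preimage, mem_ball_iff_norm]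
    rw [mem_ball_iff_norm] at ha
    simpa [b] using h1.trans_lt ha
  have hder : ∀ s ∈ b ⁻¹' Metric.ball a₀ δ,
      HasDerivAt (fun s => C.tubeIntegral lam β Ψ a (b s) ε) 0 s := by
    intro s hs
    refine hasDerivAt_sweep_integral hC a hI (b := b) (Θ := fun y =>
      Ψ (y.2.1, b y.1, ε • circ y.2.2)) (fun s _ => hbs.contDiffAt)
      (fun s hs => h.subset hs) ?_ ?_ ?_ hs
    · intro s hs i t θ
      exact contDiffAt_tube_param hΨ hbs.contDiffAt (ρ := fun _ => ε) contDiffAt_const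
        (h.mem _ hs i t _ fun e => (norm_smul_circ h.pos.le θ e).le)
    · intro s x θ e
      simp only [circ_add_single]
    · intro s hs i t θ
      exact ⟨h.slit a ha _ hs i t _ fun e => (norm_smul_circ h.pos.le θ e).le,
        h.ne_zero a ha _ hs i t _ fun e => norm_smul_circ h.pos.le θ e⟩
  have hconst := constant_of_has_deriv_right_zero (a := (0 : ℝ)) (b := 1)
    (f := fun s => C.tubeIntegral lam β Ψ a (b s) ε)
    (fun s hs => (hder s (h01 hs)).continuousAt.continuousWithinAt)
    (fun s hs => (hder s (h01 ⟨hs.1, hs.2.le⟩)).hasDerivWithinAt) 1 (right_mem_Icc.2 zero_le_one)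
  simpa [b] using hconst

end Tube

/-! ### Shrinking the radius, and Leray's residue formula. -/

section Radial

variable {l r k N : ℕ} {supp : Fin l ⊕ Fin r → Finset (Fin (r + k) →₀ ℕ)}
  {O : Set ((Fin (r + k) → ℂ) × (CoeffIndex supp → ℂ) × (Fin r → ℂ))}
  {Ψ : (Fin (r + k) → ℂ) × (CoeffIndex supp → ℂ) × (Fin r → ℂ) → Fin (r + k) → ℂ}

/-- The tangent vectors of the tube, with the radius factored out of the circle directions. -/
def tubeTangent (C : TwistedChain supp N)
    (Ψ : (Fin (r + k) → ℂ) × (CoeffIndex supp → ℂ) × (Fin r → ℂ) → Fin (r + k) → ℂ)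
    (a : CoeffIndex supp → ℂ) (i : Fin N) (ρ : ℝ) (z : (Fin k → ℝ) × (Fin r → ℝ)) :
    Fin r ⊕ Fin k → Fin (r + k) → ℂ :=
  Sum.elim
    (fun e => fderiv ℝ Ψ (C.cube i a (cubeParam z.1), a, ρ • circ z.2)
      (0, 0, Pi.single e (2 * Real.pi * Complex.I * circ z.2 e)))
    (fun q => fderiv ℝ Ψ (C.cube i a (cubeParam z.1), a, ρ • circ z.2)
      (fderiv ℝ (fun t => C.cube i a (cubeParam t)) z.1 (Pi.single q 1), 0, 0))

/-- The integrand of `tubeIntegral`, with the radius cancelled. -/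
def tubeIntegrand (C : TwistedChain supp N) (lam : Fin l → ℂ) (β : Fin (r + k) → ℂ)
    (Ψ : (Fin (r + k) → ℂ) × (CoeffIndex supp → ℂ) × (Fin r → ℂ) → Fin (r + k) → ℂ)
    (a : CoeffIndex supp → ℂ) (i : Fin N) (ρ : ℝ) (z : (Fin k → ℝ) × (Fin r → ℝ)) : ℂ :=
  C.sect i a (cubeParam z.1) *
    ((∏ q, branchPow (factorExponent lam β q) (factor supp a (C.cube i a (cubeParam z.1)) q)
      (factor supp a (Ψ (C.cube i a (cubeParam z.1), a, ρ • circ z.2)) q)) *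
    ∏ e, (circ z.2 e)⁻¹) * volumeForm r k (tubeTangent C Ψ a i ρ z)

variable {C : TwistedChain supp N} {lam : Fin l → ℂ} {β : Fin (r + k) → ℂ}
  {U : Set (CoeffIndex supp → ℂ)} {a₀ a : CoeffIndex supp → ℂ} {ε δ : ℝ}

theorem IsGoodRadius.contDiff_cube (h : IsGoodRadius C lam β U O Ψ a₀ ε δ)
    (hC : C.IsCycleOn lam β U) (ha : a ∈ Metric.ball a₀ δ) (i : Fin N) :
    ContDiff ℝ ∞ fun t => C.cube i a (cubeParam t) := by
  refine contDiff_iff_contDiffAt.2 fun t => ?_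
  exact hC.contDiffAt_cube (b := fun _ => a) contDiffAt_const
    (Eventually.of_forall fun _ => h.subset ha) contDiffAt_id i

theorem IsGoodRadius.mem_tube (h : IsGoodRadius C lam β U O Ψ a₀ ε δ)
    (ha : a ∈ Metric.ball a₀ δ) (i : Fin N) {ρ : ℝ} (hρ : ρ ∈ Icc 0 ε) (t : Fin k → ℝ)
    (θ : Fin r → ℝ) : (C.cube i a (cubeParam t), a, ρ • circ θ) ∈ O :=
  h.mem a ha i t _ fun e => (norm_smul_circ hρ.1 θ e).trans_le hρ.2

theorem IsGoodRadius.fderiv_tube (h : IsGoodRadius C lam β U O Ψ a₀ ε δ) (hΨ : IsTube supp O Ψ)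
    (hC : C.IsCycleOn lam β U) (ha : a ∈ Metric.ball a₀ δ) (i : Fin N) {ρ : ℝ}
    (hρ : ρ ∈ Icc 0 ε) (z v : (Fin k → ℝ) × (Fin r → ℝ)) :
    fderiv ℝ (fun z : (Fin k → ℝ) × (Fin r → ℝ) =>
        Ψ (C.cube i a (cubeParam z.1), a, ρ • circ z.2)) z v =
      fderiv ℝ Ψ (C.cube i a (cubeParam z.1), a, ρ • circ z.2)
        (fderiv ℝ (fun t => C.cube i a (cubeParam t)) z.1 v.1, 0, ρ • fderiv ℝ circ z.2 v.2) := by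
  have h1 : HasFDerivAt (fun z : (Fin k → ℝ) × (Fin r → ℝ) => C.cube i a (cubeParam z.1))
      ((fderiv ℝ (fun t => C.cube i a (cubeParam t)) z.1).comp (ContinuousLinearMap.fst ℝ _ _)) z :=
    HasFDerivAt.comp (g := fun t => C.cube i a (cubeParam t)) z
      (((h.contDiff_cube hC ha i).differentiable (by simp) z.1).hasFDerivAt) hasFDerivAt_fst
  have h2 : HasFDerivAt (fun z : (Fin k → ℝ) × (Fin r → ℝ) => ρ • circ z.2)
      (ρ • (fderiv ℝ circ z.2).comp (ContinuousLinearMap.snd ℝ _ _)) z :=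
    (HasFDerivAt.comp (g := circ) z
      ((contDiff_circ r).differentiable (by simp) z.2).hasFDerivAt hasFDerivAt_snd).const_smul ρ
  have h3 := HasFDerivAt.comp (g := Ψ) z (hΨ.hasFDerivAt (h.mem_tube ha i hρ z.1 z.2))
    (h1.prodMk ((hasFDerivAt_const a z).prodMk h2))
  have h4 : (Ψ ∘ fun z : (Fin k → ℝ) × (Fin r → ℝ) =>
    (C.cube i a (cubeParam z.1), a, ρ • circ z.2)) = fun z =>
    Ψ (C.cube i a (cubeParam z.1), a, ρ • circ z.2) := rfl
  rw [← h4, h3.fderiv]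
  rfl

/-- Each circle direction contributes a factor `ρ` to the volume, and each denominator `f_e = ρ ·
circ θ e` a factor `ρ⁻¹`. After cancellation the integrand makes sense, and is continuous, down to
`ρ = 0`. -/
theorem IsGoodRadius.tubeIntegral_eq_sum (h : IsGoodRadius C lam β U O Ψ a₀ ε δ)
    (hΨ : IsTube supp O Ψ) (hC : C.IsCycleOn lam β U) (ha : a ∈ Metric.ball a₀ δ) {ρ : ℝ}
    (hρ : ρ ∈ Ioc 0 ε) :
    C.tubeIntegral lam β Ψ a a ρ =
      ∑ i, ∫ z in unitCube k ×ˢ unitCube r, tubeIntegrand C lam β Ψ a i ρ z := by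
  refine Finset.sum_congr rfl fun i _ => ?_
  congr 1
  ext z
  have hρ' : ρ ∈ Icc 0 ε := ⟨hρ.1.le, hρ.2⟩
  have hρ0 : (ρ : ℂ) ≠ 0 := by exact_mod_cast hρ.1.ne'
  have h1 : (fun j => fderiv ℝ (fun z : (Fin k → ℝ) × (Fin r → ℝ) =>
      Ψ (C.cube i a (cubeParam z.1), a, ρ • circ z.2)) z (cubeDir r k j)) =
      fun j => (Sum.elim (fun _ => (ρ : ℂ)) (fun _ => 1) j : ℂ) • tubeTangent C Ψ a i ρ z j := by
    ext1 j
    rw [h.fderiv_tube hΨ hC ha i hρ']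
    rcases j with e | q
    · simp only [cubeDir, Sum.elim_inl, map_zero, fderiv_circ_single, tubeTangent,
        Complex.coe_smul]
      rw [← map_smul]
      simp
    · simp [cubeDir, tubeTangent]
  have h2 : volumeForm r k (fun j => (Sum.elim (fun _ => (ρ : ℂ)) (fun _ => 1) j : ℂ) •
      tubeTangent C Ψ a i ρ z j) = (ρ : ℂ) ^ r * volumeForm r k (tubeTangent C Ψ a i ρ z) := by
    have := (volumeForm r k).toMultilinearMap.map_smul_univ
      (Sum.elim (fun _ => (ρ : ℂ)) (fun _ => 1)) (tubeTangent C Ψ a i ρ z)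
    simpa [Fintype.prod_sum_type] using this
  have h3 : ∏ e, (polyVal supp a (Ψ (C.cube i a (cubeParam z.1), a, ρ • circ z.2))
      (Sum.inr e))⁻¹ = ((ρ : ℂ) ^ r)⁻¹ * ∏ e, (circ z.2 e)⁻¹ := by
    have h4 : ∀ e, polyVal supp a (Ψ (C.cube i a (cubeParam z.1), a, ρ • circ z.2))
        (Sum.inr e) = ρ * circ z.2 e := fun e => by
      rw [hΨ.value _ (h.mem_tube ha i hρ' z.1 z.2)]
      simp
    simp only [h4, mul_inv, Finset.prod_mul_distrib]
    simp
  rw [h1, h2, tubeIntegrand, weight, h3]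
  field_simp

theorem IsGoodRadius.continuousOn_tubeIntegrand (h : IsGoodRadius C lam β U O Ψ a₀ ε δ)
    (hΨ : IsTube supp O Ψ) (hC : C.IsCycleOn lam β U) (ha : a ∈ Metric.ball a₀ δ) (i : Fin N) :
    ContinuousOn (fun p : ℝ × (Fin k → ℝ) × (Fin r → ℝ) => tubeIntegrand C lam β Ψ a i p.1 p.2)
      (Icc 0 ε ×ˢ (unitCube k ×ˢ unitCube r)) := by
  set D := Icc 0 ε ×ˢ (unitCube k ×ˢ unitCube r)
  have hx : Continuous fun p : ℝ × (Fin k → ℝ) × (Fin r → ℝ) => C.cube i a (cubeParam p.2.1) :=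
    (h.contDiff_cube hC ha i).continuous.comp (by fun_prop)
  have hc : Continuous fun p : ℝ × (Fin k → ℝ) × (Fin r → ℝ) => circ p.2.2 :=
    (contDiff_circ r).continuous.comp (by fun_prop)
  have hp : Continuous fun p : ℝ × (Fin k → ℝ) × (Fin r → ℝ) =>
      ((C.cube i a (cubeParam p.2.1), a, p.1 • circ p.2.2) :
        (Fin (r + k) → ℂ) × (CoeffIndex supp → ℂ) × (Fin r → ℂ)) :=
    hx.prodMk (continuous_const.prodMk (continuous_fst.smul hc))
  have hmap : MapsTo (fun p : ℝ × (Fin k → ℝ) × (Fin r → ℝ) =>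
      ((C.cube i a (cubeParam p.2.1), a, p.1 • circ p.2.2) :
        (Fin (r + k) → ℂ) × (CoeffIndex supp → ℂ) × (Fin r → ℂ))) D O := fun p hp =>
    h.mem_tube ha i hp.1 _ _
  have hT : ContinuousOn (fun p : ℝ × (Fin k → ℝ) × (Fin r → ℝ) =>
      Ψ (C.cube i a (cubeParam p.2.1), a, p.1 • circ p.2.2)) D :=
    hΨ.smooth.continuousOn.comp hp.continuousOn hmap
  have hfd : ContinuousOn (fun p : ℝ × (Fin k → ℝ) × (Fin r → ℝ) =>
      fderiv ℝ Ψ (C.cube i a (cubeParam p.2.1), a, p.1 • circ p.2.2)) D :=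
    (hΨ.smooth.continuousOn_fderiv_of_isOpen hΨ.isOpen (by simp)).comp hp.continuousOn hmap
  have hfac : ∀ q, Continuous fun x : Fin (r + k) → ℂ => factor supp a x q := fun q =>
    (contDiff_factor_right supp a q).continuous
  refine ((ContinuousOn.mul ?_ (ContinuousOn.mul ?_ ?_)).mul ?_)
  · have h1 := (hC.horizontal i).continuousOn
    refine h1.comp (f := fun p : ℝ × (Fin k → ℝ) × (Fin r → ℝ) => (a, cubeParam p.2.1)) ?_ ?_
    · exact (continuous_const.prodMk
        ((contDiff_cubeParam k).continuous.comp (by fun_prop))).continuousOn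
    · exact fun p _ => ⟨h.subset ha, cubeParam_mem _⟩
  · refine continuousOn_finsetProd _ fun q _ p hpD => ?_
    refine continuousWithinAt_branchPow (((hfac q).comp hx).continuousWithinAt)
      ((hfac q).comp_continuousOn hT p hpD) fun hq => ?_
    exact h.slit a ha a ha i p.2.1 _
      (fun e => (norm_smul_circ hpD.1.1 p.2.2 e).trans_le hpD.1.2) q hq
  · refine continuousOn_finsetProd _ fun e _ => ContinuousOn.inv₀ ?_ fun p _ => circ_ne_zero _ _
    exact ((continuous_apply e).comp hc).continuousOn
  · refine (volumeCMM r k).cont.comp_continuousOn (continuousOn_pi.2 ?_)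
    rintro (e | q)
    · refine hfd.clm_apply (Continuous.continuousOn ?_)
      refine continuous_const.prodMk (continuous_const.prodMk ?_)
      exact (continuous_single e).comp (continuous_const.mul ((continuous_apply e).comp hc))
    · refine hfd.clm_apply (Continuous.continuousOn ?_)
      refine Continuous.prodMk ?_ continuous_const
      exact (((h.contDiff_cube hC ha i).continuous_fderiv (by simp)).comp
        (by fun_prop : Continuous fun p : ℝ × (Fin k → ℝ) × (Fin r → ℝ) => p.2.1)).clm_apply
        continuous_const

/-- At radius zero the `df_e` vanish on the tangent vectors of the cycle and are diagonal on the
circle directions, with entries `2πi · circ θ e`. The determinant gives `(2πi)^r ∏ circ θ e`, and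
its angular part cancels against the denominators. -/
theorem IsGoodRadius.tubeIntegrand_zero (h : IsGoodRadius C lam β U O Ψ a₀ ε δ)
    (hΨ : IsTube supp O Ψ) (hC : C.IsCycleOn lam β U) (ha : a ∈ Metric.ball a₀ δ) (i : Fin N)
    (z : (Fin k → ℝ) × (Fin r → ℝ)) :
    tubeIntegrand C lam β Ψ a i 0 z = (2 * Real.pi * Complex.I) ^ r *
      (C.sect i a (cubeParam z.1) *
      singleValuedPart (factorExponent lam β) (factor supp a (C.cube i a (cubeParam z.1))) *
      quotientForm (fun e => differential (poly supp a (Sum.inr e)) (C.cube i a (cubeParam z.1)))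
        (fun q => fderiv ℝ (fun t => C.cube i a (cubeParam t)) z.1 (Pi.single q 1))) := by
  have hvar : ∀ t : Fin k → ℝ, C.cube i a (cubeParam t) ∈ variety supp lam β a := fun t =>
    hC.mem_variety i a (h.subset ha) _ (cubeParam_mem t)
  have hO : ∀ t : Fin k → ℝ, (C.cube i a (cubeParam t), a, (0 : Fin r → ℂ)) ∈ O := fun t =>
    h.mem a ha i t 0 fun e => by simpa using h.pos.le
  have hret : ∀ t : Fin k → ℝ, Ψ (C.cube i a (cubeParam t), a, 0) = C.cube i a (cubeParam t) :=
    fun t => hΨ.retract _ _ (hO t) (polyVal_eq_zero_of_mem_variety (hvar t))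
  set x := C.cube i a (cubeParam z.1) with hx
  have hX := ((h.contDiff_cube hC ha i).differentiable (by simp) z.1).hasFDerivAt
  -- The tube restricts to the identity on the cycle, so its derivative fixes the tangent vectors of
  -- the cycle.
  have htan : ∀ v, fderiv ℝ Ψ (x, a, 0) (fderiv ℝ (fun t => C.cube i a (cubeParam t)) z.1 v, 0, 0) =
      fderiv ℝ (fun t => C.cube i a (cubeParam t)) z.1 v := by
    intro v
    have h1 := HasFDerivAt.comp (g := Ψ) z.1 (hΨ.hasFDerivAt (hO z.1))
      (hX.prodMk (hasFDerivAt_const ((a, 0) : (CoeffIndex supp → ℂ) × (Fin r → ℂ)) z.1))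
    have h2 : (Ψ ∘ fun t => (C.cube i a (cubeParam t), a, 0)) = fun t => C.cube i a (cubeParam t) :=
      funext hret
    rw [h2] at h1
    exact (DFunLike.congr_fun (h1.unique hX) v)
  have hker : ∀ e v, differential (poly supp a (Sum.inr e)) x
      (fderiv ℝ (fun t => C.cube i a (cubeParam t)) z.1 v) = 0 := by
    intro e v
    have h1 : HasDerivAt (fun s : ℝ => C.cube i a (cubeParam (z.1 + s • v)))
        (fderiv ℝ (fun t => C.cube i a (cubeParam t)) z.1 v) 0 := by
      have h2 : HasDerivAt (fun s : ℝ => z.1 + s • v) v 0 := by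
        simpa using ((hasDerivAt_id (0 : ℝ)).smul_const v).const_add z.1
      refine HasFDerivAt.comp_hasDerivAt (l := fun t => C.cube i a (cubeParam t))
        (f := fun s : ℝ => z.1 + s • v) 0 ?_ h2
      simpa using hX
    have h3 := differential_of_hasDerivAt (poly supp a (Sum.inr e)) h1
    have h4 : (fun s : ℝ => MvPolynomial.eval (C.cube i a (cubeParam (z.1 + s • v)))
        (poly supp a (Sum.inr e))) = fun _ => 0 := by
      ext s
      rw [← polyVal_def]
      exact polyVal_eq_zero_of_mem_variety (hvar _) e
    rw [h4] at h3
    have h5 := h3.unique (hasDerivAt_const (0 : ℝ) (0 : ℂ))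
    simpa using h5
  have htt : tubeTangent C Ψ a i 0 z = Sum.elim
      (fun e => fderiv ℝ Ψ (x, a, 0) (0, 0, Pi.single e (2 * Real.pi * Complex.I * circ z.2 e)))
      (fun q => fderiv ℝ (fun t => C.cube i a (cubeParam t)) z.1 (Pi.single q 1)) := by
    unfold tubeTangent
    simp only [zero_smul, ← hx, htan]
  have hdet : Matrix.det (Matrix.of fun j e => differential (poly supp a (Sum.inr e)) x
      (fderiv ℝ Ψ (x, a, 0) (0, 0, Pi.single j (2 * Real.pi * Complex.I * circ z.2 j)))) =
      (2 * Real.pi * Complex.I) ^ r * ∏ e, circ z.2 e := by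
    have h1 : (Matrix.of fun j e => differential (poly supp a (Sum.inr e)) x
        (fderiv ℝ Ψ (x, a, 0) (0, 0, Pi.single j (2 * Real.pi * Complex.I * circ z.2 j)))) =
        Matrix.diagonal fun e => 2 * Real.pi * Complex.I * circ z.2 e := by
      ext j e
      have h2 := hΨ.differential_fderiv (hO z.1)
        (Pi.single j (2 * Real.pi * Complex.I * circ z.2 j)) e
      rw [hret, ← hx] at h2
      rw [Matrix.of_apply, h2, Matrix.diagonal_apply, Pi.single_apply]
      by_cases hje : j = e
      · simp [hje]
      · simp [hje, Ne.symm hje]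
    rw [h1, Matrix.det_diagonal, Finset.prod_mul_distrib]
    simp
  have hcirc : (∏ e, (circ z.2 e)⁻¹) * ∏ e, circ z.2 e = 1 := by
    rw [← Finset.prod_mul_distrib]
    exact Finset.prod_eq_one fun e _ => inv_mul_cancel₀ (circ_ne_zero _ _)
  rw [tubeIntegrand, htt, volumeForm_eq_det_mul_quotientForm
    (linearIndependent_of_mem_variety (hvar z.1)) _ _ fun e q => hker e _, hdet, zero_smul, ← hx]
  simp only [hx]
  rw [hret, prod_branchPow_self _ _ (hvar z.1).2.2]
  linear_combination (C.sect i a (cubeParam z.1) *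
      singleValuedPart (factorExponent lam β) (factor supp a (C.cube i a (cubeParam z.1))) *
      (2 * Real.pi * Complex.I) ^ r *
      quotientForm (fun e => differential (poly supp a (Sum.inr e)) (C.cube i a (cubeParam z.1)))
        (fun q => fderiv ℝ (fun t => C.cube i a (cubeParam t)) z.1 (Pi.single q 1))) * hcirc

/-- Leray's residue formula: the integral over a small tube is `(2πi)^r` times the integral over
the cycle. -/
theorem IsGoodRadius.tubeIntegral_eq_integral (h : IsGoodRadius C lam β U O Ψ a₀ ε δ)
    (hΨ : IsTube supp O Ψ) (hC : C.IsCycleOn lam β U) (ha : a ∈ Metric.ball a₀ δ) :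
    C.tubeIntegral lam β Ψ a a ε = (2 * Real.pi * Complex.I) ^ r * C.integral lam β a := by
  let J : ℝ → ℂ := fun ρ => ∑ i, ∫ z in unitCube k ×ˢ unitCube r, tubeIntegrand C lam β Ψ a i ρ z
  have hbox : IsCompact (unitCube k ×ˢ unitCube r) :=
    (isCompact_unitCube k).prod (isCompact_unitCube r)
  have hJ : ContinuousOn J (Icc 0 ε) := continuousOn_finsetSum _ fun i _ =>
    continuousOn_setIntegral_of_isCompact hbox isCompact_Icc
      (h.continuousOn_tubeIntegrand hΨ hC ha i)
  -- Changing the radius is itself a deformation. It avoids the poles only for positive radius, so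
  -- the value at `0` is reached by continuity.
  have hder : ∀ s ∈ Ioo 0 ε, HasDerivAt J 0 s := by
    intro s hs
    have h1 : HasDerivAt (fun s => C.tubeIntegral lam β Ψ a a s) 0 s := by
      refine hasDerivAt_sweep_integral hC a isOpen_Ioo (b := fun _ => a) (Θ := fun y =>
        Ψ (y.2.1, a, y.1 • circ y.2.2)) (fun s _ => contDiffAt_const)
        (fun s hs => h.subset ha) ?_ ?_ ?_ hs
      · intro s hs i t θ
        exact contDiffAt_tube_param hΨ (b := fun _ => a) contDiffAt_const (ρ := fun s => s)
          contDiffAt_id (h.mem_tube ha i (Ioo_subset_Icc_self hs) t θ)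
      · intro s x θ e
        simp only [circ_add_single]
      · intro s hs i t θ
        refine ⟨h.slit a ha _ ha i t _ fun e => (norm_smul_circ hs.1.le θ e).trans_le hs.2.le,
          fun e => ?_⟩
        rw [hΨ.value _ (h.mem_tube ha i (Ioo_subset_Icc_self hs) t θ)]
        exact smul_ne_zero hs.1.ne' (circ_ne_zero θ e)
    refine h1.congr_of_eventuallyEq ?_
    filter_upwards [isOpen_Ioo.mem_nhds hs] with ρ hρ
    exact (h.tubeIntegral_eq_sum hΨ hC ha ⟨hρ.1, hρ.2.le⟩).symm
  have hconst : J ε = J 0 := by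
    have h1 : EqOn J (fun _ => J (ε / 2)) (Ioo 0 ε) := fun s hs =>
      isOpen_Ioo.is_const_of_deriv_eq_zero isPreconnected_Ioo
        (fun s hs => (hder s hs).differentiableAt.differentiableWithinAt)
        (fun s hs => (hder s hs).deriv) hs ⟨half_pos h.pos, half_lt_self h.pos⟩
    have h2 := h1.of_subset_closure hJ continuousOn_const Ioo_subset_Icc_self
      (closure_Ioo h.pos.ne).ge
    exact (h2 (right_mem_Icc.2 h.pos.le)).trans (h2 (left_mem_Icc.2 h.pos.le)).symm
  rw [h.tubeIntegral_eq_sum hΨ hC ha ⟨h.pos, le_rfl⟩]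
  change J ε = _
  rw [hconst, hC.integral_eq (h.subset ha), Finset.mul_sum]
  refine Finset.sum_congr rfl fun i _ => ?_
  simp only [h.tubeIntegrand_zero hΨ hC ha]
  rw [integral_const_mul]
  congr 1
  -- The limiting integrand does not depend on the angles, and the cube of angles has volume one.
  have h1 := setIntegral_prod_mul (μ := (volume : Measure (Fin k → ℝ)))
    (ν := (volume : Measure (Fin r → ℝ))) (fun t => C.sect i a (cubeParam t) *
      singleValuedPart (factorExponent lam β) (factor supp a (C.cube i a (cubeParam t))) *
      quotientForm (fun e => differential (poly supp a (Sum.inr e)) (C.cube i a (cubeParam t)))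
        (fun q => fderiv ℝ (fun t => C.cube i a (cubeParam t)) t (Pi.single q 1)))
    (fun _ => (1 : ℂ)) (unitCube k) (unitCube r)
  rw [← Measure.volume_eq_prod] at h1
  simp only [mul_one] at h1
  rw [h1]
  have h2 : ∫ _ in unitCube r, (1 : ℂ) = 1 := by
    simp [Measure.real, unitCube, Real.volume_Icc_pi]
  rw [h2, mul_one]

end Radial

/-! ### Existence of good radii, and integration over a fixed tube. -/

section GoodRadius

variable {l r k N : ℕ} {supp : Fin l ⊕ Fin r → Finset (Fin (r + k) →₀ ℕ)}
  {O : Set ((Fin (r + k) → ℂ) × (CoeffIndex supp → ℂ) × (Fin r → ℂ))}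
  {Ψ : (Fin (r + k) → ℂ) × (CoeffIndex supp → ℂ) × (Fin r → ℂ) → Fin (r + k) → ℂ}
  {C : TwistedChain supp N} {lam : Fin l → ℂ} {β : Fin (r + k) → ℂ}
  {U : Set (CoeffIndex supp → ℂ)} {a₀ : CoeffIndex supp → ℂ}

/-- Every value of `cubeParam` is already attained on the compact cube, so bounds obtained there by
compactness hold for all parameters. -/
theorem forall_cubeParam {k : ℕ} {P : (Fin k → ℝ) → Prop}
    (h : ∀ t ∈ unitCube k, P (cubeParam t)) (t : Fin k → ℝ) : P (cubeParam t) := by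
  obtain ⟨s, hs, hst⟩ := exists_cubeParam_eq (cubeParam_mem t)
  exact hst ▸ h s hs

theorem TwistedChain.IsCycleOn.continuousAt_cube (hC : C.IsCycleOn lam β U) (hU : IsOpen U)
    {b : CoeffIndex supp → ℂ} (hb : b ∈ U) (i : Fin N) (t : Fin k → ℝ) :
    ContinuousAt (fun p : (CoeffIndex supp → ℂ) × (Fin k → ℝ) => C.cube i p.1 (cubeParam p.2))
      (b, t) :=
  (hC.contDiffAt_cube (b := fun p : (CoeffIndex supp → ℂ) × (Fin k → ℝ) => p.1)
    (τ := fun p : (CoeffIndex supp → ℂ) × (Fin k → ℝ) => p.2) contDiffAt_fst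
    (continuousAt_fst.eventually_mem (hU.mem_nhds hb)) contDiffAt_snd i).continuousAt

theorem continuousAt_factor_comp {X : Type*} [TopologicalSpace X] {x : X}
    {f : X → CoeffIndex supp → ℂ} {g : X → Fin (r + k) → ℂ} (hf : ContinuousAt f x)
    (hg : ContinuousAt g x) (q : Fin l ⊕ Fin (r + k)) :
    ContinuousAt (fun x => factor supp (f x) (g x) q) x :=
  ContinuousAt.comp (f := fun x => (f x, g x))
    (g := fun p : (CoeffIndex supp → ℂ) × (Fin (r + k) → ℂ) => factor supp p.1 p.2 q)
    (contDiff_factor supp q).continuous.continuousAt (hf.prodMk hg)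

theorem continuousAt_polyVal_comp {X : Type*} [TopologicalSpace X] {x : X}
    {f : X → CoeffIndex supp → ℂ} {g : X → Fin (r + k) → ℂ} (hf : ContinuousAt f x)
    (hg : ContinuousAt g x) (i : Fin l ⊕ Fin r) :
    ContinuousAt (fun x => polyVal supp (f x) (g x) i) x :=
  ContinuousAt.comp (f := fun x => (f x, g x))
    (g := fun p : (CoeffIndex supp → ℂ) × (Fin (r + k) → ℂ) => polyVal supp p.1 p.2 i)
    (contDiff_polyVal supp i).continuous.continuousAt (hf.prodMk hg)

/-- The radius `ε` is chosen before `δ`: the denominators stay nonzero on `|w_e| = ε` only if the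
coefficients of form and base are close in a way that depends on `ε`. Having every small `ε`
available allows a common radius for two cycles. -/
theorem eventually_isGoodRadius (hΨ : IsTube supp O Ψ) (hC : C.IsCycleOn lam β U) (hU : IsOpen U)
    (ha₀ : a₀ ∈ U) (hO : ∀ i, ∀ t ∈ unitCube k, (C.cube i a₀ t, a₀, 0) ∈ O) :
    ∀ᶠ ε in 𝓝[>] (0 : ℝ), ∃ δ, IsGoodRadius C lam β U O Ψ a₀ ε δ := by
  have hcube : ∀ i (a : CoeffIndex supp → ℂ) (w : Fin r → ℂ) t, ContinuousAt
      (fun p : ((CoeffIndex supp → ℂ) × (CoeffIndex supp → ℂ) × (Fin r → ℂ)) × (Fin k → ℝ) =>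
        C.cube i p.1.2.1 (cubeParam p.2)) ((a, a₀, w), t) := fun i a w t =>
    ContinuousAt.comp (g := fun p : (CoeffIndex supp → ℂ) × (Fin k → ℝ) =>
      C.cube i p.1 (cubeParam p.2)) (f := fun p : ((CoeffIndex supp → ℂ) ×
      (CoeffIndex supp → ℂ) × (Fin r → ℂ)) × (Fin k → ℝ) => (p.1.2.1, p.2)) (x := ((a, a₀, w), t))
      (hC.continuousAt_cube hU ha₀ i t)
      (by fun_prop)
  have htube : ∀ i (a : CoeffIndex supp → ℂ) (w : Fin r → ℂ) t,
      (C.cube i a₀ (cubeParam t), a₀, w) ∈ O → ContinuousAt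
      (fun p : ((CoeffIndex supp → ℂ) × (CoeffIndex supp → ℂ) × (Fin r → ℂ)) × (Fin k → ℝ) =>
        Ψ (C.cube i p.1.2.1 (cubeParam p.2), p.1.2.1, p.1.2.2)) ((a, a₀, w), t) := fun i a w t h =>
    ContinuousAt.comp (g := Ψ) (f := fun p : ((CoeffIndex supp → ℂ) × (CoeffIndex supp → ℂ) ×
      (Fin r → ℂ)) × (Fin k → ℝ) => (C.cube i p.1.2.1 (cubeParam p.2), p.1.2.1, p.1.2.2))
      (hΨ.contDiffAt h).continuousAt ((hcube i a w t).prodMk (by fun_prop))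
  -- At the centre the ratio of each factor to its reference value is `1`, which lies in the slit
  -- plane; compactness of the cube makes the neighbourhood uniform in `t`.
  have h1 : ∀ᶠ p : (CoeffIndex supp → ℂ) × (CoeffIndex supp → ℂ) × (Fin r → ℂ) in
      𝓝 (a₀, a₀, 0), ∀ t ∈ unitCube k, ∀ i, (C.cube i p.2.1 (cubeParam t), p.2.1, p.2.2) ∈ O ∧
        ∀ q, ¬ IsNat (factorExponent lam β q) →
          factor supp p.1 (Ψ (C.cube i p.2.1 (cubeParam t), p.2.1, p.2.2)) q /
            factor supp p.2.1 (C.cube i p.2.1 (cubeParam t)) q ∈ Complex.slitPlane := by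
    refine (isCompact_unitCube k).eventually_forall_of_forall_eventually fun t _ => ?_
    rw [eventually_all]
    intro i
    have hmem := hO i _ (cubeParam_mem t)
    have hvar := hC.mem_variety i a₀ ha₀ _ (cubeParam_mem t)
    refine Eventually.and ?_ (eventually_all.2 fun q => ?_)
    · exact ((hcube i a₀ 0 t).prodMk (by fun_prop)).eventually_mem (hΨ.isOpen.mem_nhds hmem)
    · by_cases hq : IsNat (factorExponent lam β q)
      · exact Eventually.of_forall fun _ h => absurd hq h
      have h2 : ContinuousAt (fun p : ((CoeffIndex supp → ℂ) × (CoeffIndex supp → ℂ) ×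
          (Fin r → ℂ)) × (Fin k → ℝ) =>
          factor supp p.1.1 (Ψ (C.cube i p.1.2.1 (cubeParam p.2), p.1.2.1, p.1.2.2)) q /
            factor supp p.1.2.1 (C.cube i p.1.2.1 (cubeParam p.2)) q) ((a₀, a₀, 0), t) :=
        (continuousAt_factor_comp (by fun_prop) (htube i a₀ 0 t hmem) q).div
          (continuousAt_factor_comp (by fun_prop) (hcube i a₀ 0 t) q) (hvar.2.2 q hq)
      refine (h2.eventually_mem (Complex.isOpen_slitPlane.mem_nhds ?_)).mono fun _ h _ => h
      simp only
      rw [hΨ.retract _ _ hmem (polyVal_eq_zero_of_mem_variety hvar), div_self (hvar.2.2 q hq)]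
      exact Complex.one_mem_slitPlane
  obtain ⟨η, hη, hη'⟩ := Metric.eventually_nhds_iff.1 h1
  have h2 : ∀ a b : CoeffIndex supp → ℂ, a ∈ Metric.ball a₀ η → b ∈ Metric.ball a₀ η →
      ∀ w : Fin r → ℂ, ‖w‖ < η → dist (a, b, w) (a₀, a₀, 0) < η := by
    intro a b ha hb w hw
    rw [Prod.dist_eq, Prod.dist_eq]
    exact max_lt ha (max_lt hb (by simpa using hw))
  filter_upwards [Ioo_mem_nhdsGT hη] with ε hε
  have hw : ∀ w : Fin r → ℂ, (∀ e, ‖w e‖ ≤ ε) → ‖w‖ < η := fun w hw =>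
    ((pi_norm_le_iff_of_nonneg hε.1.le).2 hw).trans_lt hε.2
  have h0 : a₀ ∈ Metric.ball a₀ η := Metric.mem_ball_self hη
  -- At `a = b = a₀` the value of `f_e` is `w_e`, nonzero on the product of circles; compactness of
  -- that torus times the cube gives a uniform `δ₁`.
  have h3 : ∀ᶠ p : (CoeffIndex supp → ℂ) × (CoeffIndex supp → ℂ) in 𝓝 (a₀, a₀),
      ∀ y ∈ (Set.pi univ fun _ : Fin r => Metric.sphere (0 : ℂ) ε) ×ˢ unitCube k, ∀ i e,
        polyVal supp p.1 (Ψ (C.cube i p.2 (cubeParam y.2), p.2, y.1)) (Sum.inr e) ≠ 0 := by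
    refine ((isCompact_univ_pi fun _ => isCompact_sphere _ _).prod
      (isCompact_unitCube k)).eventually_forall_of_forall_eventually ?_
    rintro ⟨w, t⟩ ⟨hws, -⟩
    rw [eventually_all]
    intro i
    rw [eventually_all]
    intro e
    have hwe : ∀ e, ‖w e‖ = ε := fun e => by simpa using hws e (mem_univ e)
    have hmem' : (C.cube i a₀ (cubeParam t), a₀, w) ∈ O :=
      forall_cubeParam (P := fun t => (C.cube i a₀ t, a₀, w) ∈ O) (fun t ht =>
        (hη' (h2 a₀ a₀ h0 h0 w (hw w fun e => (hwe e).le)) t ht i).1) t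
    have h4 : ContinuousAt (fun p : ((CoeffIndex supp → ℂ) × (CoeffIndex supp → ℂ)) ×
        (Fin r → ℂ) × (Fin k → ℝ) => Ψ (C.cube i p.1.2 (cubeParam p.2.2), p.1.2, p.2.1))
        ((a₀, a₀), w, t) :=
      ContinuousAt.comp (g := fun p : ((CoeffIndex supp → ℂ) × (CoeffIndex supp → ℂ) ×
        (Fin r → ℂ)) × (Fin k → ℝ) => Ψ (C.cube i p.1.2.1 (cubeParam p.2), p.1.2.1, p.1.2.2))
        (f := fun p : ((CoeffIndex supp → ℂ) × (CoeffIndex supp → ℂ)) ×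
        (Fin r → ℂ) × (Fin k → ℝ) => ((p.1.1, p.1.2, p.2.1), p.2.2)) (htube i a₀ w t hmem')
        (by fun_prop)
    refine (continuousAt_polyVal_comp (by fun_prop) h4 (Sum.inr e)).eventually_ne ?_
    simp only
    rw [hΨ.value _ hmem']
    exact norm_pos_iff.1 ((hwe e).symm ▸ hε.1)
  obtain ⟨δ₁, hδ₁, h3'⟩ := Metric.eventually_nhds_iff.1 h3
  obtain ⟨δ₂, hδ₂, h5⟩ := Metric.isOpen_iff.1 hU a₀ ha₀
  have hle : ∀ δ ∈ ({δ₁, δ₂, η} : Set ℝ), Metric.ball a₀ (min δ₁ (min δ₂ η)) ⊆ Metric.ball a₀ δ := by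
    intro δ hδ
    refine Metric.ball_subset_ball ?_
    rcases hδ with rfl | rfl | rfl <;> simp
  have hb₁ := hle δ₁ (by simp)
  have hb₂ := hle δ₂ (by simp)
  have hb₃ := hle η (by simp)
  refine ⟨min δ₁ (min δ₂ η), hε.1, lt_min hδ₁ (lt_min hδ₂ hη), hb₂.trans h5, ?_, ?_, ?_⟩
  · intro b hb i t w hwε
    exact forall_cubeParam (P := fun t => (C.cube i b t, b, w) ∈ O) (fun t ht =>
      (hη' (h2 a₀ b h0 (hb₃ hb) w (hw w hwε)) t ht i).1) t
  · intro a ha b hb i t w hwε q hq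
    exact forall_cubeParam (P := fun t => factor supp a (Ψ (C.cube i b t, b, w)) q /
      factor supp b (C.cube i b t) q ∈ Complex.slitPlane) (fun t ht =>
      (hη' (h2 a b (hb₃ ha) (hb₃ hb) w (hw w hwε)) t ht i).2 q hq) t
  · intro a ha b hb i t w hwε e
    refine forall_cubeParam (P := fun t => polyVal supp a (Ψ (C.cube i b t, b, w)) (Sum.inr e) ≠ 0)
      (fun t ht => ?_) t
    refine h3' (y := (a, b)) ?_ (w, t) ⟨fun e _ => by simpa using hwε e, ht⟩ i e
    rw [Prod.dist_eq]
    exact max_lt (hb₁ ha) (hb₁ hb)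

/-- Near `a₀` the integral is given by integration over a fixed tube. -/
theorem IsGoodRadius.integral_eq {ε δ : ℝ} (h : IsGoodRadius C lam β U O Ψ a₀ ε δ)
    (hΨ : IsTube supp O Ψ) (hC : C.IsCycleOn lam β U) {a : CoeffIndex supp → ℂ}
    (ha : a ∈ Metric.ball a₀ δ) :
    C.integral lam β a = ((2 * Real.pi * Complex.I) ^ r)⁻¹ * C.tubeIntegral lam β Ψ a a₀ ε := by
  rw [← h.tubeIntegral_eq hΨ hC ha, h.tubeIntegral_eq_integral hΨ hC ha,
    inv_mul_cancel_left₀ (pow_ne_zero _ Complex.two_pi_I_ne_zero)]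

theorem TwistedChain.tubeIntegral_congr {C' : TwistedChain supp N} (h : C.AgreeAt C' a₀)
    (a : CoeffIndex supp → ℂ) (ρ : ℝ) :
    C.tubeIntegral lam β Ψ a a₀ ρ = C'.tubeIntegral lam β Ψ a a₀ ρ := by
  have h1 : ∀ i t, C.cube i a₀ (cubeParam t) = C'.cube i a₀ (cubeParam t) := fun i t =>
    (h i _ (cubeParam_mem t)).1
  have h2 : ∀ i t, C.sect i a₀ (cubeParam t) = C'.sect i a₀ (cubeParam t) := fun i t =>
    (h i _ (cubeParam_mem t)).2
  unfold tubeIntegral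
  simp only [h1, h2]

/-- The points of a cycle, at one coefficient vector. -/
def TwistedChain.support (C : TwistedChain supp N) (a : CoeffIndex supp → ℂ) :
    Set (Fin (r + k) → ℂ) := ⋃ i, C.cube i a '' unitCube k

theorem TwistedChain.mem_support (C : TwistedChain supp N) (a : CoeffIndex supp → ℂ) (i : Fin N)
    {t : Fin k → ℝ} (ht : t ∈ unitCube k) : C.cube i a t ∈ C.support a :=
  mem_iUnion.2 ⟨i, mem_image_of_mem _ ht⟩

theorem TwistedChain.IsCycleOn.continuousOn_cube {S : Set (CoeffIndex supp → ℂ)}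
    (hC : C.IsCycleOn lam β S) (ha₀ : a₀ ∈ S) (i : Fin N) :
    ContinuousOn (C.cube i a₀) (unitCube k) :=
  ContinuousOn.comp (g := fun y : (CoeffIndex supp → ℂ) × (Fin k → ℝ) => C.cube i y.1 y.2)
    (f := fun t => (a₀, t)) (hC.smooth i).continuousOn (by fun_prop) fun _ ht => ⟨ha₀, ht⟩

theorem TwistedChain.IsCycleOn.isCompact_support {S : Set (CoeffIndex supp → ℂ)}
    (hC : C.IsCycleOn lam β S) (ha₀ : a₀ ∈ S) : IsCompact (C.support a₀) :=
  isCompact_iUnion fun i => (isCompact_unitCube k).image_of_continuousOn (hC.continuousOn_cube ha₀ i)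

/-- There is a tube around every cycle. -/
theorem TwistedChain.IsCycleOn.exists_isTube {S : Set (CoeffIndex supp → ℂ)}
    (hC : C.IsCycleOn lam β S) (ha₀ : a₀ ∈ S) : ∃ O Ψ, IsTube supp O Ψ ∧
      ∀ i, ∀ t ∈ unitCube k, (C.cube i a₀ t, a₀, (0 : Fin r → ℂ)) ∈ O := by
  have hK : IsCompact (C.support a₀) := hC.isCompact_support ha₀
  have hvar : ∀ x ∈ C.support a₀, x ∈ variety supp lam β a₀ := by
    intro x hx
    obtain ⟨i, t, ht, rfl⟩ := mem_iUnion.1 hx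
    exact hC.mem_variety i a₀ ha₀ t ht
  obtain ⟨O, hO, Ψ, hΨ, hmem, hval, hret⟩ := exists_tube supp a₀ hK
    (fun x hx e => polyVal_eq_zero_of_mem_variety (hvar x hx) e)
    (fun x hx => linearIndependent_of_mem_variety (hvar x hx))
  exact ⟨O, Ψ, ⟨hO, hΨ, hval, hret⟩, fun i t ht => hmem _ (C.mem_support a₀ i ht)⟩

/-- The integral over the fixed tube reads a family only at `a₀`. One tube map and one radius serve
both families, so both integrals are given by the same expression near `a₀`. -/
theorem eventually_integral_eq_of_agreeAt {C' : TwistedChain supp N} (hU : IsOpen U)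
    (ha₀ : a₀ ∈ U) (hC : C.IsCycleOn lam β U) (hC' : C'.IsCycleOn lam β U)
    (h : C.AgreeAt C' a₀) : ∀ᶠ a in 𝓝 a₀, C.integral lam β a = C'.integral lam β a := by
  obtain ⟨O, Ψ, hΨ, hO⟩ := hC.exists_isTube ha₀
  obtain ⟨ε, ⟨δ, hδ⟩, δ', hδ'⟩ := ((eventually_isGoodRadius hΨ hC hU ha₀ hO).and
    (eventually_isGoodRadius hΨ hC' hU ha₀ fun i t ht => (h i t ht).1 ▸ hO i t ht)).exists
  filter_upwards [Metric.ball_mem_nhds a₀ hδ.pos', Metric.ball_mem_nhds a₀ hδ'.pos'] with a ha ha'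
  rw [hδ.integral_eq hΨ hC ha, hδ'.integral_eq hΨ hC' ha', TwistedChain.tubeIntegral_congr h]

end GoodRadius

/-! ### Toric differential equations for integrals of products of powers of polynomials -/

section Toric

variable {κ : Type*} [Fintype κ] {m N : ℕ} {supp : κ → Finset (Fin m →₀ ℕ)}
  {T : Type*}

/-- The products `c x^J ∏ P_i^{(n_i)}(f_i(x))`, where `P_i^{(n)}` stands for an `n`-th derivative. -/
def toricTerm (supp : κ → Finset (Fin m →₀ ℕ)) (c : T → ℂ) (x : T → Fin m → ℂ)
    (P : κ → ℕ → T → ℂ → ℂ) (n : κ → ℕ) (J : Fin m → ℕ) (a : CoeffIndex supp → ℂ) (τ : T) : ℂ :=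
  c τ * (∏ p, x τ p ^ J p) * ∏ i, P i (n i) τ (polyVal supp a (x τ) i)

variable {c : T → ℂ} {x : T → Fin m → ℂ} {P : κ → ℕ → T → ℂ → ℂ}
  {B : Set (CoeffIndex supp → ℂ)} {K : Set T}

theorem hasFDerivAt_polyVal_left (supp : κ → Finset (Fin m →₀ ℕ)) (a : CoeffIndex supp → ℂ)
    (x : Fin m → ℂ) (i : κ) : HasFDerivAt (fun a => polyVal supp a x i)
      (∑ j : {j // j ∈ supp i}, (∏ p, x p ^ (j.1 p)) •
        ContinuousLinearMap.proj (R := ℂ) (φ := fun _ : CoeffIndex supp => ℂ) ⟨i, j⟩) a := by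
  simp only [polyVal_eq_sum]
  refine HasFDerivAt.fun_sum fun j _ => ?_
  exact (hasFDerivAt_apply (𝕜 := ℂ) (⟨i, j⟩ : CoeffIndex supp) a).mul_const _

/-- The linear form with the given coefficients. -/
def coeffForm {Ω : Type*} [Fintype Ω] (G : Ω → ℂ) : (Ω → ℂ) →L[ℂ] ℂ :=
  ∑ w, G w • ContinuousLinearMap.proj (R := ℂ) (φ := fun _ : Ω => ℂ) w

theorem coeffForm_apply {Ω : Type*} [Fintype Ω] (G v : Ω → ℂ) :
    coeffForm G v = ∑ w, G w * v w := by
  simp [coeffForm]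

theorem continuousOn_coeffForm {Ω X : Type*} [Fintype Ω] [TopologicalSpace X] {S : Set X}
    {G : X → Ω → ℂ} (hG : ∀ w, ContinuousOn (fun y => G y w) S) :
    ContinuousOn (fun y => coeffForm (G y)) S :=
  continuousOn_finsetSum _ fun w _ => (hG w).smul continuousOn_const

theorem integral_coeffForm {Ω X : Type*} [Fintype Ω] [MeasurableSpace X] {μ : Measure X}
    {G : X → Ω → ℂ} (hG : ∀ w, Integrable (fun y => G y w) μ) :
    ∫ y, coeffForm (G y) ∂μ = coeffForm fun w => ∫ y, G y w ∂μ := by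
  unfold coeffForm
  rw [integral_finsetSum _ fun w _ => (hG w).smul_const _]
  exact Finset.sum_congr rfl fun w _ => integral_smul_const _ _

theorem hasFDerivAt_setIntegral_coeffForm {Ω X : Type*} [Fintype Ω] [TopologicalSpace X] [T2Space X] [MeasurableSpace X]
    [OpensMeasurableSpace X] [SecondCountableTopology X] {μ : Measure X}
    [IsFiniteMeasureOnCompacts μ] {K : Set X} (hK : IsCompact K) {B : Set (Ω → ℂ)} (hB : IsOpen B)
    {F : (Ω → ℂ) → X → ℂ} {G : (Ω → ℂ) → X → Ω → ℂ}
    (hF : ContinuousOn (fun p : (Ω → ℂ) × X => F p.1 p.2) (B ×ˢ K))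
    (hG : ∀ w, ContinuousOn (fun p : (Ω → ℂ) × X => G p.1 p.2 w) (B ×ˢ K))
    (hd : ∀ a ∈ B, ∀ x ∈ K, HasFDerivAt (fun a => F a x) (coeffForm (G a x)) a) {a₀ : Ω → ℂ}
    (ha₀ : a₀ ∈ B) :
    HasFDerivAt (fun a => ∫ x in K, F a x ∂μ) (coeffForm fun w => ∫ x in K, G a₀ x w ∂μ) a₀ := by
  have h2 : ∀ w, IntegrableOn (fun x => G a₀ x w) K μ := fun w =>
    ((hG w).comp (by fun_prop : ContinuousOn (fun x => (a₀, x)) K)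
      fun x hx => ⟨ha₀, hx⟩).integrableOn_compact hK
  have h1 := hasFDerivAt_setIntegral_of_isCompact (𝕜 := ℂ) (μ := μ) hK hB (F := F) (F' := fun a x => coeffForm (G a x)) hF
    (continuousOn_coeffForm hG) hd ha₀
  exact h1.congr_fderiv (integral_coeffForm h2)

theorem coeffForm_single {Ω : Type*} [Fintype Ω] [DecidableEq Ω] (G : Ω → ℂ) (w : Ω) :
    coeffForm G (Pi.single w 1) = G w := by
  simp [coeffForm_apply, Pi.single_apply]

/-- Since `∂f_i/∂a_{ij} = x^j`, this partial derivative raises the order of the `i`-th function by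
one and adds `j` to the exponent of `x`: the class of terms is preserved, with index shifted by
`(e_i, j)`. -/
theorem hasFDerivAt_toricTerm [DecidableEq κ] {n : κ → ℕ} {J : Fin m → ℕ} {a : CoeffIndex supp → ℂ} {τ : T}
    (hP : ∀ i, HasDerivAt (P i (n i) τ) (P i (n i + 1) τ (polyVal supp a (x τ) i))
      (polyVal supp a (x τ) i)) :
    HasFDerivAt (fun a => toricTerm supp c x P n J a τ)
      (coeffForm fun w : CoeffIndex supp =>
        toricTerm supp c x P (n + Pi.single w.1 1) (J + ⇑w.2.1) a τ) a := by
  have h1 := (HasFDerivAt.finsetProd (u := Finset.univ) fun i _ =>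
    (hP i).hasFDerivAt.comp a (hasFDerivAt_polyVal_left supp a (x τ) i)).const_mul
    (c τ * ∏ p, x τ p ^ J p)
  convert! h1 using 1
  ext1 v
  simp only [coeffForm_apply, sum_apply, smul_apply, ContinuousLinearMap.proj_apply, ContinuousLinearMap.comp_apply, smul_eq_mul,
    Fintype.sum_sigma, Finset.mul_sum, Function.comp_apply]
  refine Finset.sum_congr rfl fun i _ => ?_
  simp only [ContinuousLinearMap.toSpanSingleton_apply, smul_eq_mul, Finset.sum_mul, Finset.mul_sum]
  refine Finset.sum_congr rfl fun j _ => ?_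
  have h2 : ∏ i', P i' ((n + Pi.single i 1 : κ → ℕ) i') τ (polyVal supp a (x τ) i') =
      (∏ i' ∈ Finset.univ.erase i, P i' (n i') τ (polyVal supp a (x τ) i')) *
        P i (n i + 1) τ (polyVal supp a (x τ) i) := by
    rw [← Finset.prod_erase_mul _ _ (Finset.mem_univ i)]
    congr 1
    · refine Finset.prod_congr rfl fun i' hi' => ?_
      simp [Finset.ne_of_mem_erase hi']
    · simp
  have h3 : ∏ p, x τ p ^ ((J + ⇑j.1) p) = (∏ p, x τ p ^ J p) * ∏ p, x τ p ^ (j.1 p) := by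
    rw [← Finset.prod_mul_distrib]
    exact Finset.prod_congr rfl fun p _ => pow_add _ _ _
  rw [toricTerm, h2, h3]
  ring

theorem continuousOn_toricTerm [TopologicalSpace T] (hc : ContinuousOn c K) (hx : ContinuousOn x K)
    (hP : ∀ i n, ContinuousOn (fun y : (CoeffIndex supp → ℂ) × T =>
      P i n y.2 (polyVal supp y.1 (x y.2) i)) (B ×ˢ K)) (n : κ → ℕ) (J : Fin m → ℕ) :
    ContinuousOn (fun y : (CoeffIndex supp → ℂ) × T => toricTerm supp c x P n J y.1 y.2)
      (B ×ˢ K) := by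
  have hsnd : MapsTo (Prod.snd : (CoeffIndex supp → ℂ) × T → T) (B ×ˢ K) K := fun y hy => hy.2
  refine ((hc.comp continuousOn_snd hsnd).mul ?_).mul (continuousOn_finsetProd _ fun i _ => hP i _)
  exact continuousOn_finsetProd _ fun p _ =>
    ((continuous_apply p).comp_continuousOn (hx.comp continuousOn_snd hsnd)).pow _

variable [DecidableEq κ] [TopologicalSpace T] [T2Space T] [MeasurableSpace T] [OpensMeasurableSpace T] [SecondCountableTopology T]
  {μ : Measure T} [IsFiniteMeasureOnCompacts μ]

theorem hasFDerivAt_integral_toricTerm (hK : IsCompact K) (hB : IsOpen B)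
    (hc : ContinuousOn c K) (hx : ContinuousOn x K)
    (hP : ∀ i n, ContinuousOn (fun y : (CoeffIndex supp → ℂ) × T =>
      P i n y.2 (polyVal supp y.1 (x y.2) i)) (B ×ˢ K))
    (hP' : ∀ a ∈ B, ∀ τ ∈ K, ∀ i n, HasDerivAt (P i n τ) (P i (n + 1) τ (polyVal supp a (x τ) i))
      (polyVal supp a (x τ) i)) (n : κ → ℕ) (J : Fin m → ℕ) {a : CoeffIndex supp → ℂ} (ha : a ∈ B) :
    HasFDerivAt (fun a => ∫ τ in K, toricTerm supp c x P n J a τ ∂μ)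
      (coeffForm fun w : CoeffIndex supp =>
        ∫ τ in K, toricTerm supp c x P (n + Pi.single w.1 1) (J + ⇑w.2.1) a τ ∂μ) a := by
  exact hasFDerivAt_setIntegral_coeffForm hK hB (continuousOn_toricTerm hc hx hP n J)
    (fun w => continuousOn_toricTerm hc hx hP _ _)
    (fun a ha τ hτ => hasFDerivAt_toricTerm fun i => hP' a ha τ hτ i _) ha

/-- By induction on `L` the index shifts add up. The right-hand side sees `L` only through two sums,
and the toric equations follow from this. -/
theorem iteratedPartialDeriv_eq_toric {c : Fin N → T → ℂ} {x : Fin N → T → Fin m → ℂ}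
    {P : Fin N → κ → ℕ → T → ℂ → ℂ} {Φ : (CoeffIndex supp → ℂ) → ℂ} (hK : IsCompact K)
    (hB : IsOpen B) (hc : ∀ ν, ContinuousOn (c ν) K) (hx : ∀ ν, ContinuousOn (x ν) K)
    (hP : ∀ ν i n, ContinuousOn (fun y : (CoeffIndex supp → ℂ) × T =>
      P ν i n y.2 (polyVal supp y.1 (x ν y.2) i)) (B ×ˢ K))
    (hP' : ∀ ν, ∀ a ∈ B, ∀ τ ∈ K, ∀ i n, HasDerivAt (P ν i n τ)
      (P ν i (n + 1) τ (polyVal supp a (x ν τ) i)) (polyVal supp a (x ν τ) i))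
    (hΦ : ∀ a ∈ B, Φ a = ∑ ν, ∫ τ in K, toricTerm supp (c ν) (x ν) (P ν) 0 0 a τ ∂μ)
    (L : List (CoeffIndex supp)) {a : CoeffIndex supp → ℂ} (ha : a ∈ B) :
    iteratedPartialDeriv L Φ a = ∑ ν, ∫ τ in K, toricTerm supp (c ν) (x ν) (P ν)
      (L.map fun w => Pi.single w.1 1).sum (L.map fun w : CoeffIndex supp => (⇑w.2.1 : Fin m → ℕ)).sum a τ ∂μ := by
  induction L generalizing a with
  | nil => simpa [iteratedPartialDeriv] using hΦ a ha
  | cons w L ih =>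
    have h1 := HasFDerivAt.fun_sum (u := Finset.univ) fun ν (_ : ν ∈ Finset.univ) =>
      hasFDerivAt_integral_toricTerm (μ := μ) hK hB (hc ν) (hx ν) (hP ν) (hP' ν)
        (L.map fun w => Pi.single w.1 1).sum (L.map fun w : CoeffIndex supp => (⇑w.2.1 : Fin m → ℕ)).sum ha
    have h2 : iteratedPartialDeriv L Φ =ᶠ[𝓝 a] fun a => ∑ ν, ∫ τ in K,
        toricTerm supp (c ν) (x ν) (P ν)
        (L.map fun w => Pi.single w.1 1).sum (L.map fun w : CoeffIndex supp => (⇑w.2.1 : Fin m → ℕ)).sum a τ ∂μ := by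
      filter_upwards [hB.mem_nhds ha] with b hb using ih hb
    change partialDeriv w (iteratedPartialDeriv L Φ) a = _
    rw [partialDeriv, h2.fderiv_eq, h1.fderiv, sum_apply]
    simp only [coeffForm_single, List.map_cons, List.sum_cons]
    refine Finset.sum_congr rfl fun ν _ => ?_
    rw [add_comm _ (Pi.single w.1 1), add_comm _ (⇑w.2.1)]

theorem differentiableAt_of_toric {c : Fin N → T → ℂ} {x : Fin N → T → Fin m → ℂ}
    {P : Fin N → κ → ℕ → T → ℂ → ℂ} {Φ : (CoeffIndex supp → ℂ) → ℂ} (hK : IsCompact K)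
    (hB : IsOpen B) (hc : ∀ ν, ContinuousOn (c ν) K) (hx : ∀ ν, ContinuousOn (x ν) K)
    (hP : ∀ ν i n, ContinuousOn (fun y : (CoeffIndex supp → ℂ) × T =>
      P ν i n y.2 (polyVal supp y.1 (x ν y.2) i)) (B ×ˢ K))
    (hP' : ∀ ν, ∀ a ∈ B, ∀ τ ∈ K, ∀ i n, HasDerivAt (P ν i n τ)
      (P ν i (n + 1) τ (polyVal supp a (x ν τ) i)) (polyVal supp a (x ν τ) i))
    (hΦ : ∀ a ∈ B, Φ a = ∑ ν, ∫ τ in K, toricTerm supp (c ν) (x ν) (P ν) 0 0 a τ ∂μ)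
    {a : CoeffIndex supp → ℂ} (ha : a ∈ B) : DifferentiableAt ℂ Φ a := by
  have h1 := HasFDerivAt.fun_sum (u := Finset.univ) fun ν (_ : ν ∈ Finset.univ) =>
    hasFDerivAt_integral_toricTerm (μ := μ) hK hB (hc ν) (hx ν) (hP ν) (hP' ν) 0 0 ha
  refine h1.differentiableAt.congr_of_eventuallyEq ?_
  filter_upwards [hB.mem_nhds ha] with b hb using hΦ b hb

end Toric

theorem sum_exponentVector_eq {κ : Type*} [DecidableEq κ] {m : ℕ}
    {supp : κ → Finset (Fin m →₀ ℕ)} {L L' : List (CoeffIndex supp)}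
    (h : (L.map (exponentVector supp)).sum = (L'.map (exponentVector supp)).sum) :
    (L.map fun w => (Pi.single w.1 1 : κ → ℕ)).sum = (L'.map fun w => Pi.single w.1 1).sum ∧
    (L.map fun w : CoeffIndex supp => (⇑w.2.1 : Fin m → ℕ)).sum = (L'.map fun w : CoeffIndex supp => (⇑w.2.1 : Fin m → ℕ)).sum := by
  have h1 : ∀ (L : List (CoeffIndex supp)) i, (L.map (exponentVector supp)).sum (Sum.inl i) =
      (((L.map fun w => (Pi.single w.1 1 : κ → ℕ)).sum i : ℕ) : ℤ) := by
    intro L i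
    induction L with
    | nil => simp
    | cons w L ih =>
      simp only [List.map_cons, List.sum_cons, Pi.add_apply, ih, exponentVector, Sum.elim_inl]
      by_cases hw : i = w.1 <;> simp [hw]
  have h2 : ∀ (L : List (CoeffIndex supp)) p, (L.map (exponentVector supp)).sum (Sum.inr p) =
      (((L.map fun w : CoeffIndex supp => (⇑w.2.1 : Fin m → ℕ)).sum p : ℕ) : ℤ) := by
    intro L p
    induction L with
    | nil => simp
    | cons w L ih => simp [ih, exponentVector]
  constructor
  · ext i
    have := congrFun h (Sum.inl i)
    rw [h1, h1] at this
    exact_mod_cast this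
  · ext p
    have := congrFun h (Sum.inr p)
    rw [h2, h2] at this
    exact_mod_cast this

/-! ### Homogeneity -/

/-- The Euler equation is the derivative at `s = 0` of the homogeneity relation. Only stationarity
at that point is assumed, which is what the deformation argument supplies. -/
theorem euler_of_eventually_homogeneous {Ω : Type*} [Fintype Ω] [DecidableEq Ω]
    {Φ : (Ω → ℂ) → ℂ} {a : Ω → ℂ} (hΦ : DifferentiableAt ℂ Φ a) {A : Ω → ℤ} {γ : ℂ}
    (h : HasDerivAt (fun s : ℝ => Complex.exp (-(γ * s)) *
      Φ (fun w => Complex.exp (A w * s) * a w)) 0 0) :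
    ∑ w, (A w : ℂ) * a w * partialDeriv w Φ a = γ * Φ a := by
  have h1 : HasDerivAt (fun s : ℝ => fun w => Complex.exp (A w * s) * a w)
      (fun w => A w * a w) 0 := by
    refine hasDerivAt_pi.2 fun w => ?_
    have h2 := (((hasDerivAt_id (0 : ℝ)).ofReal_comp.const_mul (A w : ℂ)).cexp).mul_const (a w)
    simpa using h2
  have h3 : HasDerivAt (fun s : ℝ => Φ (fun w => Complex.exp (A w * s) * a w))
      (fderiv ℂ Φ a (fun w => A w * a w)) 0 := by
    refine HasFDerivAt.comp_hasDerivAt (l := Φ) (f := fun s : ℝ => fun w =>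
      Complex.exp (A w * s) * a w) 0 (l' := (fderiv ℂ Φ a).restrictScalars ℝ) ?_ h1
    simpa using hΦ.hasFDerivAt.restrictScalars ℝ
  have h4 : HasDerivAt (fun s : ℝ => Complex.exp (-(γ * s))) (-γ) 0 := by
    have h2 := ((hasDerivAt_id (0 : ℝ)).ofReal_comp.const_mul γ).neg.cexp
    simpa using h2
  have h5 := h.unique (h4.mul h3)
  have h6 : (fun w => (A w : ℂ) * a w) = ∑ w, ((A w : ℂ) * a w) • Pi.single w (1 : ℂ) := by
    ext w
    simp [Finset.sum_apply, Pi.single_apply]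
  rw [h6, map_sum] at h5
  simp only [map_smul, smul_eq_mul, Complex.ofReal_zero, mul_zero, neg_zero, Complex.exp_zero,
    one_mul] at h5
  simp only [partialDeriv]
  linear_combination -h5

/-! ### The derivatives of the powers -/

open Classical in
/-- The `n`-th derivative of `branchPow s z₀`. -/
def branchPowDeriv (s z₀ : ℂ) (n : ℕ) (z : ℂ) : ℂ :=
  if h : IsNat s then (h.choose.descFactorial n : ℂ) * z ^ (h.choose - n)
  else (∏ i ∈ Finset.range n, (s - i)) * (z₀⁻¹ ^ n * (z / z₀) ^ (s - n))

theorem branchPowDeriv_zero (s z₀ z : ℂ) : branchPowDeriv s z₀ 0 z = branchPow s z₀ z := by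
  by_cases h : IsNat s
  · rw [branchPow_of_isNat h, branchPowDeriv, dif_pos h]
    conv_rhs => rw [h.choose_spec]
    simp
  · rw [branchPow_of_not_isNat h, branchPowDeriv, dif_neg h]
    simp

theorem hasDerivAt_branchPowDeriv {s z₀ z : ℂ} (n : ℕ)
    (hz : ¬ IsNat s → z / z₀ ∈ Complex.slitPlane) :
    HasDerivAt (branchPowDeriv s z₀ n) (branchPowDeriv s z₀ (n + 1) z) z := by
  by_cases h : IsNat s
  · have h1 : branchPowDeriv s z₀ n = fun z =>
        (h.choose.descFactorial n : ℂ) * z ^ (h.choose - n) := by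
      ext z
      rw [branchPowDeriv, dif_pos h]
    rw [h1, branchPowDeriv, dif_pos h]
    convert! (hasDerivAt_pow (h.choose - n) z).const_mul (h.choose.descFactorial n : ℂ) using 1
    -- The truncated subtractions are consistent: once the order reaches the exponent, the factor of
    -- the new derivative is zero on both sides.
    rw [Nat.descFactorial_succ, Nat.sub_sub]
    push_cast
    ring
  · have h1 : branchPowDeriv s z₀ n = fun z =>
        (∏ i ∈ Finset.range n, (s - i)) * (z₀⁻¹ ^ n * (z / z₀) ^ (s - n)) := by
      ext z
      rw [branchPowDeriv, dif_neg h]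
    rw [h1, branchPowDeriv, dif_neg h]
    have h2 := (((hasDerivAt_id z).div_const z₀).cpow_const (c := s - n) (hz h))
    convert! (h2.const_mul (z₀⁻¹ ^ n)).const_mul (∏ i ∈ Finset.range n, (s - i)) using 1
    rw [Finset.prod_range_succ]
    push_cast
    rw [sub_add_eq_sub_sub]
    simp only [id]
    ring

theorem continuousWithinAt_branchPowDeriv {Y : Type*} [TopologicalSpace Y] {D : Set Y} {y : Y}
    {s : ℂ} {f g : Y → ℂ} (n : ℕ) (hf : ContinuousWithinAt f D y) (hg : ContinuousWithinAt g D y)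
    (h : ¬ IsNat s → g y / f y ∈ Complex.slitPlane) :
    ContinuousWithinAt (fun y => branchPowDeriv s (f y) n (g y)) D y := by
  by_cases hs : IsNat s
  · simp only [branchPowDeriv, dif_pos hs]
    exact continuousWithinAt_const.mul (hg.pow _)
  · simp only [branchPowDeriv, dif_neg hs]
    have h1 := h hs
    have hf0 : f y ≠ 0 := fun h0 => by simp [h0] at h1
    exact continuousWithinAt_const.mul
      (((hf.inv₀ hf0).pow n).mul ((hg.div hf hf0).cpow continuousWithinAt_const h1))

/-- The `n`-th derivative of `z ↦ z⁻¹`. -/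
def invDeriv (n : ℕ) (z : ℂ) : ℂ := (-1) ^ n * n.factorial * z⁻¹ ^ (n + 1)

theorem hasDerivAt_invDeriv {z : ℂ} (n : ℕ) (hz : z ≠ 0) :
    HasDerivAt (invDeriv n) (invDeriv (n + 1) z) z := by
  unfold invDeriv
  convert! ((hasDerivAt_inv hz).pow (n + 1)).const_mul ((-1) ^ n * (n.factorial : ℂ)) using 1
  rw [Nat.factorial_succ]
  push_cast
  ring

/-! ### The integral as a sum of integrals of toric terms. -/

section Local

variable {l r k N : ℕ} {supp : Fin l ⊕ Fin r → Finset (Fin (r + k) →₀ ℕ)}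
  {O : Set ((Fin (r + k) → ℂ) × (CoeffIndex supp → ℂ) × (Fin r → ℂ))}
  {Ψ : (Fin (r + k) → ℂ) × (CoeffIndex supp → ℂ) × (Fin r → ℂ) → Fin (r + k) → ℂ}
  {C : TwistedChain supp N} {lam : Fin l → ℂ} {β : Fin (r + k) → ℂ}
  {U : Set (CoeffIndex supp → ℂ)} {a₀ : CoeffIndex supp → ℂ} {ε δ : ℝ}

theorem factor_inl (a : CoeffIndex supp → ℂ) (x : Fin (r + k) → ℂ) (j : Fin l) :
    factor supp a x (Sum.inl j) = polyVal supp a x (Sum.inl j) := (polyVal_def ..).symm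

/-- The powers of the coordinates do not involve the coefficients; they are separated so that they
can be absorbed into the factor `c` of `toricTerm`. -/
theorem weight_eq (a : CoeffIndex supp → ℂ) (ref : Fin l ⊕ Fin (r + k) → ℂ)
    (x : Fin (r + k) → ℂ) : weight supp lam β a ref x =
      (∏ p, branchPow (β p - 1) (ref (Sum.inr p)) (x p)) *
      ((∏ j, branchPow (lam j) (ref (Sum.inl j)) (polyVal supp a x (Sum.inl j))) *
      ∏ e, (polyVal supp a x (Sum.inr e))⁻¹) := by
  unfold weight
  rw [Fintype.prod_sum_type]
  simp only [factor_inl, factorExponent, Sum.elim_inl, Sum.elim_inr]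
  simp only [factor, Sum.elim_inr]
  ring

theorem IsGoodRadius.contDiff_tube (h : IsGoodRadius C lam β U O Ψ a₀ ε δ)
    (hΨ : IsTube supp O Ψ) (hC : C.IsCycleOn lam β U) (i : Fin N) :
    ContDiff ℝ ∞ fun z : (Fin k → ℝ) × (Fin r → ℝ) =>
      Ψ (C.cube i a₀ (cubeParam z.1), a₀, ε • circ z.2) := by
  have ha₀ : a₀ ∈ Metric.ball a₀ δ := Metric.mem_ball_self h.pos'
  refine contDiff_iff_contDiffAt.2 fun z => ?_
  refine ContDiffAt.comp (g := Ψ) (f := fun z : (Fin k → ℝ) × (Fin r → ℝ) =>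
    (C.cube i a₀ (cubeParam z.1), a₀, ε • circ z.2)) z
    (hΨ.contDiffAt (h.mem_tube ha₀ i (right_mem_Icc.2 h.pos.le) z.1 z.2)) ?_
  refine ContDiffAt.prodMk ?_ (contDiffAt_const.prodMk ?_)
  · exact ((h.contDiff_cube hC ha₀ i).comp contDiff_fst).contDiffAt
  · exact (((contDiff_circ r).comp contDiff_snd).const_smul ε).contDiffAt

/-- Near `a₀`, the Gelfand-Leray integral is an integral of a product of powers of polynomials over
a domain that does not depend on the coefficients. -/
theorem IsGoodRadius.exists_toric (h : IsGoodRadius C lam β U O Ψ a₀ ε δ) (hΨ : IsTube supp O Ψ)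
    (hC : C.IsCycleOn lam β U) :
    ∃ (c : Fin N → (Fin k → ℝ) × (Fin r → ℝ) → ℂ)
      (x : Fin N → (Fin k → ℝ) × (Fin r → ℝ) → Fin (r + k) → ℂ)
      (P : Fin N → Fin l ⊕ Fin r → ℕ → (Fin k → ℝ) × (Fin r → ℝ) → ℂ → ℂ),
      (∀ ν, ContinuousOn (c ν) (unitCube k ×ˢ unitCube r)) ∧
      (∀ ν, ContinuousOn (x ν) (unitCube k ×ˢ unitCube r)) ∧
      (∀ ν i n, ContinuousOn (fun y : (CoeffIndex supp → ℂ) × (Fin k → ℝ) × (Fin r → ℝ) =>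
        P ν i n y.2 (polyVal supp y.1 (x ν y.2) i))
        (Metric.ball a₀ δ ×ˢ (unitCube k ×ˢ unitCube r))) ∧
      (∀ ν, ∀ a ∈ Metric.ball a₀ δ, ∀ τ ∈ unitCube k ×ˢ unitCube r, ∀ i n,
        HasDerivAt (P ν i n τ) (P ν i (n + 1) τ (polyVal supp a (x ν τ) i))
          (polyVal supp a (x ν τ) i)) ∧
      ∀ a ∈ Metric.ball a₀ δ, C.integral lam β a =
        ∑ ν, ∫ τ in unitCube k ×ˢ unitCube r, toricTerm supp (c ν) (x ν) (P ν) 0 0 a τ := by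
  have ha₀ : a₀ ∈ Metric.ball a₀ δ := Metric.mem_ball_self h.pos'
  let x : Fin N → (Fin k → ℝ) × (Fin r → ℝ) → Fin (r + k) → ℂ := fun ν z =>
    Ψ (C.cube ν a₀ (cubeParam z.1), a₀, ε • circ z.2)
  have hx : ∀ ν, ContDiff ℝ ∞ (x ν) := h.contDiff_tube hΨ hC
  have hcube : ∀ ν, Continuous fun z : (Fin k → ℝ) × (Fin r → ℝ) => C.cube ν a₀ (cubeParam z.1) :=
    fun ν => (h.contDiff_cube hC ha₀ ν).continuous.comp continuous_fst
  have hslit : ∀ ν, ∀ a ∈ Metric.ball a₀ δ, ∀ z : (Fin k → ℝ) × (Fin r → ℝ), ∀ q,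
      ¬ IsNat (factorExponent lam β q) → factor supp a (x ν z) q /
        factor supp a₀ (C.cube ν a₀ (cubeParam z.1)) q ∈ Complex.slitPlane := fun ν a ha z =>
    h.slit a ha a₀ ha₀ ν z.1 _ fun e => (norm_smul_circ h.pos.le z.2 e).le
  have hpoly : ∀ ν i, Continuous fun y : (CoeffIndex supp → ℂ) × (Fin k → ℝ) × (Fin r → ℝ) =>
      polyVal supp y.1 (x ν y.2) i := fun ν i => continuous_iff_continuousAt.2 fun y =>
    continuousAt_polyVal_comp continuousAt_fst
      ((hx ν).continuous.comp continuous_snd).continuousAt i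
  have hne : ∀ ν, ∀ a ∈ Metric.ball a₀ δ, ∀ z : (Fin k → ℝ) × (Fin r → ℝ), ∀ e,
      polyVal supp a (x ν z) (Sum.inr e) ≠ 0 := fun ν a ha z =>
    h.ne_zero a ha a₀ ha₀ ν z.1 _ fun e => norm_smul_circ h.pos.le z.2 e
  -- Everything independent of `a` goes into `c`: Leray's constant, the section, the coordinate
  -- powers and the Jacobian. The functions applied to the `f_i` are the powers with exponent `lam
  -- j` and the inverses, along with their derivatives.
  refine ⟨fun ν z => ((2 * Real.pi * Complex.I) ^ r)⁻¹ * (C.sect ν a₀ (cubeParam z.1) *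
    (∏ p, branchPow (β p - 1) (C.cube ν a₀ (cubeParam z.1) p) (x ν z p)) *
    volumeForm r k fun j => fderiv ℝ (x ν) z (cubeDir r k j)), x,
    fun ν => Sum.elim (fun j n z => branchPowDeriv (lam j)
      (factor supp a₀ (C.cube ν a₀ (cubeParam z.1)) (Sum.inl j)) n) (fun e n z => invDeriv n),
    ?_, fun ν => (hx ν).continuous.continuousOn, ?_, ?_, ?_⟩
  · intro ν
    refine continuousOn_const.mul ((ContinuousOn.mul ?_ ?_).mul ?_)
    · refine (hC.horizontal ν).continuousOn.comp
        (f := fun z : (Fin k → ℝ) × (Fin r → ℝ) => (a₀, cubeParam z.1)) ?_ ?_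
      · exact (continuous_const.prodMk
          ((contDiff_cubeParam k).continuous.comp continuous_fst)).continuousOn
      · exact fun z _ => ⟨h.subset ha₀, cubeParam_mem _⟩
    · refine continuousOn_finsetProd _ fun p _ z _ => ?_
      exact continuousWithinAt_branchPow ((continuous_apply p).comp (hcube ν)).continuousWithinAt
        ((continuous_apply p).comp (hx ν).continuous).continuousWithinAt
        (hslit ν a₀ ha₀ z (Sum.inr p))
    · refine Continuous.continuousOn ((volumeCMM r k).cont.comp (continuous_pi fun j => ?_))
      exact ((hx ν).continuous_fderiv (by simp)).clm_apply continuous_const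
  · rintro ν (j | e) n
    · rintro ⟨a, z⟩ ⟨ha, -⟩
      refine continuousWithinAt_branchPowDeriv n (f := fun y : (CoeffIndex supp → ℂ) ×
        (Fin k → ℝ) × (Fin r → ℝ) => factor supp a₀ (C.cube ν a₀ (cubeParam y.2.1)) (Sum.inl j))
        ?_ (hpoly ν _).continuousWithinAt fun hj => ?_
      · exact ((contDiff_factor_right supp a₀ _).continuous.comp
          ((hcube ν).comp continuous_snd)).continuousWithinAt
      · simpa only [factor_inl] using hslit ν a ha z (Sum.inl j) hj
    · refine continuousOn_const.mul (ContinuousOn.pow ?_ _)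
      exact (hpoly ν _).continuousOn.inv₀ fun y hy => hne ν y.1 hy.1 y.2 e
  · rintro ν a ha z - (j | e) n
    · refine hasDerivAt_branchPowDeriv n fun hj => ?_
      simpa only [factor_inl] using hslit ν a ha z (Sum.inl j) hj
    · exact hasDerivAt_invDeriv n (hne ν a ha z e)
  · intro a ha
    rw [h.integral_eq hΨ hC ha, TwistedChain.tubeIntegral, Finset.mul_sum]
    refine Finset.sum_congr rfl fun ν _ => ?_
    rw [← integral_const_mul]
    congr 1
    ext z
    rw [weight_eq, toricTerm, Fintype.prod_sum_type]
    simp only [Sum.elim_inl, Sum.elim_inr, Pi.zero_apply, branchPowDeriv_zero, invDeriv, pow_zero,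
      Finset.prod_const_one, Nat.factorial_zero, Nat.cast_one, zero_add, pow_one, mul_one, one_mul]
    simp only [factor, Sum.elim_inr, x]
    ring

end Local

/-! ### Homogeneity of the integral over a tube -/

theorem ofReal_exp_cpow (s : ℝ) (γ : ℂ) : ((Real.exp s : ℝ) : ℂ) ^ γ = Complex.exp (γ * s) := by
  rw [Complex.cpow_def_of_ne_zero (by exact_mod_cast (Real.exp_pos s).ne'), ← Complex.ofReal_log
    (Real.exp_pos s).le, Real.log_exp, mul_comm]

theorem ofReal_mul_mem_slitPlane {c : ℝ} (hc : 0 < c) {z : ℂ} (hz : z ∈ Complex.slitPlane) :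
    (c : ℂ) * z ∈ Complex.slitPlane := by
  rw [Complex.mem_slitPlane_iff] at hz ⊢
  rw [Complex.re_ofReal_mul, Complex.im_ofReal_mul]
  exact hz.imp (mul_pos hc) (mul_ne_zero hc.ne')

section TorusAction

variable {κ : Type*} [DecidableEq κ] {m : ℕ} {supp : κ → Finset (Fin m →₀ ℕ)}

/-- The one-parameter group of dilations of the coefficients that belongs to an Euler equation. -/
def dilateCoeff (q : κ ⊕ Fin m) (s : ℝ) (a : CoeffIndex supp → ℂ) : CoeffIndex supp → ℂ :=
  fun w => Complex.exp (exponentVector supp w q * s) * a w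

theorem dilateCoeff_zero (q : κ ⊕ Fin m) (a : CoeffIndex supp → ℂ) : dilateCoeff q 0 a = a := by
  ext w
  simp [dilateCoeff]

theorem continuous_dilateCoeff (q : κ ⊕ Fin m) (a : CoeffIndex supp → ℂ) :
    Continuous fun s => dilateCoeff q s a := by
  unfold dilateCoeff
  fun_prop

theorem polyVal_dilateCoeff_inl (i₀ : κ) (s : ℝ) (a : CoeffIndex supp → ℂ) (x : Fin m → ℂ) (i : κ) :
    polyVal supp (dilateCoeff (Sum.inl i₀) s a) x i =
      (if i = i₀ then Real.exp s else 1 : ℝ) * polyVal supp a x i := by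
  simp only [polyVal_eq_sum, dilateCoeff, exponentVector, Sum.elim_inl, Finset.mul_sum]
  refine Finset.sum_congr rfl fun j _ => ?_
  by_cases h : i = i₀
  · subst h
    simp [mul_assoc]
  · simp [h, Ne.symm h]

/-- The dilation of one coordinate. -/
def dilate (p : Fin m) (s : ℝ) (x : Fin m → ℂ) : Fin m → ℂ :=
  fun q => (if q = p then Real.exp s else 1 : ℝ) • x q

theorem contDiff_dilate (p : Fin m) :
    ContDiff ℝ ∞ fun y : ℝ × (Fin m → ℂ) => dilate p y.1 y.2 := by
  refine contDiff_pi.2 fun q => ?_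
  by_cases h : q = p
  · simp only [dilate, h, if_true]
    fun_prop
  · simp only [dilate, h, if_false]
    fun_prop

/-- `dilate` as a continuous linear map. -/
def dilateCLM (p : Fin m) (s : ℝ) : (Fin m → ℂ) →L[ℝ] (Fin m → ℂ) :=
  ContinuousLinearMap.pi fun q =>
    (if q = p then Real.exp s else 1 : ℝ) • ContinuousLinearMap.proj (R := ℝ) q

theorem dilateCLM_apply (p : Fin m) (s : ℝ) (x : Fin m → ℂ) : dilateCLM p s x = dilate p s x := by
  rfl

/-- In the monomial `a_{ij} x^j` the factor `e^{s j_p}` may be attached to the coefficient or to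
`x_p`. This turns a scaling of the coefficients into a motion of the tube. -/
theorem polyVal_dilateCoeff_inr (p : Fin m) (s : ℝ) (a : CoeffIndex supp → ℂ) (x : Fin m → ℂ)
    (i : κ) : polyVal supp (dilateCoeff (Sum.inr p) s a) x i =
      polyVal supp a (dilate p s x) i := by
  simp only [polyVal_eq_sum, dilateCoeff, exponentVector, Sum.elim_inr, dilate]
  refine Finset.sum_congr rfl fun j _ => ?_
  have h1 : ∏ q, ((if q = p then Real.exp s else 1 : ℝ) • x q) ^ (j.1 q) =
      Complex.exp ((j.1 p : ℤ) * s) * ∏ q, x q ^ (j.1 q) := by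
    simp only [Complex.real_smul, mul_pow, Finset.prod_mul_distrib]
    congr 1
    rw [Fintype.prod_eq_single p fun q hq => by simp [hq]]
    rw [if_pos rfl, Int.cast_natCast, Complex.exp_nat_mul, Complex.ofReal_exp]
  rw [h1]
  ring

theorem volumeForm_dilate {r k : ℕ} (p : Fin (r + k)) (s : ℝ)
    (v : Fin r ⊕ Fin k → Fin (r + k) → ℂ) :
    volumeForm r k (fun j => dilate p s (v j)) = (Real.exp s : ℝ) * volumeForm r k v := by
  rw [volumeForm_apply, volumeForm_apply]
  have h1 := Matrix.det_mul_row (fun q : Fin (r + k) =>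
    (((if q = p then Real.exp s else 1 : ℝ)) : ℂ)) (Matrix.of fun i => v (finSumFinEquiv.symm i))
  have h2 : ∏ q : Fin (r + k), (((if q = p then Real.exp s else 1 : ℝ)) : ℂ) =
      (Real.exp s : ℝ) := by
    rw [Fintype.prod_eq_single p fun q hq => by simp [hq]]
    simp
  rw [h2] at h1
  rw [← h1]
  rfl

end TorusAction

/-! ### The Euler equations and the `A`-hypergeometric system. -/

section Euler

variable {l r k N : ℕ} {supp : Fin l ⊕ Fin r → Finset (Fin (r + k) →₀ ℕ)}
  {O : Set ((Fin (r + k) → ℂ) × (CoeffIndex supp → ℂ) × (Fin r → ℂ))}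
  {Ψ : (Fin (r + k) → ℂ) × (CoeffIndex supp → ℂ) × (Fin r → ℂ) → Fin (r + k) → ℂ}
  {C : TwistedChain supp N} {lam : Fin l → ℂ} {β : Fin (r + k) → ℂ}
  {U : Set (CoeffIndex supp → ℂ)} {a₀ : CoeffIndex supp → ℂ} {ε δ : ℝ}

theorem weight_dilateCoeff_inl (i₀ : Fin l ⊕ Fin r) (s : ℝ) (a : CoeffIndex supp → ℂ)
    (ref : Fin l ⊕ Fin (r + k) → ℂ) (x : Fin (r + k) → ℂ) :
    weight supp lam β (dilateCoeff (Sum.inl i₀) s a) ref x =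
      Complex.exp (Sum.elim lam (fun _ => -1) i₀ * s) * weight supp lam β a ref x := by
  have hpos : ∀ i, 0 < (if i = i₀ then Real.exp s else 1) := fun i => by
    split_ifs
    · exact Real.exp_pos s
    · exact one_pos
  simp only [weight_eq, polyVal_dilateCoeff_inl, branchPow_ofReal_mul _ _ _ (hpos _), mul_inv,
    Finset.prod_mul_distrib]
  have h1 : (∏ j, ((if Sum.inl j = i₀ then Real.exp s else 1 : ℝ) : ℂ) ^ lam j) *
      ∏ e, (((if Sum.inr e = i₀ then Real.exp s else 1 : ℝ) : ℂ))⁻¹ =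
      Complex.exp (Sum.elim lam (fun _ => -1) i₀ * s) := by
    rcases i₀ with j₀ | e₀
    · rw [Fintype.prod_eq_single j₀ fun j hj => by simp [hj]]
      simp only [if_true, ofReal_exp_cpow]
      simp
    · rw [Fintype.prod_eq_single (a := e₀) (f := fun e =>
        (((if (Sum.inr e : Fin l ⊕ Fin r) = Sum.inr e₀ then Real.exp s else 1 : ℝ) : ℂ))⁻¹)
        fun e he => by simp [he]]
      simp [Complex.exp_neg]
  rw [← h1]
  ring

theorem weight_dilate (p : Fin (r + k)) (s : ℝ) (a : CoeffIndex supp → ℂ)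
    (ref : Fin l ⊕ Fin (r + k) → ℂ) (x : Fin (r + k) → ℂ) :
    weight supp lam β a ref (dilate p s x) =
      Complex.exp ((β p - 1) * s) * weight supp lam β (dilateCoeff (Sum.inr p) s a) ref x := by
  have hpos : ∀ q, 0 < (if q = p then Real.exp s else 1) := fun i => by
    split_ifs
    · exact Real.exp_pos s
    · exact one_pos
  simp only [weight_eq, polyVal_dilateCoeff_inr]
  have h1 : ∏ q, branchPow (β q - 1) (ref (Sum.inr q)) (dilate p s x q) =
      Complex.exp ((β p - 1) * s) * ∏ q, branchPow (β q - 1) (ref (Sum.inr q)) (x q) := by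
    simp only [dilate, Complex.real_smul, branchPow_ofReal_mul _ _ _ (hpos _),
      Finset.prod_mul_distrib]
    congr 1
    rw [Fintype.prod_eq_single p fun q hq => by simp [hq], if_pos rfl, ofReal_exp_cpow]
  rw [h1]
  ring

theorem TwistedChain.tubeIntegral_dilateCoeff_inl (i₀ : Fin l ⊕ Fin r) (s : ℝ)
    (a : CoeffIndex supp → ℂ) :
    C.tubeIntegral lam β Ψ (dilateCoeff (Sum.inl i₀) s a) a₀ ε =
      Complex.exp (Sum.elim lam (fun _ => -1) i₀ * s) * C.tubeIntegral lam β Ψ a a₀ ε := by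
  unfold tubeIntegral
  rw [Finset.mul_sum]
  refine Finset.sum_congr rfl fun ν _ => ?_
  rw [← integral_const_mul]
  congr 1
  ext z
  rw [weight_dilateCoeff_inl]
  ring

/-- Up to the factor `e^{β_p s}`, the integral of the rescaled form over the fixed tube is the
integral of the original form over the tube dilated in `x_p`. The latter is stationary under
deformation. -/
theorem IsGoodRadius.hasDerivAt_tubeIntegral_dilateCoeff_inr
    (h : IsGoodRadius C lam β U O Ψ a₀ ε δ) (hΨ : IsTube supp O Ψ) (hC : C.IsCycleOn lam β U)
    (p : Fin (r + k)) :
    HasDerivAt (fun s : ℝ => Complex.exp (β p * s) *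
      C.tubeIntegral lam β Ψ (dilateCoeff (Sum.inr p) s a₀) a₀ ε) 0 0 := by
  have ha₀ : a₀ ∈ Metric.ball a₀ δ := Metric.mem_ball_self h.pos'
  let I : Set ℝ := (fun s => dilateCoeff (Sum.inr p) s a₀) ⁻¹' Metric.ball a₀ δ
  have hI : IsOpen I := Metric.isOpen_ball.preimage (continuous_dilateCoeff _ _)
  have h0 : (0 : ℝ) ∈ I := by
    change dilateCoeff (Sum.inr p) 0 a₀ ∈ Metric.ball a₀ δ
    rwa [dilateCoeff_zero]
  have hJ := hasDerivAt_sweep_integral (lam := lam) (β := β) hC a₀ hI (b := fun _ => a₀)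
    (Θ := fun y => dilate p y.1 (Ψ (y.2.1, a₀, ε • circ y.2.2))) (fun s _ => contDiffAt_const)
    (fun s _ => h.subset ha₀) ?_ ?_ ?_ h0
  · refine hJ.congr_of_eventuallyEq (Eventually.of_forall fun s => ?_)
    simp only [TwistedChain.tubeIntegral]
    rw [Finset.mul_sum]
    refine Finset.sum_congr rfl fun i _ => ?_
    rw [← integral_const_mul]
    congr 1
    ext z
    have hd : (fun j => fderiv ℝ (fun z : (Fin k → ℝ) × (Fin r → ℝ) =>
        sweep C (fun _ => a₀) (fun y => dilate p y.1 (Ψ (y.2.1, a₀, ε • circ y.2.2))) i (s, z)) z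
        (cubeDir r k j)) = fun j => dilate p s (fderiv ℝ (fun z : (Fin k → ℝ) × (Fin r → ℝ) =>
          Ψ (C.cube i a₀ (cubeParam z.1), a₀, ε • circ z.2)) z (cubeDir r k j)) := by
      ext1 j
      have h1 := (dilateCLM p s).hasFDerivAt.comp z
        ((h.contDiff_tube hΨ hC i).differentiable (by simp) z).hasFDerivAt
      have h2 : (⇑(dilateCLM p s) ∘ fun z : (Fin k → ℝ) × (Fin r → ℝ) =>
          Ψ (C.cube i a₀ (cubeParam z.1), a₀, ε • circ z.2)) = fun z =>
          sweep C (fun _ => a₀) (fun y => dilate p y.1 (Ψ (y.2.1, a₀, ε • circ y.2.2))) i (s, z) :=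
        funext fun z => dilateCLM_apply _ _ _
      rw [← h2, h1.fderiv, ContinuousLinearMap.comp_apply, dilateCLM_apply]
    rw [hd, volumeForm_dilate, sweepWeight]
    simp only [sweep]
    rw [weight_dilate]
    -- The power `x_p^{β_p - 1}` scales with exponent `β_p - 1`, and the volume form supplies the
    -- missing `1`.
    have h3 : Complex.exp (β p * s) = Complex.exp ((β p - 1) * s) * (Real.exp s : ℝ) := by
      rw [Complex.ofReal_exp, ← Complex.exp_add]
      congr 1
      ring
    rw [h3]
    ring
  · intro s hs i t θ
    refine ContDiffAt.comp (g := fun y : ℝ × (Fin (r + k) → ℂ) => dilate p y.1 y.2)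
      (f := fun y : ℝ × (Fin (r + k) → ℂ) × (Fin r → ℝ) =>
        (y.1, Ψ (y.2.1, a₀, ε • circ y.2.2))) _ (contDiff_dilate p).contDiffAt
      (contDiffAt_fst.prodMk ?_)
    exact contDiffAt_tube_param hΨ (b := fun _ => a₀) contDiffAt_const (ρ := fun _ => ε)
      contDiffAt_const (h.mem_tube ha₀ i (right_mem_Icc.2 h.pos.le) t θ)
  · intro s x θ e
    simp only [circ_add_single]
  · intro s hs i t θ
    have hn : ∀ e, ‖(ε • circ θ) e‖ = ε := norm_smul_circ h.pos.le θ
    refine ⟨?_, fun e => ?_⟩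
    -- A polynomial at the dilated point equals the rescaled polynomial at the old point, whose
    -- coefficients stay in the ball; a coordinate is only multiplied by a positive real, which
    -- preserves the slit plane.
    · rintro (j | q) hq
      · have h1 := h.slit _ hs a₀ ha₀ i t _ (fun e => (hn e).le) (Sum.inl j) hq
        rwa [factor_inl, polyVal_dilateCoeff_inr, ← factor_inl] at h1
      · have h1 := h.slit _ ha₀ a₀ ha₀ i t _ (fun e => (hn e).le) (Sum.inr q) hq
        simp only [factor, Sum.elim_inr, dilate, Complex.real_smul] at h1 ⊢
        rw [mul_div_assoc]
        refine ofReal_mul_mem_slitPlane ?_ h1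
        split_ifs
        · exact Real.exp_pos s
        · exact one_pos
    · rw [← polyVal_dilateCoeff_inr]
      exact h.ne_zero _ hs a₀ ha₀ i t _ hn e

theorem IsGoodRadius.hasDerivAt_tubeIntegral_dilateCoeff
    (h : IsGoodRadius C lam β U O Ψ a₀ ε δ) (hΨ : IsTube supp O Ψ) (hC : C.IsCycleOn lam β U)
    (q : (Fin l ⊕ Fin r) ⊕ Fin (r + k)) :
    HasDerivAt (fun s : ℝ => Complex.exp (-(hypergeometricExponents lam β q * s)) *
      C.tubeIntegral lam β Ψ (dilateCoeff q s a₀) a₀ ε) 0 0 := by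
  rcases q with i₀ | p
  · have h1 : (fun s : ℝ => Complex.exp (-(hypergeometricExponents lam β (Sum.inl i₀) * s)) *
        C.tubeIntegral lam β Ψ (dilateCoeff (Sum.inl i₀) s a₀) a₀ ε) =
        fun _ => C.tubeIntegral lam β Ψ a₀ a₀ ε := by
      ext s
      rw [TwistedChain.tubeIntegral_dilateCoeff_inl, ← mul_assoc, ← Complex.exp_add]
      simp [hypergeometricExponents]
    rw [h1]
    exact hasDerivAt_const _ _
  · simpa [hypergeometricExponents] using h.hasDerivAt_tubeIntegral_dilateCoeff_inr hΨ hC p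

/-- The Gelfand-Leray integral is an `A`-hypergeometric function of the coefficients. -/
theorem TwistedChain.IsCycleOn.isAHypergeometricOn (hC : C.IsCycleOn lam β U) (hU : IsOpen U) :
    IsAHypergeometricOn (exponentVector supp) (hypergeometricExponents lam β) U
      (C.integral lam β) := by
  have hgood : ∀ a₀ ∈ U, ∃ O Ψ ε δ, IsTube supp O Ψ ∧ IsGoodRadius C lam β U O Ψ a₀ ε δ := by
    intro a₀ ha₀
    obtain ⟨O, Ψ, hΨ, hO⟩ := hC.exists_isTube ha₀
    obtain ⟨ε, δ, h⟩ := (eventually_isGoodRadius hΨ hC hU ha₀ hO).exists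
    exact ⟨O, Ψ, ε, δ, hΨ, h⟩
  have hbox : IsCompact (unitCube k ×ˢ unitCube r) :=
    (isCompact_unitCube k).prod (isCompact_unitCube r)
  have hdiff : ∀ a ∈ U, DifferentiableAt ℂ (C.integral lam β) a := by
    intro a ha
    obtain ⟨O, Ψ, ε, δ, hΨ, h⟩ := hgood a ha
    obtain ⟨c, x, P, hc, hx, hP, hP', hΦ⟩ := h.exists_toric hΨ hC
    exact differentiableAt_of_toric hbox Metric.isOpen_ball hc hx hP hP' hΦ
      (Metric.mem_ball_self h.pos')
  refine ⟨fun a ha => (hdiff a ha).differentiableWithinAt, ?_, ?_⟩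
  · intro L L' hL a ha
    obtain ⟨O, Ψ, ε, δ, hΨ, h⟩ := hgood a ha
    obtain ⟨c, x, P, hc, hx, hP, hP', hΦ⟩ := h.exists_toric hΨ hC
    rw [iteratedPartialDeriv_eq_toric hbox Metric.isOpen_ball hc hx hP hP' hΦ L
      (Metric.mem_ball_self h.pos'), iteratedPartialDeriv_eq_toric hbox Metric.isOpen_ball hc hx hP
      hP' hΦ L' (Metric.mem_ball_self h.pos'), (sum_exponentVector_eq hL).1,
      (sum_exponentVector_eq hL).2]
  · intro q a ha
    obtain ⟨O, Ψ, ε, δ, hΨ, h⟩ := hgood a ha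
    refine euler_of_eventually_homogeneous (A := fun w => exponentVector supp w q) (hdiff a ha) ?_
    have h1 := (h.hasDerivAt_tubeIntegral_dilateCoeff hΨ hC q).const_mul
      ((2 * Real.pi * Complex.I) ^ r)⁻¹
    rw [mul_zero] at h1
    refine h1.congr_of_eventuallyEq ?_
    have h2 : ∀ᶠ s : ℝ in 𝓝 0, dilateCoeff q s a ∈ Metric.ball a δ := by
      refine (continuous_dilateCoeff q a).continuousAt.eventually_mem (Metric.isOpen_ball.mem_nhds ?_)
      rw [dilateCoeff_zero]
      exact Metric.mem_ball_self h.pos'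
    filter_upwards [h2] with s hs
    have h3 := h.integral_eq hΨ hC hs
    change _ * C.integral lam β (dilateCoeff q s a) = _
    rw [h3]
    ring

end Euler

/-! ### Continuation of cycles -/

theorem face_mem_unitCube {k : ℕ} (j : Fin (k + 1)) (ε : Fin 2) {s : Fin k → ℝ}
    (hs : s ∈ unitCube k) : face j ε s ∈ unitCube (k + 1) := by
  obtain ⟨t, -, rfl⟩ := exists_cubeParam_eq hs
  rw [← cubeParam_face]
  exact cubeParam_mem _

/-- Points and sections are moved by functions `R a` and `χ a` of the point alone, so coinciding
faces stay together and degenerate ones stay degenerate. Conversely, coincidence over `S` can be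
read off at `a₀`. The boundary sums thus have the same terms, multiplied by a common factor. -/
theorem IsClosedOn.of_deformation {P E : Type*} {k N : ℕ} {a₀ : P} {S : Set P} (ha₀ : a₀ ∈ S)
    {σ₀ σ : Fin N → P → (Fin k → ℝ) → E} {g₀ g : Fin N → P → (Fin k → ℝ) → ℂ} (R : P → E → E)
    (χ : P → E → ℂ) (hσ : ∀ i a t, σ i a t = R a (σ₀ i a₀ t))
    (hg : ∀ i a t, g i a t = g₀ i a₀ t * χ a (σ₀ i a₀ t))
    (h0 : ∀ i, ∀ t ∈ unitCube k, σ i a₀ t = σ₀ i a₀ t) (h : IsClosedOn {a₀} σ₀ g₀) :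
    IsClosedOn S σ g := by
  obtain _ | k := k
  · trivial
  intro F₀ hF₀ a ha s hs
  have hnd : ¬ IsDegenerateOn {a₀} (fun a s => σ₀ F₀.1 a (face F₀.2.1 F₀.2.2 s)) := by
    rintro ⟨q, hq⟩
    refine hF₀ ⟨q, fun a _ s hs u hu => ?_⟩
    have h1 : σ₀ F₀.1 a₀ (face F₀.2.1 F₀.2.2 (Function.update s q u)) =
      σ₀ F₀.1 a₀ (face F₀.2.1 F₀.2.2 s) := hq a₀ rfl s hs u hu
    simp only [hσ, h1]
  have hsame : ∀ F : Fin N × Fin (k + 1) × Fin 2,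
      SameOn S (fun a s => σ F.1 a (face F.2.1 F.2.2 s))
        (fun a s => σ F₀.1 a (face F₀.2.1 F₀.2.2 s)) ↔
      SameOn {a₀} (fun a s => σ₀ F.1 a (face F.2.1 F.2.2 s))
        (fun a s => σ₀ F₀.1 a (face F₀.2.1 F₀.2.2 s)) := by
    intro F
    constructor
    · rintro hF _ rfl s hs
      have h1 := hF _ ha₀ s hs
      simp only at h1 ⊢
      rwa [h0 _ _ (face_mem_unitCube _ _ hs), h0 _ _ (face_mem_unitCube _ _ hs)] at h1
    · intro hF a _ s hs
      have h1 : σ₀ F.1 a₀ (face F.2.1 F.2.2 s) = σ₀ F₀.1 a₀ (face F₀.2.1 F₀.2.2 s) := hF a₀ rfl s hs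
      simp only [hσ, h1]
  have h1 := congrArg (· * χ a (σ₀ F₀.1 a₀ (face F₀.2.1 F₀.2.2 s))) (h F₀ hnd a₀ rfl s hs)
  simp only [zero_mul, Finset.sum_mul] at h1
  refine Eq.trans (Finset.sum_congr rfl fun F _ => ?_) h1
  by_cases hF : SameOn {a₀} (fun a s => σ₀ F.1 a (face F.2.1 F.2.2 s))
      (fun a s => σ₀ F₀.1 a (face F₀.2.1 F₀.2.2 s))
  · have h2 : σ₀ F.1 a₀ (face F.2.1 F.2.2 s) = σ₀ F₀.1 a₀ (face F₀.2.1 F₀.2.2 s) := hF a₀ rfl s hs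
    rw [if_pos ((hsame F).2 hF), if_pos hF, hg, h2, mul_assoc]
  · rw [if_neg (mt (hsame F).1 hF), if_neg hF, zero_mul]

section Continuation

variable {l r k N : ℕ} {supp : Fin l ⊕ Fin r → Finset (Fin (r + k) →₀ ℕ)}
  {O : Set ((Fin (r + k) → ℂ) × (CoeffIndex supp → ℂ) × (Fin r → ℂ))}
  {Ψ : (Fin (r + k) → ℂ) × (CoeffIndex supp → ℂ) × (Fin r → ℂ) → Fin (r + k) → ℂ}
  {C₀ : TwistedChain supp N} {lam : Fin l → ℂ} {β : Fin (r + k) → ℂ}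
  {U : Set (CoeffIndex supp → ℂ)} {a₀ : CoeffIndex supp → ℂ}

theorem continuousOn_factor_comp {X : Type*} [TopologicalSpace X] {D : Set X}
    {f : X → CoeffIndex supp → ℂ} {g : X → Fin (r + k) → ℂ} (hf : ContinuousOn f D)
    (hg : ContinuousOn g D) (q : Fin l ⊕ Fin (r + k)) :
    ContinuousOn (fun x => factor supp (f x) (g x) q) D := fun x hx =>
  ContinuousAt.comp_continuousWithinAt (f := fun x => (f x, g x))
    (g := fun p : (CoeffIndex supp → ℂ) × (Fin (r + k) → ℂ) => factor supp p.1 p.2 q)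
    (contDiff_factor supp q).continuous.continuousAt ((hf x hx).prodMk (hg x hx))

/-- The normal derivatives of the tube are vectors dual to the `df_e`, so regularity of the nearby
varieties comes for free. -/
theorem IsTube.linearIndependent (hΨ : IsTube supp O Ψ) {x : Fin (r + k) → ℂ}
    {b : CoeffIndex supp → ℂ} {w : Fin r → ℂ} (hp : (x, b, w) ∈ O) :
    LinearIndependent ℂ fun e => differential (poly supp b (Sum.inr e)) (Ψ (x, b, w)) := by
  rw [Fintype.linearIndependent_iff]
  intro g hg e
  have h1 := LinearMap.congr_fun hg (fderiv ℝ Ψ (x, b, w) (0, 0, Pi.single e 1))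
  simpa [LinearMap.sum_apply, hΨ.differential_fderiv hp, Pi.single_apply] using h1

open Classical in
/-- The continuation of a section of the local system along the tube. -/
def sectContinuation (lam : Fin l → ℂ) (β : Fin (r + k) → ℂ)
    (Ψ : (Fin (r + k) → ℂ) × (CoeffIndex supp → ℂ) × (Fin r → ℂ) → Fin (r + k) → ℂ)
    (a₀ a : CoeffIndex supp → ℂ) (x : Fin (r + k) → ℂ) : ℂ :=
  Complex.exp (∑ q, if IsNat (factorExponent lam β q) then 0 else factorExponent lam β q *
    Complex.log (factor supp a (Ψ (x, a, 0)) q / factor supp a₀ x q))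

/-- The continuation of a cycle to nearby coefficients. -/
def TwistedChain.continuation (C₀ : TwistedChain supp N) (lam : Fin l → ℂ) (β : Fin (r + k) → ℂ)
    (Ψ : (Fin (r + k) → ℂ) × (CoeffIndex supp → ℂ) × (Fin r → ℂ) → Fin (r + k) → ℂ)
    (a₀ : CoeffIndex supp → ℂ) : TwistedChain supp N where
  cube i a t := Ψ (C₀.cube i a₀ t, a, 0)
  sect i a t := C₀.sect i a₀ t * sectContinuation lam β Ψ a₀ a (C₀.cube i a₀ t)

theorem TwistedChain.IsCycleOn.continuation_agreeAt (hC : C₀.IsCycleOn lam β {a₀})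
    (hΨ : IsTube supp O Ψ) (hO : ∀ i, ∀ t ∈ unitCube k, (C₀.cube i a₀ t, a₀, (0 : Fin r → ℂ)) ∈ O) :
    (C₀.continuation lam β Ψ a₀).AgreeAt C₀ a₀ := by
  intro i t ht
  have hvar := hC.mem_variety i a₀ rfl t ht
  have h1 : Ψ (C₀.cube i a₀ t, a₀, 0) = C₀.cube i a₀ t :=
    hΨ.retract _ _ (hO i t ht) (polyVal_eq_zero_of_mem_variety hvar)
  refine ⟨h1, ?_⟩
  have h2 : sectContinuation lam β Ψ a₀ a₀ (C₀.cube i a₀ t) = 1 := by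
    rw [sectContinuation, h1, ← Complex.exp_zero]
    congr 1
    refine Finset.sum_eq_zero fun q _ => ?_
    split_ifs with hq
    · rfl
    · rw [div_self (hvar.2.2 q hq), Complex.log_one, mul_zero]
  simp only [continuation, h2, mul_one]

theorem TwistedChain.IsCycleOn.continuation_isCycleOn (hC : C₀.IsCycleOn lam β {a₀})
    (hΨ : IsTube supp O Ψ) (ha₀ : a₀ ∈ U)
    (hO : ∀ a ∈ U, ∀ i, ∀ t ∈ unitCube k, (C₀.cube i a₀ t, a, (0 : Fin r → ℂ)) ∈ O)
    (hslit : ∀ a ∈ U, ∀ i, ∀ t ∈ unitCube k, ∀ q, ¬ IsNat (factorExponent lam β q) →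
      factor supp a (Ψ (C₀.cube i a₀ t, a, 0)) q / factor supp a₀ (C₀.cube i a₀ t) q ∈
        Complex.slitPlane) :
    (C₀.continuation lam β Ψ a₀).IsCycleOn lam β U := by
  have hsm : ∀ i, ContDiffOn ℝ ∞ (fun y : (CoeffIndex supp → ℂ) × (Fin k → ℝ) => C₀.cube i a₀ y.2)
      (U ×ˢ unitCube k) := fun i =>
    (hC.smooth i).comp (f := fun y : (CoeffIndex supp → ℂ) × (Fin k → ℝ) => (a₀, y.2))
      (contDiff_const.prodMk contDiff_snd).contDiffOn fun y hy => ⟨rfl, hy.2⟩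
  have hcube : ∀ i, ContDiffOn ℝ ∞ (fun y : (CoeffIndex supp → ℂ) × (Fin k → ℝ) =>
      Ψ (C₀.cube i a₀ y.2, y.1, 0)) (U ×ˢ unitCube k) := fun i =>
    hΨ.smooth.comp (f := fun y : (CoeffIndex supp → ℂ) × (Fin k → ℝ) =>
      (C₀.cube i a₀ y.2, y.1, (0 : Fin r → ℂ)))
      ((hsm i).prodMk (contDiff_fst.prodMk contDiff_const).contDiffOn)
      fun y hy => hO y.1 hy.1 i y.2 hy.2
  refine ⟨hcube, ?_, ?_, ?_⟩
  · intro i a ha t ht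
    refine ⟨fun e => ?_, hΨ.linearIndependent (hO a ha i t ht), fun q hq h0 => ?_⟩
    · rw [← polyVal_def]
      exact hΨ.value _ (hO a ha i t ht) e
    · have h1 := hslit a ha i t ht q hq
      change factor supp a (Ψ (C₀.cube i a₀ t, a, 0)) q = 0 at h0
      rw [h0, zero_div] at h1
      exact Complex.zero_notMem_slitPlane h1
  · rintro i ⟨a, t⟩ ⟨ha, ht⟩
    obtain ⟨W, hW, c, ℓ, hℓ, hg⟩ := hC.horizontal i (a₀, t) ⟨rfl, ht⟩
    let π : (CoeffIndex supp → ℂ) × (Fin k → ℝ) → (CoeffIndex supp → ℂ) × (Fin k → ℝ) :=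
      fun y => (a₀, y.2)
    have hπ : Continuous π := by fun_prop
    have hπ' : MapsTo π (U ×ˢ unitCube k) ({a₀} ×ˢ unitCube k) := fun y hy => ⟨rfl, hy.2⟩
    have hW' : π ⁻¹' W ∈ 𝓝[U ×ˢ unitCube k] (a, t) :=
      (hπ.continuousWithinAt.tendsto_nhdsWithin hπ') hW
    -- The old logarithms at `a₀` are continued by adding the principal logarithm of the ratio of
    -- new to old factor; the local constant `c` is unchanged.
    refine ⟨π ⁻¹' W ∩ U ×ˢ unitCube k, inter_mem hW' self_mem_nhdsWithin, c, fun q y =>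
      ℓ q (π y) + Complex.log (factor supp y.1 (Ψ (C₀.cube i a₀ y.2, y.1, 0)) q /
        factor supp a₀ (C₀.cube i a₀ y.2) q), ?_, ?_⟩
    · intro q hq
      refine ⟨((hℓ q hq).1.comp hπ.continuousOn fun y hy => hy.1).add ?_, fun y hy => ?_⟩
      · refine ContinuousOn.clog (ContinuousOn.div ?_ ?_ ?_) fun y hy =>
          hslit y.1 hy.2.1 i y.2 hy.2.2 q hq
        · exact continuousOn_factor_comp continuousOn_fst
            ((hcube i).continuousOn.mono inter_subset_right) q
        · exact continuousOn_factor_comp (f := fun _ => a₀) continuousOn_const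
            ((hsm i).continuousOn.mono inter_subset_right) q
        · exact fun y hy => (hC.mem_variety i a₀ rfl y.2 hy.2.2).2.2 q hq
      · rw [Complex.exp_add, (hℓ q hq).2 _ hy.1,
          Complex.exp_log (Complex.slitPlane_ne_zero (hslit y.1 hy.2.1 i y.2 hy.2.2 q hq))]
        exact mul_div_cancel₀ _ ((hC.mem_variety i a₀ rfl y.2 hy.2.2).2.2 q hq)
    · intro y hy
      have h1 : C₀.sect i a₀ y.2 = _ := hg _ hy.1
      change C₀.sect i a₀ y.2 * sectContinuation lam β Ψ a₀ y.1 (C₀.cube i a₀ y.2) = _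
      rw [h1, sectContinuation, mul_assoc, ← Complex.exp_add, ← Finset.sum_add_distrib]
      congr 3
      ext q
      split_ifs
      · simp
      · ring
  · exact hC.closed.of_deformation ha₀ (fun a x => Ψ (x, a, 0)) (sectContinuation lam β Ψ a₀)
      (fun _ _ _ => rfl) (fun _ _ _ => rfl)
      fun i t ht => hΨ.retract _ _ (hO a₀ ha₀ i t ht)
        (polyVal_eq_zero_of_mem_variety (hC.mem_variety i a₀ rfl t ht))

/-- Every cycle can be continued along with the coefficients. -/
theorem TwistedChain.IsCycleOn.exists_continuation (hC : C₀.IsCycleOn lam β {a₀}) :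
    ∃ U : Set (CoeffIndex supp → ℂ), IsOpen U ∧ a₀ ∈ U ∧
      ∃ C : TwistedChain supp N, C.IsCycleOn lam β U ∧ C.AgreeAt C₀ a₀ := by
  obtain ⟨O, Ψ, hΨ, hO⟩ := hC.exists_isTube (mem_singleton a₀)
  have hK : IsCompact (C₀.support a₀) := hC.isCompact_support (mem_singleton a₀)
  have h1 : ∀ᶠ a in 𝓝 a₀, ∀ x ∈ C₀.support a₀, (x, a, (0 : Fin r → ℂ)) ∈ O ∧
      ∀ q, ¬ IsNat (factorExponent lam β q) →
        factor supp a (Ψ (x, a, 0)) q / factor supp a₀ x q ∈ Complex.slitPlane := by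
    refine hK.eventually_forall_of_forall_eventually fun x hx => ?_
    obtain ⟨i, t, ht, rfl⟩ := mem_iUnion.1 hx
    have hvar := hC.mem_variety i a₀ rfl t ht
    have hmem := hO i t ht
    have hcont : ContinuousAt (fun p : (CoeffIndex supp → ℂ) × (Fin (r + k) → ℂ) =>
        (p.2, p.1, (0 : Fin r → ℂ))) (a₀, C₀.cube i a₀ t) := by fun_prop
    refine Eventually.and ?_ (eventually_all.2 fun q => ?_)
    · exact hcont.eventually_mem (hΨ.isOpen.mem_nhds hmem)
    · by_cases hq : IsNat (factorExponent lam β q)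
      · exact Eventually.of_forall fun _ h => absurd hq h
      have h2 : ContinuousAt (fun p : (CoeffIndex supp → ℂ) × (Fin (r + k) → ℂ) =>
          Ψ (p.2, p.1, 0)) (a₀, C₀.cube i a₀ t) :=
        ContinuousAt.comp (g := Ψ) (f := fun p : (CoeffIndex supp → ℂ) × (Fin (r + k) → ℂ) =>
          (p.2, p.1, (0 : Fin r → ℂ))) (hΨ.contDiffAt hmem).continuousAt hcont
      have h3 := (continuousAt_factor_comp (supp := supp) continuousAt_fst h2 q).div
        (continuousAt_factor_comp (supp := supp) (f := fun _ => a₀) continuousAt_const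
          continuousAt_snd q) (hvar.2.2 q hq)
      refine (h3.eventually_mem (Complex.isOpen_slitPlane.mem_nhds ?_)).mono fun _ h _ => h
      simp only [Pi.div_apply]
      rw [hΨ.retract _ _ hmem (polyVal_eq_zero_of_mem_variety hvar), div_self (hvar.2.2 q hq)]
      exact Complex.one_mem_slitPlane
  obtain ⟨U, hU, hUo, ha₀⟩ := eventually_nhds_iff.1 h1
  refine ⟨U, hUo, ha₀, C₀.continuation lam β Ψ a₀, ?_, hC.continuation_agreeAt hΨ hO⟩
  exact hC.continuation_isCycleOn hΨ ha₀
    (fun a ha i t ht => (hU a ha _ (C₀.mem_support a₀ i ht)).1)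
    (fun a ha i t ht => (hU a ha _ (C₀.mem_support a₀ i ht)).2)

end Continuation

end GelfandLeray

end

theorem theorem3 (l r k : ℕ) (supp : Fin l ⊕ Fin r → Finset (Fin (r + k) →₀ ℕ))
    (lam : Fin l → ℂ) (β : Fin (r + k) → ℂ) :
    -- every cycle can be continued along with the coefficients
    (∀ (N : ℕ) (a₀ : GelfandLeray.CoeffIndex supp → ℂ) (C₀ : GelfandLeray.TwistedChain supp N),
      C₀.IsCycleOn lam β {a₀} →
      ∃ U : Set (GelfandLeray.CoeffIndex supp → ℂ), IsOpen U ∧ a₀ ∈ U ∧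
        ∃ C : GelfandLeray.TwistedChain supp N, C.IsCycleOn lam β U ∧ C.AgreeAt C₀ a₀) ∧
    -- near `a₀` the integral depends only on the cycle at `a₀`
    (∀ (N : ℕ) (U : Set (GelfandLeray.CoeffIndex supp → ℂ)), IsOpen U → ∀ a₀ ∈ U,
      ∀ C C' : GelfandLeray.TwistedChain supp N, C.IsCycleOn lam β U → C'.IsCycleOn lam β U →
      C.AgreeAt C' a₀ → ∀ᶠ a in 𝓝 a₀, C.integral lam β a = C'.integral lam β a) ∧
    -- the integral is an `A`-hypergeometric function of the coefficients
    (∀ (N : ℕ) (U : Set (GelfandLeray.CoeffIndex supp → ℂ)), IsOpen U →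
      ∀ C : GelfandLeray.TwistedChain supp N, C.IsCycleOn lam β U →
      GelfandLeray.IsAHypergeometricOn (GelfandLeray.exponentVector supp)
        (GelfandLeray.hypergeometricExponents lam β) U (C.integral lam β)) := by
  refine ⟨fun N a₀ C₀ hC => hC.exists_continuation, fun N U hU a₀ ha₀ C C' hC hC' h => ?_,
    fun N U hU C hC => hC.isAHypergeometricOn hU⟩
  exact GelfandLeray.eventually_integral_eq_of_agreeAt hU ha₀ hC hC' h
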